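/- **Setting.** Identify partitions $\lambda$ with Young diagrams. Let $\dim\lambda$ be the dimension of the irreducible complex representation of the symmetric group $S(|\lambda|)$ corresponding to $\lambda$, and for $\theta>0$ let $$M^\theta(\lambda)=e^{-\theta}\sum_{n\ge 0}\frac{\theta^n}{n!}M_n(\lambda)=e^{-\theta}\theta^{|\lambda|}\Big(\frac{\dim\lambda}{|\lambda|!}\Big)^2,$$ where $M_n(\lambda)=(\dim\lambda)^2/n!$ if $|\lambda|=n$ and $M_n(\lambda)=0$ otherwise (the poissonized Plancherel measure on the set of all partitions). The modified Frobenius coordinates of $\lambda$ are the elements of $$\operatorname{Fr}(\lambda)=\left(\{\lambda_i-i\}_{i\ge1}+\tfrac12\right)\,\triangle\,\left(\mathbb Z_{\le 0}-\tfrac12\right)\subset\mathbb Z+\tfrac12 ,$$ and the correlation functions are $\rho^\theta(X)=M^\theta(\{\lambda: X\subset\operatorname{Fr}(\lambda)\})$. Let $J_\nu=J_\nu(2\sqrt\theta)$ be the Bessel function of the first kind of order $\nu$ and argument $2\sqrt\theta$, put $$k_+(x,y)=J_{x-\frac12}J_{y+\frac12}-J_{x+\frac12}J_{y-\frac12},\qquad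 k_-(x,y)=J_{x-\frac12}J_{y-\frac12}+J_{x+\frac12}J_{y+\frac12},$$ and define for $x,y\in\mathbb Z+\frac12$ $$\mathsf K(x,y)=\begin{cases}\sqrt\theta\,\dfrac{k_+(|x|,|y|)}{|x|-|y|},& xy>0,\\[8pt] \sqrt\theta\,\dfrac{k_-(|x|,|y|)}{x-y},& xy<0,\end{cases}\qquad \mathsf L(x,y)=\begin{cases}0,& xy>0,\\[4pt] \dfrac1{x-y}\,\dfrac{\theta^{(|x|+|y|)/2}}{\Gamma(|x|+\frac12)\,\Gamma(|y|+\frac12)},& xy<0,\end{cases}$$ where $\mathsf K(x,x)$ is understood as the limit of $\sqrt\theta\,k_+(|x|,|t|)/(|x|-|t|)$ as $t\to x$, $t\ne x$, through real values $t$. **Theorem.** Let $\theta>0$. Then $M^\theta$ is a probability measure, the limits defining $\mathsf K(x,x)$ exist, and for every finite set $X=\{x_1,\dots,x_s\}\subset\mathbb Z+\frac12$ of $s$ distinct points, $$\rho^\theta(X)=\det\big[\mathsf K(x_i,x_j)\big]_{1\le i,j\le s}.$$ Moreover, for every such $X$, $$M^\theta(\{\lambda:\operatorname{Fr}(\lambda)=X\})=e^{-\theta}\det\big[\mathsf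 L(x_i,x_j)\big]_{1\le i,j\le s};$$ and $\mathsf L$ and $\mathsf K$ are the matrices of bounded operators on $\ell^2(\mathbb Z+\frac12)$ such that $1+\mathsf L$ is invertible and $\mathsf K=\mathsf L(1+\mathsf L)^{-1}$. -/

import Mathlib

open Filter Topology MeasureTheory

noncomputable section

namespace PoissonizedPlancherel

/-! ### Irreducible representations of the symmetric groups and the Plancherel measure

A partition is identified with its Young diagram. For a diagram `μ` with `n` cells we use
`Equiv.Perm μ.cells`, the symmetric group of the `n`-element set of cells, as the group `S(n)`.
This is the usual construction with a tableau of shape `μ`, without having to number the cells. -/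

/-- The row symmetrizer: the sum of all permutations of the cells that preserve every row. -/
def rowSymmetrizer (μ : YoungDiagram) : MonoidAlgebra ℂ (Equiv.Perm μ.cells) :=
  ∑ σ ∈ Finset.univ.filter (fun σ : Equiv.Perm μ.cells => ∀ c, (σ c).1.1 = c.1.1),
    MonoidAlgebra.single σ 1

/-- The column antisymmetrizer: the signed sum of all permutations of the cells that preserve
every column. -/
def columnAntisymmetrizer (μ : YoungDiagram) : MonoidAlgebra ℂ (Equiv.Perm μ.cells) :=
  ∑ σ ∈ Finset.univ.filter (fun σ : Equiv.Perm μ.cells => ∀ c, (σ c).1.2 = c.1.2),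
    MonoidAlgebra.single σ ((Equiv.Perm.sign σ : ℤ) : ℂ)

/-- The Young symmetrizer. -/
def youngSymmetrizer (μ : YoungDiagram) : MonoidAlgebra ℂ (Equiv.Perm μ.cells) :=
  rowSymmetrizer μ * columnAntisymmetrizer μ

/-- The irreducible complex representation of the symmetric group corresponding to `μ`: the left
ideal of the group algebra generated by the Young symmetrizer. -/
def irrep (μ : YoungDiagram) :
    Submodule (MonoidAlgebra ℂ (Equiv.Perm μ.cells)) (MonoidAlgebra ℂ (Equiv.Perm μ.cells)) :=
  Submodule.span _ {youngSymmetrizer μ}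

/-- `dim μ`, the dimension of the irreducible representation corresponding to `μ`. -/
def dimension (μ : YoungDiagram) : ℕ :=
  Module.finrank ℂ (irrep μ)

/-- The Plancherel measure `M_n`, as a weight function on all partitions
(it is concentrated on the partitions of `n`). -/
def plancherelWeight (n : ℕ) (μ : YoungDiagram) : ℝ :=
  if μ.card = n then (dimension μ : ℝ) ^ 2 / n.factorial else 0

/-- The weight of `μ` under the poissonized Plancherel measure with parameter `θ`. -/
def poissonizedWeight (θ : ℝ) (μ : YoungDiagram) : ℝ :=
  Real.exp (-θ) * ∑' n : ℕ, θ ^ n / n.factorial * plancherelWeight n μ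

theorem poissonizedWeight_eq (θ : ℝ) (μ : YoungDiagram) :
    poissonizedWeight θ μ =
      Real.exp (-θ) * θ ^ μ.card * ((dimension μ : ℝ) / μ.card.factorial) ^ 2 := by
  unfold poissonizedWeight
  rw [tsum_eq_single μ.card]
  · simp only [plancherelWeight, if_true]
    ring
  · intro n hn
    simp [plancherelWeight, Ne.symm hn]

instance : MeasurableSpace YoungDiagram := ⊤

/-- The poissonized Plancherel measure `M^θ` on the set of all partitions. -/
def poissonizedPlancherel (θ : ℝ) : Measure YoungDiagram :=
  Measure.sum fun μ => ENNReal.ofReal (poissonizedWeight θ μ) • Measure.dirac μ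

/-! ### Modified Frobenius coordinates and correlation functions -/

/-- The set `ℤ + 1/2`. -/
def halfIntegers : Set ℝ := Set.range fun n : ℤ => (n : ℝ) + 1 / 2

/-- The descent set `{μ_i - i : i = 1, 2, …}`; rows of a `YoungDiagram` are numbered from `0`. -/
def descentSet (μ : YoungDiagram) : Set ℤ :=
  Set.range fun i : ℕ => (μ.rowLen i : ℤ) - ((i : ℤ) + 1)

/-- The modified Frobenius coordinates: the symmetric difference of
`descentSet μ + 1/2` and `ℤ_{≤ 0} - 1/2`. -/
def modifiedFrobenius (μ : YoungDiagram) : Set ℝ :=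
  symmDiff ((fun n : ℤ => (n : ℝ) + 1 / 2) '' descentSet μ)
    ((fun n : ℤ => (n : ℝ) - 1 / 2) '' Set.Iic 0)

/-- The correlation function: the `M^θ`-probability that the modified Frobenius coordinates
contain `X`. -/
def correlation (θ : ℝ) (X : Set ℝ) : ℝ :=
  (poissonizedPlancherel θ).real {μ | X ⊆ modifiedFrobenius μ}

/-! ### The kernels -/

/-- The Bessel function `J_ν(z)` of the first kind, of real order `ν`, for `z > 0`. Note that
`Real.Gamma` is `0` at its poles, so that there the inverse is `0`, as it should be. -/
def besselJ (ν z : ℝ) : ℝ :=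
  ∑' m : ℕ, (-1) ^ m * ((m.factorial : ℝ) * Real.Gamma (m + ν + 1))⁻¹ * (z / 2) ^ (2 * (m : ℝ) + ν)

/-- The function `k_+`. -/
def kPlus (θ x y : ℝ) : ℝ :=
  besselJ (x - 1 / 2) (2 * √θ) * besselJ (y + 1 / 2) (2 * √θ) -
    besselJ (x + 1 / 2) (2 * √θ) * besselJ (y - 1 / 2) (2 * √θ)

/-- The function `k_-`. -/
def kMinus (θ x y : ℝ) : ℝ :=
  besselJ (x - 1 / 2) (2 * √θ) * besselJ (y - 1 / 2) (2 * √θ) +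
    besselJ (x + 1 / 2) (2 * √θ) * besselJ (y + 1 / 2) (2 * √θ)

/-- The kernel `K`. The quotient `k_+(|x|, |y|) / (|x| - |y|)` extends continuously (in the real
variable `y`, which enters through the orders of the Bessel functions) to `y = x`, and its value
on the diagonal is given by this extension. -/
def kernelK (θ x y : ℝ) : ℝ :=
  if 0 < x * y then
    if x = y then limUnder (𝓝[≠] x) fun t : ℝ => √θ * (kPlus θ |x| |t| / (|x| - |t|))
    else √θ * (kPlus θ |x| |y| / (|x| - |y|))
  else √θ * (kMinus θ |x| |y| / (x - y))

/-- The kernel `L`. -/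
def kernelL (θ x y : ℝ) : ℝ :=
  if 0 < x * y then 0
  else 1 / (x - y) *
    (θ ^ ((|x| + |y|) / 2) / (Real.Gamma (|x| + 1 / 2) * Real.Gamma (|y| + 1 / 2)))

/-- The Hilbert space `ℓ²(ℤ + 1/2)`. -/
abbrev HalfIntegerSpace : Type := lp (fun _ : halfIntegers => ℝ) 2

/-- `T` is the bounded operator on `ℓ²(ℤ + 1/2)` with kernel (matrix) `k`. -/
def IsOperatorOfKernel (T : HalfIntegerSpace →L[ℝ] HalfIntegerSpace) (k : ℝ → ℝ → ℝ) : Prop :=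
  ∀ (f : HalfIntegerSpace) (x : halfIntegers),
    HasSum (fun y : halfIntegers => k x y * f y) (T f x)

end PoissonizedPlancherel

end

open Filter Topology MeasureTheory

noncomputable section

namespace PoissonizedPlancherel

/-! ### Bessel functions of integer order -/

/-! The algebraic heart is the formula dim λ = |λ|! det[H(p_i, q_j)], where p and q are the arm and
leg lengths of the diagonal cells and H(p, q) = 1/((p+q+1) p! q!). In the coordinates k + 1/2 and
-(l + 1/2) the kernel L is the block matrix (0, D; -D, 0) with D(k, l) = η^(k+l+1) H(k, l) and η =
√θ. A principal minor of L vanishes unless it involves as many positive as negative points;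
otherwise it is a product of two determinants of D, that is θ^|λ| (dim λ / |λ|!)². Thus Fr(λ) is the
L-ensemble with normalization e^θ (`minor_frobSet`, `hasSum_minor_blockL`).

The dimension formula is proved by a squeeze (`dimension_eq`). The determinants f satisfy one
recursion for adding and one for removing a box (`frob_up`, `frob_down`). Pairing them along the
edges between neighbouring sizes gives ∑ f² = 1/n! over the diagrams with n cells (`sum_frob_sq`).
By the removal recursion n! f is at most the number of standard fillings (`exists_standard`), and
the fillings index linearly independent elements of the Young ideal (`IsTableau.card_le_youngDim`),
so n! f ≤ dim. Conversely the Young symmetrizers are mutually orthogonal quasi-idempotents in the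
weak, one-sided sense that still yields ∑ dim² ≤ n! (`sum_sq_dimension_le`). Hence equality holds
for each diagram, without complete reducibility or the hook formula.

For the correlations, the sum of the minors of a finite matrix M over all Y ⊇ X is det(1+M) times
the X-minor of M(1+M)⁻¹ (`sum_minors_eq`). As L is antisymmetric and dominated by a summable
product, the truncated resolvents converge (`tsum_minor_eq`), and only K + LK = L remains
(`hasSum_blockL_mul_blockK`). With K = (G, F; -F, G) this says DF = G and F + DG = D. Telescoping
the Bessel recurrence (`hasSum_of_recurrence`) writes G and F as sums of products of Bessel
functions, and D acts on these by one sum rule (`hasSum_blockD_mul_besselInt`). The same telescoping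
with one real order gives the diagonal limits, and antisymmetry also makes 1 + L coercive on ℓ². -/

theorem hasSum_of_eq {α : Type*} {f g : α → ℝ} {s t : ℝ} (h : HasSum f s) (hst : s = t)
    (hfg : ∀ x, g x = f x) : HasSum g t :=
  hst ▸ h.congr_fun hfg

/-- Fubini, in the form used for the Bessel convolutions and for the products DF and DG: both
iterated sums are known termwise, one of them in total. -/
theorem hasSum_of_hasSum_swap {α β : Type*} {f : α → β → ℝ}
    (hs : Summable fun p : α × β => f p.1 p.2) {g : β → ℝ} (hg : ∀ b, HasSum (fun a => f a b) (g b))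
    {h : α → ℝ} (hh : ∀ a, HasSum (f a) (h a)) {s : ℝ} (hgs : HasSum g s) : HasSum h s := by
  have h1 := hs.hasSum.prod_fiberwise hh
  have h2 : HasSum (fun p : β × α => f p.2 p.1) (∑' p : α × β, f p.1 p.2) :=
    (Equiv.prodComm β α).hasSum_iff.mpr hs.hasSum
  rwa [(h2.prod_fiberwise hg).unique hgs] at h1

/-- The coefficients of `exp (η z)`, extended by zero to all integer exponents. -/
def expCoeff (η : ℝ) (i : ℤ) : ℝ := if 0 ≤ i then η ^ i.toNat / i.toNat.factorial else 0

@[simp] theorem expCoeff_natCast (η : ℝ) (n : ℕ) : expCoeff η n = η ^ n / n.factorial := by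
  simp [expCoeff]

theorem expCoeff_of_neg (η : ℝ) {i : ℤ} (hi : i < 0) : expCoeff η i = 0 := by
  simp [expCoeff, not_le.mpr hi]

theorem expCoeff_zero (η : ℝ) : expCoeff η 0 = 1 := by simp [expCoeff]

theorem abs_expCoeff (η : ℝ) (i : ℤ) : |expCoeff η i| = expCoeff |η| i := by
  unfold expCoeff
  split_ifs <;> simp [abs_div, abs_pow]

theorem expCoeff_nonneg {η : ℝ} (hη : 0 ≤ η) (i : ℤ) : 0 ≤ expCoeff η i := by
  unfold expCoeff; split_ifs <;> positivity

theorem expCoeff_neg (η : ℝ) (i : ℤ) : expCoeff (-η) i = (-1) ^ i.natAbs * expCoeff η i := by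
  unfold expCoeff
  split_ifs with h
  · obtain ⟨n, rfl⟩ := Int.eq_ofNat_of_zero_le h
    simp [neg_pow η]; ring
  · simp

/-- The coefficients of z (d/dz) exp(ηz) = ηz exp(ηz); the source of the Bessel recurrence. -/
theorem int_mul_expCoeff (η : ℝ) (i : ℤ) : (i : ℝ) * expCoeff η i = η * expCoeff η (i - 1) := by
  rcases lt_trichotomy i 0 with h | h | h
  · rw [expCoeff_of_neg η h, expCoeff_of_neg η (by lia)]; simp
  · subst h; rw [expCoeff_of_neg η (by lia : (0 : ℤ) - 1 < 0)]; simp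
  · obtain ⟨n, rfl⟩ : ∃ n : ℕ, i = n + 1 := ⟨(i - 1).toNat, by lia⟩
    have : ((n : ℤ) + 1) = ((n + 1 : ℕ) : ℤ) := by simp
    rw [add_sub_cancel_right, this, expCoeff_natCast, expCoeff_natCast, Nat.factorial_succ]
    push_cast
    field_simp
    ring

theorem expCoeff_le_exp {η : ℝ} (hη : 0 ≤ η) (i : ℤ) : expCoeff η i ≤ Real.exp η := by
  unfold expCoeff
  split_ifs
  · exact Real.pow_div_factorial_le_exp η hη _
  · positivity

theorem hasSum_int_iff_nat {f : ℤ → ℝ} (hf : ∀ i < 0, f i = 0) {s : ℝ} :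
    HasSum f s ↔ HasSum (fun n : ℕ => f n) s := by
  refine (Function.Injective.hasSum_iff (g := ((↑) : ℕ → ℤ)) Nat.cast_injective ?_).symm
  intro x hx
  apply hf
  by_contra h
  exact hx ⟨x.toNat, by simp; lia⟩

theorem summable_expCoeff (η : ℝ) : Summable (expCoeff η) := by
  have h : HasSum (fun n : ℕ => expCoeff η n) (Real.exp η) := by
    simp only [expCoeff_natCast]
    rw [Real.exp_eq_exp_ℝ]
    exact NormedSpace.expSeries_div_hasSum_exp η
  exact ((hasSum_int_iff_nat fun i hi => expCoeff_of_neg η hi).mpr h).summable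

theorem abs_expCoeff_le (η : ℝ) (i : ℤ) : |expCoeff η i| ≤ Real.exp |η| := by
  rw [abs_expCoeff]; exact expCoeff_le_exp (abs_nonneg η) i

theorem summable_abs_expCoeff (η : ℝ) : Summable fun i => |expCoeff η i| := by
  simp only [abs_expCoeff]; exact summable_expCoeff _

theorem expCoeff_add_le {η : ℝ} (hη : 0 ≤ η) (m n : ℕ) :
    expCoeff η ((m : ℤ) + n) ≤ expCoeff η m * expCoeff η n := by
  have : ((m : ℤ) + n) = ((m + n : ℕ) : ℤ) := by simp
  rw [this, expCoeff_natCast, expCoeff_natCast, expCoeff_natCast, pow_add, div_mul_div_comm]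
  gcongr
  exact_mod_cast Nat.le_of_dvd (Nat.factorial_pos _) (Nat.factorial_mul_factorial_dvd_factorial_add m n)

/-- `exp (-η z) * exp (η z) = 1` on the level of coefficients. -/
theorem hasSum_expCoeff_conv (η : ℝ) (N : ℤ) :
    HasSum (fun l => expCoeff (-η) l * expCoeff η (N - l)) (if N = 0 then 1 else 0) := by
  rw [hasSum_int_iff_nat fun i hi => by rw [expCoeff_of_neg _ hi, zero_mul]]
  rcases lt_or_ge N 0 with hN | hN
  · rw [if_neg (by lia)]
    convert hasSum_zero with l
    rw [expCoeff_of_neg η (by lia), mul_zero]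
  · obtain ⟨n, rfl⟩ := Int.eq_ofNat_of_zero_le hN
    have key : ∑ l ∈ Finset.range (n + 1), expCoeff (-η) (l : ℤ) * expCoeff η ((n : ℤ) - l) =
        if (n : ℤ) = 0 then 1 else 0 := by
      have h1 : ∀ l ∈ Finset.range (n + 1), expCoeff (-η) (l : ℤ) * expCoeff η ((n : ℤ) - l) =
          ((-η) ^ l * η ^ (n - l) * (n.choose l)) / n.factorial := by
        intro l hl
        have hl' : l ≤ n := by simpa [Nat.lt_succ_iff] using hl
        rw [← Nat.cast_sub hl', expCoeff_natCast, expCoeff_natCast, Nat.cast_choose ℝ hl']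
        field_simp
      rw [Finset.sum_congr rfl h1, ← Finset.sum_div, ← add_pow]
      rcases Nat.eq_zero_or_pos n with h | h
      · simp [h]
      · simp [h.ne']
    rw [← key]
    refine hasSum_sum_of_ne_finset_zero fun l hl => ?_
    have : n < l := by simpa using hl
    rw [expCoeff_of_neg η (by lia), mul_zero]

/-- The Bessel function of integer order `n` at `2 * η`. -/
def besselInt (η : ℝ) (n : ℤ) : ℝ := ∑' j : ℤ, expCoeff (-η) j * expCoeff η (n + j)

theorem hasSum_besselInt (η : ℝ) (n : ℤ) :
    HasSum (fun j : ℤ => expCoeff (-η) j * expCoeff η (n + j)) (besselInt η n) := by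
  refine Summable.hasSum (Summable.of_norm_bounded
    (g := fun j => |expCoeff (-η) j| * Real.exp |η|) ((summable_abs_expCoeff _).mul_right _) ?_)
  intro j
  rw [Real.norm_eq_abs, abs_mul]
  gcongr
  exact abs_expCoeff_le _ _

/-- The coefficient of z^n in exp(-ηz) · exp(η(z - 1/z)) = exp(-η/z), the second factor being the
generating function of the Bessel functions. -/
theorem hasSum_expCoeff_mul_besselInt (η : ℝ) (n : ℤ) :
    HasSum (fun l => expCoeff (-η) l * besselInt η (n - l)) (expCoeff (-η) (-n)) := by
  refine hasSum_of_hasSum_swap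
    (f := fun l j => expCoeff (-η) l * (expCoeff (-η) j * expCoeff η (n - l + j)))
    (g := fun j => expCoeff (-η) j * if n + j = 0 then 1 else 0) ?_ ?_
    (fun l => (hasSum_besselInt η (n - l)).mul_left _) ?_
  · refine Summable.of_norm_bounded
      (g := fun p : ℤ × ℤ => |expCoeff (-η) p.1| * (|expCoeff (-η) p.2| * Real.exp |η|)) ?_ ?_
    · exact (summable_abs_expCoeff _).mul_of_nonneg ((summable_abs_expCoeff _).mul_right _)
        (fun _ => abs_nonneg _) (fun _ => by positivity)
    · intro p
      rw [Real.norm_eq_abs, abs_mul, abs_mul]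
      gcongr
      exact abs_expCoeff_le _ _
  · intro j
    refine ((hasSum_expCoeff_conv η (n + j)).mul_left (expCoeff (-η) j)).congr_fun ?_
    intro l
    rw [show n - l + j = n + j - l by ring]; ring
  · convert hasSum_ite_eq (-n) (expCoeff (-η) (-n)) using 2 with j
    by_cases h : j = -n
    · simp [h]
    · rw [if_neg (by lia), if_neg h, mul_zero]

/-- The shift j ↦ j + n exchanges the roles of the two exponential coefficients; the signs come from
η ↦ -η. -/
theorem besselInt_neg (η : ℝ) (n : ℤ) : besselInt η (-n) = (-1) ^ n.natAbs * besselInt η n := by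
  refine (hasSum_besselInt η (-n)).unique ?_
  rw [← (Equiv.addRight n).hasSum_iff]
  refine ((hasSum_besselInt η n).mul_left ((-1) ^ n.natAbs)).congr_fun fun i => ?_
  simp only [Function.comp_apply, Equiv.coe_addRight]
  rw [show -n + (i + n) = i by ring, expCoeff_neg, expCoeff_neg, add_comm n i]
  have : ((-1 : ℝ)) ^ (i + n).natAbs = (-1) ^ n.natAbs * (-1) ^ i.natAbs := by
    rw [← pow_add]
    rcases Int.even_or_odd i with hi | hi <;> rcases Int.even_or_odd n with hn | hn
    all_goals
      first
      | rw [Even.neg_one_pow, Even.neg_one_pow] <;> grind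
      | rw [Odd.neg_one_pow, Odd.neg_one_pow] <;> grind
  rw [this]; ring

/-- Write n = (n + j) - j under the sum and let each summand differentiate its own exponential. -/
theorem besselInt_recurrence (η : ℝ) (n : ℤ) :
    η * (besselInt η (n - 1) + besselInt η (n + 1)) = n * besselInt η n := by
  have h1 := (hasSum_besselInt η (n - 1)).mul_left η
  have h2 : HasSum (fun j : ℤ => η * (expCoeff (-η) (j - 1) * expCoeff η (n + j)))
      (η * besselInt η (n + 1)) := by
    rw [← (Equiv.addRight (1 : ℤ)).hasSum_iff]
    refine ((hasSum_besselInt η (n + 1)).mul_left η).congr_fun fun i => ?_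
    simp only [Function.comp_apply, Equiv.coe_addRight]
    rw [add_sub_cancel_right, show n + (i + 1) = n + 1 + i by ring]
  rw [mul_add]
  refine (h1.add h2).unique ?_
  refine ((hasSum_besselInt η n).mul_left (n : ℝ)).congr_fun fun j => ?_
  have e1 := int_mul_expCoeff η (n + j)
  have e2 := int_mul_expCoeff (-η) j
  rw [show n - 1 + j = n + j - 1 by ring]
  push_cast at e1
  linear_combination (-expCoeff (-η) j) * e1 + expCoeff η (n + j) * e2

/-- A constant for the super-exponential decay of the Bessel functions. -/
def besselConst (η : ℝ) : ℝ := ∑' j : ℤ, |expCoeff (-η) j| * |expCoeff η j|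

theorem besselConst_nonneg (η : ℝ) : 0 ≤ besselConst η := tsum_nonneg fun _ => by positivity

/-- The inequality 1/(n+j)! ≤ 1/(n! j!) separates the order from the summation index. -/
theorem abs_besselInt_natCast_le {η : ℝ} (hη : 0 ≤ η) (n : ℕ) :
    |besselInt η n| ≤ besselConst η * expCoeff η n := by
  have hs : Summable fun j : ℤ => |expCoeff (-η) j| * |expCoeff η j| :=
    Summable.of_nonneg_of_le (fun _ => by positivity)
      (fun j => mul_le_mul_of_nonneg_left (abs_expCoeff_le η j) (abs_nonneg _))
      ((summable_abs_expCoeff (-η)).mul_right (Real.exp |η|))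
  rw [← (hasSum_besselInt η n).tsum_eq, besselConst, ← tsum_mul_right, ← Real.norm_eq_abs]
  refine tsum_of_norm_bounded (hs.mul_right (expCoeff η n)).hasSum fun j => ?_
  rw [Real.norm_eq_abs, abs_mul, mul_assoc]
  rcases lt_or_ge j 0 with hj | hj
  · simp [expCoeff_of_neg _ hj]
  · gcongr
    obtain ⟨m, rfl⟩ := Int.eq_ofNat_of_zero_le hj
    rw [abs_expCoeff, abs_expCoeff, abs_of_nonneg hη, mul_comm]
    exact expCoeff_add_le hη n m

theorem abs_besselInt_le {η : ℝ} (hη : 0 ≤ η) (n : ℤ) :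
    |besselInt η n| ≤ besselConst η * expCoeff η n.natAbs := by
  rcases Int.natAbs_eq n with h | h
  · rw [h]; simpa using abs_besselInt_natCast_le hη n.natAbs
  · rw [h, besselInt_neg, abs_mul, abs_pow, abs_neg, abs_one, one_pow, one_mul]
    simpa using abs_besselInt_natCast_le hη n.natAbs

theorem summable_expCoeff_natAbs (η : ℝ) : Summable fun n : ℤ => expCoeff η n.natAbs := by
  have h : Summable fun n : ℕ => expCoeff η n :=
    (summable_expCoeff η).comp_injective Nat.cast_injective
  refine Summable.of_nat_of_neg (by simpa using h) (by simpa using h)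

theorem summable_abs_besselInt {η : ℝ} (hη : 0 ≤ η) : Summable fun n => |besselInt η n| :=
  Summable.of_nonneg_of_le (fun _ => abs_nonneg _) (abs_besselInt_le hη)
    ((summable_expCoeff_natAbs η).mul_left _)

theorem expCoeff_add_le_left {η : ℝ} (hη : 0 ≤ η) (m n : ℕ) :
    expCoeff η ((m : ℤ) + n) ≤ Real.exp η * expCoeff η m := by
  refine (expCoeff_add_le hη m n).trans ?_
  rw [mul_comm]
  exact mul_le_mul_of_nonneg_right (expCoeff_le_exp hη _) (expCoeff_nonneg hη _)

theorem abs_besselInt_le_const {η : ℝ} (hη : 0 ≤ η) (n : ℤ) :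
    |besselInt η n| ≤ besselConst η * Real.exp η :=
  (abs_besselInt_le hη n).trans
    (mul_le_mul_of_nonneg_left (expCoeff_le_exp hη _) (besselConst_nonneg η))

/-- The convolution identity `hasSum_expCoeff_mul_besselInt` reflected by J_{-n} = (-1)^n J_n. -/
theorem besselInt_sub_mul_expCoeff (η : ℝ) (N : ℤ) :
    HasSum (fun m => besselInt η m * expCoeff η (m + N)) (expCoeff η (-N)) := by
  have h := (hasSum_expCoeff_mul_besselInt η N).mul_left ((-1) ^ N.natAbs)
  rw [expCoeff_neg, Int.natAbs_neg, ← mul_assoc, ← pow_add, Even.neg_one_pow ⟨_, rfl⟩, one_mul] at h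
  rw [← (Equiv.addRight N).symm.hasSum_iff]
  refine h.congr_fun fun l => ?_
  simp only [Function.comp_apply, Equiv.addRight_symm, Equiv.coe_addRight]
  rw [show l + -N = -(N - l) by ring, besselInt_neg, show -(N - l) + N = l by ring, expCoeff_neg]
  have : ((-1 : ℝ)) ^ (N - l).natAbs = (-1) ^ N.natAbs * (-1) ^ l.natAbs := by
    rw [← pow_add]
    rcases Int.even_or_odd l with hi | hi <;> rcases Int.even_or_odd N with hn | hn
    all_goals
      first
      | rw [Even.neg_one_pow, Even.neg_one_pow] <;> grind
      | rw [Odd.neg_one_pow, Odd.neg_one_pow] <;> grind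
  rw [this]; ring

/-- For Φ(z) = exp(η(z - 1/z)) one has Φ(z) Φ(1/z) = 1. Expanding just the second Bessel function
reduces this to exp(-ηz) exp(ηz) = 1. -/
theorem hasSum_besselInt_orthogonality {η : ℝ} (hη : 0 ≤ η) (d : ℤ) :
    HasSum (fun m => besselInt η m * besselInt η (m + d)) (if d = 0 then 1 else 0) := by
  refine hasSum_of_hasSum_swap
    (f := fun m j => besselInt η m * (expCoeff (-η) j * expCoeff η (m + d + j)))
    (g := fun j => expCoeff (-η) j * expCoeff η (-d - j)) ?_ ?_
    (fun m => (hasSum_besselInt η (m + d)).mul_left _) ?_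
  · refine Summable.of_norm_bounded
      (g := fun p : ℤ × ℤ => |besselInt η p.1| * (|expCoeff (-η) p.2| * Real.exp |η|)) ?_ ?_
    · exact (summable_abs_besselInt hη).mul_of_nonneg ((summable_abs_expCoeff _).mul_right _)
        (fun _ => abs_nonneg _) (fun _ => by positivity)
    · intro p
      rw [Real.norm_eq_abs, abs_mul, abs_mul]
      gcongr
      exact abs_expCoeff_le _ _
  · intro j
    have := (besselInt_sub_mul_expCoeff η (d + j)).mul_left (expCoeff (-η) j)
    rw [show -(d + j) = -d - j by ring] at this
    refine this.congr_fun fun m => ?_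
    rw [← add_assoc]; ring
  · simpa using hasSum_expCoeff_conv η (-d)

/-! ### The off-diagonal block of the kernel `L` -/

/-- The off-diagonal block of `L` in the coordinates `k + 1/2`, `-(l + 1/2)`. -/
def blockD (η : ℝ) (k l : ℕ) : ℝ := η ^ (k + l + 1) / ((k + l + 1) * k.factorial * l.factorial)

theorem blockD_symm (η : ℝ) (k l : ℕ) : blockD η k l = blockD η l k := by
  unfold blockD; rw [add_comm k l, add_comm (k : ℝ) l]; ring_nf

/-- Since (k+1) + (l+1) = k + l + 2, the sum D(k+1, l) + D(k, l+1) is a product of a function of k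
and one of l. This allows induction on the row index. -/
theorem blockD_succ (η : ℝ) (k l : ℕ) : blockD η (k + 1) l =
    η ^ (k + l + 2) / ((k + 1).factorial * (l + 1).factorial) - blockD η k (l + 1) := by
  unfold blockD
  rw [Nat.factorial_succ, Nat.factorial_succ, show k + 1 + l + 1 = k + l + 2 by ring,
    show k + (l + 1) + 1 = k + l + 2 by ring]
  push_cast
  rw [show (k : ℝ) + 1 + l + 1 = k + l + 2 by ring, show (k : ℝ) + (l + 1) + 1 = k + l + 2 by ring]
  field_simp
  ring

theorem blockD_zero_right (η : ℝ) (k : ℕ) : blockD η k 0 = η ^ (k + 1) / (k + 1).factorial := by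
  unfold blockD
  rw [Nat.factorial_succ]
  push_cast
  simp

theorem abs_blockD_le {η : ℝ} (hη : 0 ≤ η) (k l : ℕ) :
    |blockD η k l| ≤ η * (expCoeff η k * expCoeff η l) := by
  unfold blockD
  rw [abs_of_nonneg (by positivity), expCoeff_natCast, expCoeff_natCast, div_mul_div_comm,
    ← mul_div_assoc]
  rw [show η * (η ^ k * η ^ l) = η ^ (k + l + 1) by ring]
  gcongr
  have h1 : (0 : ℝ) ≤ k := by positivity
  have h2 : (0 : ℝ) ≤ l := by positivity
  have h3 : (0 : ℝ) ≤ k.factorial := by positivity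
  nlinarith

/-- For m ≥ 1 the series exp(-η/z) has no term z^m; the term l = 0 of the convolution is moved to
the right-hand side. -/
theorem hasSum_besselInt_nat {η : ℝ} {m : ℤ} (hm : 1 ≤ m) :
    HasSum (fun l : ℕ => expCoeff (-η) (l + 1 : ℕ) * besselInt η (m - 1 - l))
      (-besselInt η m) := by
  have h := hasSum_expCoeff_mul_besselInt η m
  rw [expCoeff_of_neg (-η) (by lia : -m < 0),
    hasSum_int_iff_nat fun i hi => by rw [expCoeff_of_neg _ hi, zero_mul],
    ← hasSum_nat_add_iff' 1] at h
  simp only [Finset.range_one, Finset.sum_singleton, Nat.cast_zero, expCoeff_zero, one_mul,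
    sub_zero, zero_sub] at h
  refine h.congr_fun fun l => ?_
  rw [show m - 1 - (l : ℤ) = m - ((l + 1 : ℕ) : ℤ) by push_cast; ring]

/-- The sum rule behind both block identities: D carries the alternating Bessel sequence of
nonincreasing orders m-1, m-2, … to J_{k+m}. -/
theorem hasSum_blockD_mul_besselInt (η : ℝ) (k : ℕ) : ∀ m : ℤ, 1 ≤ m →
    HasSum (fun l : ℕ => blockD η k l * ((-1) ^ l * besselInt η (m - 1 - l)))
      (besselInt η (k + m)) := by
  induction k with
  | zero =>
    intro m hm
    simpa using (hasSum_besselInt_nat (η := η) hm).neg.congr_fun fun l => by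
      rw [blockD_symm, blockD_zero_right, expCoeff_natCast, neg_pow η, pow_succ (-1 : ℝ)]
      ring
  | succ k ih =>
    intro m hm
    have h1 := ih (m + 1) (by lia)
    -- The split-off term D(k, 0) J_m cancels against the sum of the factorized part of D(k+1, ·).
    rw [← hasSum_nat_add_iff' 1] at h1
    have h2 := (hasSum_besselInt_nat (η := η) hm).mul_left (-(η ^ (k + 1) / (k + 1).factorial))
    have h3 := h2.add h1
    simp only [Finset.range_one, Finset.sum_singleton, blockD_zero_right, pow_zero, Nat.cast_zero,
      one_mul, sub_zero, add_sub_cancel_right] at h3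
    refine hasSum_of_eq h3 ?_ fun l => ?_
    · push_cast
      rw [show (k : ℤ) + 1 + m = k + (m + 1) by ring]
      ring
    · rw [blockD_succ, expCoeff_natCast, neg_pow η,
        show m - ((l + 1 : ℕ) : ℤ) = m - 1 - l by push_cast; ring,
        show k + l + 2 = (k + 1) + (l + 1) by ring, pow_add η (k + 1)]
      field_simp
      ring

/-! ### The blocks of the kernel `K` -/

/-- The diagonal blocks of `K`. -/
def blockG (η : ℝ) (k l : ℕ) : ℝ :=
  ∑' m : ℕ, besselInt η (k + (m + 1)) * besselInt η (l + (m + 1))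

/-- The off-diagonal block of `K`. -/
def blockF (η : ℝ) (k l : ℕ) : ℝ :=
  η * (besselInt η k * besselInt η l + besselInt η (k + 1) * besselInt η (l + 1)) / (k + l + 1)

theorem blockF_symm (η : ℝ) (k l : ℕ) : blockF η k l = blockF η l k := by
  unfold blockF; rw [add_comm (k : ℝ) l]; ring_nf

/-- A Christoffel–Darboux argument: η times the difference of consecutive Casoratians u_m v_{m+1} -
u_{m+1} v_m is (α - β) u_{m+1} v_{m+1}, and the sum telescopes. The orders may be real. -/
theorem hasSum_of_recurrence {η α β : ℝ} {u v : ℕ → ℝ}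
    (hu : ∀ m : ℕ, η * (u m + u (m + 2)) = (α + m) * u (m + 1))
    (hv : ∀ m : ℕ, η * (v m + v (m + 2)) = (β + m) * v (m + 1))
    (hs : Summable fun m => u m * v (m + 1)) (hs' : Summable fun m => u (m + 1) * v m) :
    HasSum (fun m => (α - β) * (u (m + 1) * v (m + 1))) (η * (u 0 * v 1 - u 1 * v 0)) := by
  have h1 := (hs.sub hs').hasSum
  have h2 := h1
  rw [← hasSum_nat_add_iff' 1] at h2
  have h3 := (h1.sub h2).mul_left η
  simp only [Finset.range_one, Finset.sum_singleton, sub_sub_cancel, zero_add] at h3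
  refine h3.congr_fun fun m => ?_
  linear_combination (-v (m + 1)) * hu m + u (m + 1) * hv m

theorem summable_besselInt_mul {η : ℝ} (hη : 0 ≤ η) {f g : ℕ → ℤ} (hf : Function.Injective f) :
    Summable fun m => besselInt η (f m) * besselInt η (g m) := by
  refine Summable.of_norm_bounded
    (((summable_abs_besselInt hη).comp_injective hf).mul_right (besselConst η * Real.exp η)) ?_
  intro m
  rw [Real.norm_eq_abs, abs_mul]
  exact mul_le_mul_of_nonneg_left (abs_besselInt_le_const hη _) (abs_nonneg _)

theorem hasSum_besselInt_mul {η : ℝ} (hη : 0 ≤ η) (a b : ℤ) :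
    HasSum (fun m : ℕ => ((a : ℝ) - b) * (besselInt η (a + (m + 1)) * besselInt η (b + (m + 1))))
      (η * (besselInt η a * besselInt η (b + 1) - besselInt η (a + 1) * besselInt η b)) := by
  have hr : ∀ (a : ℤ) (m : ℕ), η * (besselInt η (a + m) + besselInt η (a + (m + 2 : ℕ))) =
      (((a : ℝ) + 1) + m) * besselInt η (a + (m + 1 : ℕ)) := by
    intro a m
    have := besselInt_recurrence η (a + m + 1)
    push_cast at this ⊢
    rw [show a + (m : ℤ) + 1 - 1 = a + m by ring, show a + (m : ℤ) + 1 + 1 = a + (m + 2) by ring,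
      show a + (m : ℤ) + 1 = a + (m + 1) by ring] at this
    rw [this]; ring
  have inj : ∀ c : ℤ, Function.Injective fun m : ℕ => c + (m : ℤ) := fun c m n h => by
    simpa using h
  have := hasSum_of_recurrence (u := fun m : ℕ => besselInt η (a + m))
    (v := fun m : ℕ => besselInt η (b + m)) (hr a) (hr b)
    (summable_besselInt_mul hη (inj a)) (by
      have := summable_besselInt_mul (g := fun m : ℕ => a + ((m + 1 : ℕ) : ℤ)) hη (inj b)
      simpa only [mul_comm] using this)
  simpa using this

theorem blockG_eq {η : ℝ} (hη : 0 ≤ η) {k l : ℕ} (h : k ≠ l) :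
    blockG η k l = η * ((besselInt η k * besselInt η (l + 1) -
      besselInt η (k + 1) * besselInt η l) / (k - l)) := by
  have h0 : ((k : ℝ) - l) ≠ 0 := sub_ne_zero.mpr (by exact_mod_cast h)
  have := (hasSum_besselInt_mul hη k l).tsum_eq
  rw [tsum_mul_left] at this
  rw [← mul_div_assoc, eq_div_iff h0, blockG, ← this]
  push_cast
  ring

theorem summable_blockG {η : ℝ} (hη : 0 ≤ η) (k l : ℕ) :
    Summable fun m : ℕ => besselInt η (k + (m + 1)) * besselInt η (l + (m + 1)) :=
  summable_besselInt_mul hη fun m n h => by simpa using h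

/-- Christoffel–Darboux with second order -1-l: the difference of orders is then k + l + 1, and
reflection turns the minus sign of the boundary term into a plus. -/
theorem hasSum_blockF {η : ℝ} (hη : 0 ≤ η) (k l : ℕ) :
    HasSum (fun m : ℕ => ((-1) ^ l * besselInt η (m - l)) * besselInt η (k + (m + 1)))
      (blockF η k l) := by
  have h := (hasSum_besselInt_mul hη k (-1 - l)).mul_left ((-1 : ℝ) ^ l / (k + l + 1))
  have e0 : besselInt η (-1 - l) = (-1) ^ (l + 1) * besselInt η (l + 1) := by
    rw [show (-1 - (l : ℤ)) = -((l + 1 : ℕ) : ℤ) by push_cast; ring, besselInt_neg,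
      Int.natAbs_natCast]
    push_cast; rfl
  have e1 : besselInt η (-1 - l + 1) = (-1) ^ l * besselInt η l := by
    rw [show (-1 - (l : ℤ) + 1) = -(l : ℤ) by ring, besselInt_neg, Int.natAbs_natCast]
  have h0 : (k : ℝ) + l + 1 ≠ 0 := by positivity
  have hp : ((-1 : ℝ) ^ l) * (-1) ^ l = 1 := by
    rw [← pow_add, Even.neg_one_pow ⟨_, rfl⟩]
  rw [e0, e1] at h
  refine hasSum_of_eq h ?_ fun m => ?_
  · unfold blockF
    rw [pow_succ]
    field_simp
    linear_combination η * (besselInt η k * besselInt η l +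
      besselInt η (k + 1) * besselInt η (l + 1)) * hp
  · rw [show -1 - (l : ℤ) + (m + 1) = m - l by ring]
    push_cast
    field_simp
    ring

/-- D decays in its column index and one Bessel factor is summable along an injective sequence, so
mere boundedness of the other factor suffices. -/
theorem summable_blockD_mul {η : ℝ} (hη : 0 ≤ η) (k : ℕ) (f : ℕ → ℕ → ℤ) {h : ℕ → ℤ}
    (hh : Function.Injective h) :
    Summable fun p : ℕ × ℕ =>
      blockD η k p.1 * (besselInt η (f p.1 p.2) * besselInt η (h p.2)) := by
  have h1 : Summable fun l : ℕ => expCoeff η (l : ℤ) :=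
    (summable_expCoeff η).comp_injective Nat.cast_injective
  have h2 : Summable fun m : ℕ => |besselInt η (h m)| :=
    (summable_abs_besselInt hη).comp_injective hh
  have h3 : Summable fun p : ℕ × ℕ => expCoeff η (p.1 : ℤ) * |besselInt η (h p.2)| :=
    h1.mul_of_nonneg h2 (fun l => expCoeff_nonneg hη _) fun _ => abs_nonneg _
  refine Summable.of_norm_bounded
    (h3.mul_left (η * expCoeff η k * (besselConst η * Real.exp η))) fun p => ?_
  have a1 := abs_blockD_le hη k p.1
  have a2 := abs_besselInt_le_const hη (f p.1 p.2)
  have a3 := (abs_nonneg (blockD η k p.1)).trans a1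
  rw [Real.norm_eq_abs, abs_mul, abs_mul, ← mul_assoc]
  calc _ ≤ (η * (expCoeff η k * expCoeff η p.1)) * (besselConst η * Real.exp η) *
        |besselInt η (h p.2)| :=
        mul_le_mul_of_nonneg_right (mul_le_mul a1 a2 (abs_nonneg _) a3) (abs_nonneg _)
    _ = _ := by ring

/-- `G = D F`. -/
theorem hasSum_blockD_mul_blockF {η : ℝ} (hη : 0 ≤ η) (k k' : ℕ) :
    HasSum (fun l => blockD η k l * blockF η l k') (blockG η k k') := by
  refine hasSum_of_hasSum_swap
    (f := fun l m : ℕ => blockD η k l *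
      (((-1) ^ l * besselInt η (m - l)) * besselInt η (k' + (m + 1))))
    (g := fun m => besselInt η (k + (m + 1)) * besselInt η (k' + (m + 1))) ?_ ?_ ?_
    (summable_blockG hη k k').hasSum
  · have hi : Function.Injective fun m : ℕ => (k' : ℤ) + (m + 1) := fun m n h => by simpa using h
    refine ((summable_blockD_mul hη k (fun l m => m - l) hi).abs.congr fun p => ?_).of_abs
    simp only [abs_mul, abs_pow, abs_neg, abs_one, one_pow, one_mul]
  -- For fixed m the sum over l is the sum rule for D at order m + 1.
  · intro m
    have := (hasSum_blockD_mul_besselInt η k (m + 1) (by lia)).mul_right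
      (besselInt η (k' + (m + 1)))
    refine this.congr_fun fun l => ?_
    rw [add_sub_cancel_right]; ring
  · intro l
    rw [blockF_symm]
    exact (hasSum_blockF hη k' l).mul_left _

theorem neg_one_pow_mul_besselInt_sub (η : ℝ) (k s : ℕ) :
    (-1) ^ s * besselInt η (k - s) = (-1) ^ k * besselInt η (s - k) := by
  rw [show (k : ℤ) - s = -(s - k) by ring, besselInt_neg, ← mul_assoc, ← pow_add]
  congr 1
  rcases Nat.even_or_odd k with hk | hk
  · rw [hk.neg_one_pow, Even.neg_one_pow]; grind
  · rw [hk.neg_one_pow, Odd.neg_one_pow]; grind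

/-- The sum over all integers is the orthogonality relation, and G is the half of it with orders
increasing from k + 1 and l + 1; this is the other half. -/
theorem hasSum_blockG_compl {η : ℝ} (hη : 0 ≤ η) (k l : ℕ) :
    HasSum (fun s : ℕ => besselInt η (k - s) * besselInt η (l - s))
      ((if k = l then 1 else 0) - blockG η k l) := by
  have hs : Summable fun s : ℕ => besselInt η (k - s) * besselInt η (l - s) :=
    summable_besselInt_mul hη fun m n h => by simpa using h
  have h1 : HasSum (fun i : ℤ => besselInt η (k - i) * besselInt η (l - i)) _ :=
    HasSum.of_nat_of_neg_add_one hs.hasSum ((summable_blockG hη k l).hasSum.congr_fun fun m => by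
      rw [sub_neg_eq_add, sub_neg_eq_add])
  have h2 : HasSum (fun i : ℤ => besselInt η (k - i) * besselInt η (l - i))
      (if k = l then 1 else 0) := by
    rw [← (Equiv.subLeft (k : ℤ)).hasSum_iff]
    refine hasSum_of_eq (hasSum_besselInt_orthogonality hη (l - k)) ?_ fun m => ?_
    · congr 1; grind
    · simp only [Function.comp_apply, Equiv.subLeft_apply]
      rw [sub_sub_cancel, show (l : ℤ) - (k - m) = m + (l - k) by ring]
  rw [h2.unique h1, blockG, add_sub_cancel_right]
  exact hs.hasSum

theorem hasSum_blockD_mul_besselInt_sub (η : ℝ) (l s : ℕ) :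
    HasSum (fun k' : ℕ => blockD η l k' * besselInt η ((k' : ℤ) - s))
      ((-1) ^ s * besselInt η (l + (s + 1))) := by
  have := (hasSum_blockD_mul_besselInt η l (s + 1) (by lia)).mul_left ((-1) ^ s)
  refine this.congr_fun fun k' => ?_
  rw [add_sub_cancel_right, ← neg_one_pow_mul_besselInt_sub η k' s]
  have hp : ((-1 : ℝ) ^ s) * (-1) ^ s = 1 := by rw [← pow_add, Even.neg_one_pow ⟨_, rfl⟩]
  linear_combination (-(blockD η l k' * besselInt η ((k' : ℤ) - (s : ℤ)))) * hp

/-- `F + D G = D`. -/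
theorem hasSum_blockD_mul_blockG {η : ℝ} (hη : 0 ≤ η) (l k : ℕ) :
    HasSum (fun k' => blockD η l k' * blockG η k' k) (blockD η l k - blockF η l k) := by
  have hi : Function.Injective fun m : ℕ => (k : ℤ) - m := fun m n h => by simpa using h
  have hs : Summable fun p : ℕ × ℕ => blockD η l p.1 *
      (besselInt η ((p.1 : ℤ) - (p.2 : ℤ)) * besselInt η ((k : ℤ) - (p.2 : ℤ))) :=
    summable_blockD_mul (h := fun m : ℕ => (k : ℤ) - m) hη l (fun l m => (l : ℤ) - (m : ℤ)) hi
  have hb : ∀ s : ℕ, HasSum (fun k' : ℕ => blockD η l k' *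
      (besselInt η ((k' : ℤ) - s) * besselInt η ((k : ℤ) - s)))
      (((-1) ^ k * besselInt η (s - k)) * besselInt η (l + (s + 1))) := fun s =>
    hasSum_of_eq ((hasSum_blockD_mul_besselInt_sub η l s).mul_right (besselInt η ((k : ℤ) - s)))
      (by rw [← neg_one_pow_mul_besselInt_sub]; ring) fun k' => by ring
  have hc : ∀ k' : ℕ, HasSum (fun s : ℕ => blockD η l k' *
      (besselInt η ((k' : ℤ) - s) * besselInt η ((k : ℤ) - s)))
      (blockD η l k' * ((if k' = k then 1 else 0) - blockG η k' k)) := fun k' =>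
    (hasSum_blockG_compl hη k' k).mul_left _
  -- Here G = 1 - G' with G' the complementary half-sum. Summing D over the first index of G' gives
  -- the series of F, so DG' = F.
  have h1 := hasSum_of_hasSum_swap (f := fun k' s : ℕ => blockD η l k' *
      (besselInt η ((k' : ℤ) - s) * besselInt η ((k : ℤ) - s))) hs hb hc (hasSum_blockF hη l k)
  have h2 : HasSum (fun k' => blockD η l k' * (if k' = k then 1 else 0)) (blockD η l k) :=
    hasSum_of_eq (hasSum_ite_eq k (blockD η l k)) rfl fun k' => by
      by_cases h : k' = k <;> simp [h]
  exact (h2.sub h1).congr_fun fun k' => by ring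

/-! ### Bessel functions of real order -/

/-- A crude bound that makes 1/Γ ≤ 2 at all positive arguments, so that Bessel series are dominated
locally uniformly in the order. Monotonicity on [2, ∞) and Γ(y+1) = yΓ(y) suffice. -/
theorem half_le_Gamma {y : ℝ} (hy : 0 < y) : 1 / 2 ≤ Real.Gamma y := by
  have h2 : ∀ y : ℝ, 2 ≤ y → 1 ≤ Real.Gamma y := fun y hy => by
    have := Real.Gamma_strictMonoOn_Ici.monotoneOn (Set.mem_Ici.mpr le_rfl) (Set.mem_Ici.mpr hy) hy
    rwa [Real.Gamma_two] at this
  have h1 : ∀ y : ℝ, 1 ≤ y → 1 / 2 ≤ Real.Gamma y := fun y hy => by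
    rcases le_total 2 y with h | h
    · linarith [h2 y h]
    · have h3 := h2 (y + 1) (by linarith)
      rw [Real.Gamma_add_one (by linarith)] at h3
      nlinarith [Real.Gamma_pos_of_pos (show 0 < y by linarith)]
  rcases le_total 1 y with h | h
  · exact h1 y h
  · have h3 := h1 (y + 1) (by linarith)
    rw [Real.Gamma_add_one (by linarith)] at h3
    nlinarith [Real.Gamma_pos_of_pos hy]

/-- The terms of the series for the Bessel function of order `ν` at `2 * η`. -/
def besselTerm (η ν : ℝ) (m : ℕ) : ℝ :=
  (-1) ^ m * ((m.factorial : ℝ) * Real.Gamma (m + ν + 1))⁻¹ * η ^ (2 * (m : ℝ) + ν)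

theorem besselJ_eq_tsum (ν θ : ℝ) : besselJ ν (2 * √θ) = ∑' m, besselTerm √θ ν m := by
  unfold besselJ besselTerm
  rw [mul_div_cancel_left₀ _ (two_ne_zero)]

theorem abs_besselTerm_le {η ν : ℝ} (hη : 0 < η) (hν : -1 < ν) (m : ℕ) :
    |besselTerm η ν m| ≤ 2 * η ^ ν * expCoeff (η ^ 2) m := by
  have hy : 0 < m + ν + 1 := by have : (0 : ℝ) ≤ m := by positivity
                                linarith
  have hG := half_le_Gamma hy
  unfold besselTerm
  rw [abs_mul, abs_mul, abs_pow, abs_neg, abs_one, one_pow, one_mul, expCoeff_natCast,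
    abs_of_pos (by positivity), abs_of_pos (by positivity), Real.rpow_add hη,
    show (2 * (m : ℝ)) = ((2 * m : ℕ) : ℝ) by push_cast; ring, Real.rpow_natCast, pow_mul,
    mul_inv]
  have h2 : (Real.Gamma (m + ν + 1))⁻¹ ≤ 2 := by
    rw [inv_le_comm₀ (by positivity) (by positivity)]; linarith
  calc (m.factorial : ℝ)⁻¹ * (Real.Gamma (m + ν + 1))⁻¹ * ((η ^ 2) ^ m * η ^ ν)
      ≤ (m.factorial : ℝ)⁻¹ * 2 * ((η ^ 2) ^ m * η ^ ν) := by gcongr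
    _ = _ := by ring

theorem summable_expCoeff_nat (η : ℝ) : Summable fun m : ℕ => expCoeff η m :=
  (summable_expCoeff η).comp_injective Nat.cast_injective

theorem hasSum_expCoeff_nat (η : ℝ) : HasSum (fun m : ℕ => expCoeff η m) (Real.exp η) := by
  simp only [expCoeff_natCast]
  rw [Real.exp_eq_exp_ℝ]
  exact NormedSpace.expSeries_div_hasSum_exp η

theorem hasSum_besselJ {θ ν : ℝ} (hθ : 0 < θ) (hν : -1 < ν) :
    HasSum (besselTerm √θ ν) (besselJ ν (2 * √θ)) := by
  rw [besselJ_eq_tsum]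
  exact (Summable.of_norm_bounded ((summable_expCoeff_nat _).mul_left _)
    (abs_besselTerm_le (Real.sqrt_pos.mpr hθ) hν)).hasSum

theorem abs_besselJ_le {θ ν : ℝ} (hθ : 0 < θ) (hν : -1 < ν) :
    |besselJ ν (2 * √θ)| ≤ 2 * √θ ^ ν * Real.exp θ := by
  rw [besselJ_eq_tsum, ← Real.norm_eq_abs]
  have := (hasSum_expCoeff_nat (√θ ^ 2)).mul_left (2 * √θ ^ ν)
  have h := tsum_of_norm_bounded (f := besselTerm √θ ν) this
    fun m => abs_besselTerm_le (Real.sqrt_pos.mpr hθ) hν m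
  rwa [Real.sq_sqrt hθ.le] at h

theorem continuousAt_besselJ {θ ν : ℝ} (hθ : 0 < θ) (hν : -1 < ν) :
    ContinuousAt (fun ν => besselJ ν (2 * √θ)) ν := by
  have hη := Real.sqrt_pos.mpr hθ
  have hc : ContinuousAt (fun ν : ℝ => √θ ^ ν) ν := (Real.continuous_const_rpow hη.ne').continuousAt
  simp only [besselJ_eq_tsum]
  refine tendsto_tsum_of_dominated_convergence
    (bound := fun m : ℕ => 2 * (√θ ^ ν + 1) * expCoeff (√θ ^ 2) m)
    ((summable_expCoeff_nat _).mul_left _) ?_ ?_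
  · intro m
    have hy : 0 < m + ν + 1 := by have : (0 : ℝ) ≤ m := by positivity
                                  linarith
    have hG : ContinuousAt (fun ν : ℝ => Real.Gamma (m + ν + 1)) ν := by
      refine ContinuousAt.comp (g := Real.Gamma) (f := fun ν : ℝ => m + ν + 1) ?_ (by fun_prop)
      refine (Real.differentiableAt_Gamma fun n hn => ?_).continuousAt
      have : (0 : ℝ) ≤ n := by positivity
      linarith
    unfold besselTerm
    refine ((continuousAt_const.mul ((continuousAt_const.mul hG).inv₀ ?_)).mul ?_)
    · exact mul_ne_zero (by positivity) (Real.Gamma_pos_of_pos hy).ne'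
    · exact ContinuousAt.comp (g := fun s : ℝ => √θ ^ s) (f := fun ν : ℝ => 2 * (m : ℝ) + ν)
        (Real.continuous_const_rpow hη.ne').continuousAt (by fun_prop)
  · have h1 : ∀ᶠ t in 𝓝 ν, √θ ^ t < √θ ^ ν + 1 := hc.eventually_lt continuousAt_const (by simp)
    -- Near ν the value η^t stays below η^ν + 1, so one majorant serves all these orders.
    filter_upwards [h1, lt_mem_nhds hν] with t ht ht' m
    refine (abs_besselTerm_le hη ht' m).trans ?_
    have := expCoeff_nonneg (sq_nonneg √θ) (m : ℤ)
    gcongr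

theorem besselJ_recurrence {θ ν : ℝ} (hθ : 0 < θ) (hν : 0 < ν) :
    √θ * (besselJ (ν - 1) (2 * √θ) + besselJ (ν + 1) (2 * √θ)) = ν * besselJ ν (2 * √θ) := by
  have hη := Real.sqrt_pos.mpr hθ
  have h1 := (hasSum_besselJ hθ (show -1 < ν - 1 by linarith)).mul_left √θ
  have h2 := (hasSum_besselJ hθ (show -1 < ν + 1 by linarith)).mul_left √θ
  have h3 := (hasSum_besselJ hθ (show -1 < ν by linarith)).mul_left ν
  rw [← hasSum_nat_add_iff' 1] at h1 h3
  have h4 := (h1.add h2).unique (h3.congr_fun fun m => ?_)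
  · simp only [Finset.range_one, Finset.sum_singleton] at h4
    -- The term m = 0 matches by Γ(ν+1) = νΓ(ν). Beyond it, term m + 1 of order ν - 1 is paired with
    -- term m of order ν + 1.
    have h5 : √θ * besselTerm √θ (ν - 1) 0 = ν * besselTerm √θ ν 0 := by
      unfold besselTerm
      simp only [pow_zero, Nat.factorial_zero, Nat.cast_one, one_mul, Nat.cast_zero, mul_zero,
        zero_add, sub_add_cancel]
      rw [Real.Gamma_add_one hν.ne', Real.rpow_sub hη, Real.rpow_one]
      have := Real.Gamma_pos_of_pos hν
      field_simp
    linarith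
  · unfold besselTerm
    have hm : (0 : ℝ) ≤ m := by positivity
    push_cast
    rw [show (m : ℝ) + 1 + (ν - 1) + 1 = m + ν + 1 by ring,
      show (m : ℝ) + 1 + ν + 1 = (m + ν + 1) + 1 by ring,
      show (m : ℝ) + (ν + 1) + 1 = (m + ν + 1) + 1 by ring,
      Real.Gamma_add_one (by linarith : (m : ℝ) + ν + 1 ≠ 0) |>.trans rfl, Nat.factorial_succ,
      show 2 * ((m : ℝ) + 1) + (ν - 1) = (2 * m + ν) + 1 by ring,
      show 2 * ((m : ℝ) + 1) + ν = (2 * m + ν) + 1 + 1 by ring,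
      show 2 * (m : ℝ) + (ν + 1) = (2 * m + ν) + 1 by ring,
      Real.rpow_add hη (2 * m + ν + 1), Real.rpow_one]
    have hG := Real.Gamma_pos_of_pos (show 0 < (m : ℝ) + ν + 1 by linarith)
    have : (m : ℝ) + ν + 1 ≠ 0 := by linarith
    push_cast
    field_simp
    ring

theorem besselJ_natCast {θ : ℝ} (hθ : 0 < θ) (n : ℕ) :
    besselJ n (2 * √θ) = besselInt √θ n := by
  refine (hasSum_besselJ hθ (by have : (0 : ℝ) ≤ n := by positivity
                                linarith)).unique ?_
  have h := hasSum_besselInt √θ n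
  rw [hasSum_int_iff_nat fun i hi => by rw [expCoeff_of_neg _ hi, zero_mul]] at h
  refine h.congr_fun fun m => ?_
  unfold besselTerm
  rw [show ((n : ℤ) + m) = ((n + m : ℕ) : ℤ) by push_cast; ring, expCoeff_natCast,
    expCoeff_natCast, show (m : ℝ) + n + 1 = ((n + m : ℕ) : ℝ) + 1 by push_cast; ring,
    Real.Gamma_nat_eq_factorial, show 2 * (m : ℝ) + n = ((m + (n + m) : ℕ) : ℝ) by push_cast; ring,
    Real.rpow_natCast, pow_add, neg_pow √θ]
  field_simp

/-! ### The diagonal values of `K` -/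

/-- The integer order contributes η^m/m! and the real order η^m. The bound depends on t only through
M, which is what dominated convergence in t needs. -/
theorem abs_mul_besselJ_le {θ M t : ℝ} (hθ : 0 < θ) (ht : -1 < t) (hM : √θ ^ t ≤ M) (i j k m : ℕ) :
    |besselInt √θ ((k + i + m : ℕ) : ℤ) * besselJ (t + j + m) (2 * √θ)| ≤
      besselConst √θ * (Real.exp √θ * 2 * M * √θ ^ j * Real.exp θ) * expCoeff (√θ ^ 2) m := by
  have hη := Real.sqrt_pos.mpr hθ
  have h1 : |besselInt √θ ((k + i + m : ℕ) : ℤ)| ≤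
      besselConst √θ * (Real.exp √θ * expCoeff √θ m) := by
    refine (abs_besselInt_natCast_le hη.le (k + i + m)).trans
      (mul_le_mul_of_nonneg_left ?_ (besselConst_nonneg _))
    have := expCoeff_add_le_left hη.le m (k + i)
    rwa [show ((m : ℤ) + (k + i : ℕ)) = ((k + i + m : ℕ) : ℤ) by lia] at this
  have h2 : |besselJ (t + j + m) (2 * √θ)| ≤ 2 * (M * √θ ^ j * √θ ^ m) * Real.exp θ := by
    refine (abs_besselJ_le hθ ?_).trans ?_
    · have : (0 : ℝ) ≤ m := by positivity
      have : (0 : ℝ) ≤ j := by positivity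
      linarith
    · rw [Real.rpow_add hη, Real.rpow_add hη, Real.rpow_natCast, Real.rpow_natCast]
      gcongr
  have hM0 : 0 ≤ M := (Real.rpow_nonneg hη.le t).trans hM
  have h0 := expCoeff_nonneg hη.le (m : ℤ)
  have h00 := besselConst_nonneg √θ
  rw [abs_mul]
  refine (mul_le_mul h1 h2 (abs_nonneg _) (by positivity)).trans (le_of_eq ?_)
  rw [expCoeff_natCast, expCoeff_natCast, ← pow_mul, two_mul m, pow_add]
  ring

/-- Christoffel–Darboux with one integer and one real order replaces the quotient by a series that
is regular at t = k + 1/2. -/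
theorem sqrt_mul_kPlus_div {θ t : ℝ} (hθ : 0 < θ) (ht : 0 < t) (k : ℕ) (hk : t ≠ k + 1 / 2) :
    √θ * (kPlus θ (k + 1 / 2) t / ((k + 1 / 2) - t)) =
      ∑' m : ℕ, besselInt √θ ((k + 1 + m : ℕ) : ℤ) * besselJ (t - 1 / 2 + 1 + m) (2 * √θ) := by
  have hs : ∀ i j : ℕ, Summable fun m : ℕ =>
      besselInt √θ ((k + i + m : ℕ) : ℤ) * besselJ (t - 1 / 2 + j + m) (2 * √θ) := fun i j =>
    Summable.of_norm_bounded ((summable_expCoeff_nat (√θ ^ 2)).mul_left _)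
      (abs_mul_besselJ_le hθ (by linarith) le_rfl i j k)
  have h := hasSum_of_recurrence (η := √θ) (α := k + 1) (β := t + 1 / 2)
    (u := fun m : ℕ => besselInt √θ ((k + m : ℕ) : ℤ))
    (v := fun m : ℕ => besselJ (t - 1 / 2 + m) (2 * √θ)) (fun m => ?_) (fun m => ?_)
    ((hs 0 1).congr fun m => ?_) ((hs 1 0).congr fun m => ?_)
  · rw [← mul_div_assoc, div_eq_iff (sub_ne_zero.mpr hk.symm), ← tsum_mul_right]
    have h' := h.tsum_eq
    simp only [Nat.cast_zero, Nat.cast_one, add_zero] at h'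
    unfold kPlus
    rw [show (k : ℝ) + 1 / 2 - 1 / 2 = k by ring,
      show (k : ℝ) + 1 / 2 + 1 / 2 = ((k + 1 : ℕ) : ℝ) by push_cast; ring, besselJ_natCast hθ,
      besselJ_natCast hθ, show t + 1 / 2 = t - 1 / 2 + 1 by ring, ← h']
    refine tsum_congr fun m => ?_
    rw [show k + (m + 1) = k + 1 + m by ring]
    push_cast
    rw [show t - 1 / 2 + ((m : ℝ) + 1) = t - 1 / 2 + 1 + m by ring]
    ring
  · have := besselInt_recurrence √θ ((k + (m + 1) : ℕ) : ℤ)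
    rw [show ((k + (m + 1) : ℕ) : ℤ) - 1 = ((k + m : ℕ) : ℤ) by push_cast; ring,
      show ((k + (m + 1) : ℕ) : ℤ) + 1 = ((k + (m + 2) : ℕ) : ℤ) by push_cast; ring] at this
    rw [this]; push_cast; ring
  · have hm : (0 : ℝ) ≤ m := by positivity
    have := besselJ_recurrence hθ (show 0 < t - 1 / 2 + (m + 1 : ℕ) by push_cast; linarith)
    push_cast at this ⊢
    rw [show t - 1 / 2 + ((m : ℝ) + 1) - 1 = t - 1 / 2 + m by ring,
      show t - 1 / 2 + ((m : ℝ) + 1) + 1 = t - 1 / 2 + (m + 2) by ring] at this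
    rw [this]; ring
  · rw [add_zero, Nat.cast_one, Nat.cast_succ, show t - 1 / 2 + ((m : ℝ) + 1) = t - 1 / 2 + 1 + m by ring]
  · rw [show k + (m + 1) = k + 1 + m by ring, Nat.cast_zero, add_zero]

theorem tendsto_kPlus_div {θ : ℝ} (hθ : 0 < θ) (k : ℕ) :
    Tendsto (fun t => √θ * (kPlus θ (k + 1 / 2) t / ((k + 1 / 2) - t))) (𝓝[≠] ((k : ℝ) + 1 / 2))
      (𝓝 (blockG √θ k k)) := by
  have hη := Real.sqrt_pos.mpr hθ
  have hk : (0 : ℝ) ≤ k := by positivity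
  have h : Tendsto (fun t : ℝ => ∑' m : ℕ, besselInt √θ ((k + 1 + m : ℕ) : ℤ) *
      besselJ (t - 1 / 2 + 1 + m) (2 * √θ)) (𝓝 ((k : ℝ) + 1 / 2)) (𝓝 (blockG √θ k k)) := by
    have hc : ContinuousAt (fun ν : ℝ => √θ ^ (ν - 1 / 2)) ((k : ℝ) + 1 / 2) :=
      ((Real.continuous_const_rpow hη.ne').comp (by fun_prop : Continuous fun ν : ℝ => ν - 1 / 2)).continuousAt
    refine tendsto_tsum_of_dominated_convergence
      ((summable_expCoeff_nat (√θ ^ 2)).mul_left _) (fun m => ?_) ?_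
      (bound := fun m : ℕ => besselConst √θ * (Real.exp √θ * 2 *
        (√θ ^ ((k : ℝ) + 1 / 2 - 1 / 2) + 1) * √θ ^ 1 * Real.exp θ) * expCoeff (√θ ^ 2) m)
    · have e : besselInt √θ (k + (m + 1)) = besselJ ((k : ℝ) + 1 / 2 - 1 / 2 + 1 + m) (2 * √θ) := by
        rw [show (k : ℝ) + 1 / 2 - 1 / 2 + 1 + m = ((k + (m + 1) : ℕ) : ℝ) by push_cast; ring,
          besselJ_natCast hθ]
        push_cast; rfl
      rw [show ((k + 1 + m : ℕ) : ℤ) = k + (m + 1) by push_cast; ring]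
      nth_rewrite 3 [e]
      refine Tendsto.mul tendsto_const_nhds ?_
      refine ContinuousAt.comp (g := fun ν => besselJ ν (2 * √θ))
        (f := fun t : ℝ => t - 1 / 2 + 1 + m) (continuousAt_besselJ hθ ?_) (by fun_prop)
      have hm : (0 : ℝ) ≤ m := by positivity
      linarith
    · filter_upwards [hc.eventually_lt continuousAt_const (lt_add_one _),
        lt_mem_nhds (show 0 < (k : ℝ) + 1 / 2 by linarith)] with t ht ht0 m
      have := abs_mul_besselJ_le hθ (by linarith : -1 < t - 1 / 2) ht.le 1 1 k m
      rwa [Nat.cast_one] at this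
  refine (h.mono_left nhdsWithin_le_nhds).congr' ?_
  filter_upwards [nhdsWithin_le_nhds (lt_mem_nhds (show 0 < (k : ℝ) + 1 / 2 by linarith)),
    self_mem_nhdsWithin] with t ht ht'
  exact (sqrt_mul_kPlus_div hθ ht k ht').symm

/-! ### Coordinates on `ℤ + 1/2` -/

/-- The half-integer with given sign and absolute value. -/
def coord : ℕ ⊕ ℕ → ℝ := Sum.elim (fun k => k + 1 / 2) fun l => -(l + 1 / 2)

theorem coord_mem (p : ℕ ⊕ ℕ) : coord p ∈ halfIntegers := by
  rcases p with k | l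
  · exact ⟨k, by simp [coord]⟩
  · exact ⟨-l - 1, by simp [coord]; ring⟩

theorem coord_injective : Function.Injective coord := by
  rintro (k | k) (l | l) h
  all_goals
    simp only [coord, Sum.elim_inl, Sum.elim_inr] at h
  · rw [show k = l by exact_mod_cast (by linarith : (k : ℝ) = l)]
  · exfalso
    have : (0 : ℝ) ≤ k := by positivity
    have : (0 : ℝ) ≤ l := by positivity
    linarith
  · exfalso
    have : (0 : ℝ) ≤ k := by positivity
    have : (0 : ℝ) ≤ l := by positivity
    linarith
  · rw [show k = l by exact_mod_cast (by linarith : (k : ℝ) = l)]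

theorem exists_coord_eq {x : ℝ} (hx : x ∈ halfIntegers) : ∃ p, coord p = x := by
  obtain ⟨n, rfl⟩ := hx
  rcases le_or_gt 0 n with h | h
  · obtain ⟨k, rfl⟩ := Int.eq_ofNat_of_zero_le h
    exact ⟨Sum.inl k, by simp [coord]⟩
  · obtain ⟨k, hk⟩ := Int.eq_ofNat_of_zero_le (show 0 ≤ -n - 1 by lia)
    refine ⟨Sum.inr k, ?_⟩
    rw [show n = -(k : ℤ) - 1 by lia]
    simp [coord]; ring

/-- The half-integers as signed natural numbers. -/
def coordEquiv : ℕ ⊕ ℕ ≃ halfIntegers :=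
  Equiv.ofBijective (fun p => ⟨coord p, coord_mem p⟩)
    ⟨fun _ _ h => coord_injective (congrArg Subtype.val h), fun x =>
      (exists_coord_eq x.2).imp fun _ h => Subtype.ext h⟩

@[simp] theorem coe_coordEquiv (p : ℕ ⊕ ℕ) : (coordEquiv p : ℝ) = coord p := rfl

/-- The kernel `L` in block form. -/
def blockL (η : ℝ) (p q : ℕ ⊕ ℕ) : ℝ :=
  Matrix.fromBlocks 0 (Matrix.of (blockD η)) (-Matrix.of (blockD η)) 0 p q

/-- The kernel `K` in block form. -/
def blockK (η : ℝ) (p q : ℕ ⊕ ℕ) : ℝ :=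
  Matrix.fromBlocks (Matrix.of (blockG η)) (Matrix.of (blockF η)) (-Matrix.of (blockF η))
    (Matrix.of (blockG η)) p q

theorem tendsto_kernelK_diag {θ : ℝ} (hθ : 0 < θ) (p : ℕ ⊕ ℕ) :
    Tendsto (fun t : ℝ => √θ * (kPlus θ |coord p| |t| / (|coord p| - |t|)))
        (𝓝[≠] (coord p)) (𝓝 (blockK √θ p p)) := by
  rcases p with k | k
  all_goals
    have hk : (0 : ℝ) ≤ k := by positivity
    simp only [coord, Sum.elim_inl, Sum.elim_inr, blockK, Matrix.fromBlocks_apply₁₁,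
      Matrix.fromBlocks_apply₂₂, Matrix.of_apply, abs_neg]
    rw [abs_of_pos (show 0 < (k : ℝ) + 1 / 2 by linarith)]
  · refine (tendsto_kPlus_div hθ k).congr' ?_
    filter_upwards [nhdsWithin_le_nhds (lt_mem_nhds (show 0 < (k : ℝ) + 1 / 2 by linarith))]
      with t ht
    rw [abs_of_pos ht]
  -- At negative points only absolute values enter, so t ↦ -t reduces to the positive case.
  · have hneg : Tendsto (fun t : ℝ => -t) (𝓝[≠] (-((k : ℝ) + 1 / 2))) (𝓝[≠] ((k : ℝ) + 1 / 2)) := by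
      refine tendsto_nhdsWithin_iff.mpr ⟨?_, ?_⟩
      · have : Tendsto (fun t : ℝ => -t) (𝓝 (-((k : ℝ) + 1 / 2))) (𝓝 (- -((k : ℝ) + 1 / 2))) :=
          (continuous_neg).tendsto _
        rw [neg_neg] at this
        exact this.mono_left nhdsWithin_le_nhds
      · filter_upwards [self_mem_nhdsWithin] with t ht h
        exact ht (by rw [Set.mem_singleton_iff] at *; linarith)
    refine ((tendsto_kPlus_div hθ k).comp hneg).congr' ?_
    filter_upwards [nhdsWithin_le_nhds (gt_mem_nhds (show -((k : ℝ) + 1 / 2) < 0 by linarith))]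
      with t ht
    simp only [Function.comp_apply]
    rw [abs_of_neg ht]

theorem coord_mul_self_pos (p : ℕ ⊕ ℕ) : 0 < coord p * coord p := by
  have h : coord p ≠ 0 := by
    rcases p with k | k
    all_goals
      have hk : (0 : ℝ) ≤ k := by positivity
      simp only [coord, Sum.elim_inl, Sum.elim_inr]
      intro h
      linarith
  exact mul_self_pos.mpr h

theorem kernelK_diag {θ : ℝ} (hθ : 0 < θ) (p : ℕ ⊕ ℕ) :
    kernelK θ (coord p) (coord p) = blockK √θ p p := by
  unfold kernelK
  rw [if_pos (coord_mul_self_pos p), if_pos rfl]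
  exact (tendsto_kernelK_diag hθ p).limUnder_eq

theorem kernelK_coord {θ : ℝ} (hθ : 0 < θ) (p q : ℕ ⊕ ℕ) :
    kernelK θ (coord p) (coord q) = blockK √θ p q := by
  by_cases hpq : p = q
  · subst hpq; exact kernelK_diag hθ p
  have hη := Real.sqrt_pos.mpr hθ
  rcases p with k | k <;> rcases q with l | l
  all_goals
    have hk : (0 : ℝ) ≤ k := by positivity
    have hl : (0 : ℝ) ≤ l := by positivity
    have hc := fun h => hpq (coord_injective h)
    simp only [coord, Sum.elim_inl, Sum.elim_inr, blockK, Matrix.fromBlocks_apply₁₁,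
      Matrix.fromBlocks_apply₂₂, Matrix.fromBlocks_apply₁₂, Matrix.fromBlocks_apply₂₁,
      Matrix.of_apply, Matrix.neg_apply] at hc ⊢
    unfold kernelK
    try simp only [abs_neg]
    rw [abs_of_pos (show 0 < (k : ℝ) + 1 / 2 by linarith),
      abs_of_pos (show 0 < (l : ℝ) + 1 / 2 by linarith)]
    simp only [kPlus, kMinus, add_sub_cancel_right]
    rw [show (k : ℝ) + 1 / 2 + 1 / 2 = ((k + 1 : ℕ) : ℝ) by push_cast; ring,
      show (l : ℝ) + 1 / 2 + 1 / 2 = ((l + 1 : ℕ) : ℝ) by push_cast; ring,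
      besselJ_natCast hθ, besselJ_natCast hθ, besselJ_natCast hθ, besselJ_natCast hθ]
  · rw [if_pos (by positivity), if_neg hc, blockG_eq hη.le (by simpa using hpq),
      show (k : ℝ) + 1 / 2 - (l + 1 / 2) = k - l by ring]
    push_cast; rfl
  · rw [if_neg (by nlinarith), blockF]
    rw [show (k : ℝ) + 1 / 2 - -(l + 1 / 2) = k + l + 1 by ring, mul_div_assoc]
    push_cast; rfl
  · rw [if_neg (by nlinarith), blockF]
    rw [show -((k : ℝ) + 1 / 2) - (l + 1 / 2) = -(k + l + 1) by ring, mul_div_assoc, div_neg]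
    push_cast; ring
  · rw [if_pos (by nlinarith), if_neg hc, blockG_eq hη.le (by simpa using hpq),
      show (k : ℝ) + 1 / 2 - (l + 1 / 2) = k - l by ring]
    push_cast; rfl

theorem kernelL_coord {θ : ℝ} (hθ : 0 < θ) (p q : ℕ ⊕ ℕ) :
    kernelL θ (coord p) (coord q) = blockL √θ p q := by
  have hη := Real.sqrt_pos.mpr hθ
  have hpow : ∀ k l : ℕ, θ ^ (((k : ℝ) + 1 / 2 + (l + 1 / 2)) / 2) = √θ ^ (k + l + 1) := by
    intro k l
    rw [← Real.rpow_natCast, Real.sqrt_eq_rpow, ← Real.rpow_mul hθ.le]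
    push_cast; congr 1; ring
  rcases p with k | k <;> rcases q with l | l
  all_goals
    have hk : (0 : ℝ) ≤ k := by positivity
    have hl : (0 : ℝ) ≤ l := by positivity
    simp only [coord, Sum.elim_inl, Sum.elim_inr, blockL, Matrix.fromBlocks_apply₁₁,
      Matrix.fromBlocks_apply₂₂, Matrix.fromBlocks_apply₁₂, Matrix.fromBlocks_apply₂₁,
      Matrix.of_apply, Matrix.neg_apply, Matrix.zero_apply]
    unfold kernelL
    try simp only [abs_neg]
    rw [abs_of_pos (show 0 < (k : ℝ) + 1 / 2 by linarith),
      abs_of_pos (show 0 < (l : ℝ) + 1 / 2 by linarith)]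
  · rw [if_pos (by positivity)]
  · rw [if_neg (by nlinarith), hpow, show (k : ℝ) + 1 / 2 - -(l + 1 / 2) = k + l + 1 by ring,
      show (k : ℝ) + 1 / 2 + 1 / 2 = k + 1 by ring, show (l : ℝ) + 1 / 2 + 1 / 2 = l + 1 by ring,
      Real.Gamma_nat_eq_factorial, Real.Gamma_nat_eq_factorial, blockD]
    field_simp
  · rw [if_neg (by nlinarith), hpow, show -((k : ℝ) + 1 / 2) - (l + 1 / 2) = -(k + l + 1) by ring,
      show (k : ℝ) + 1 / 2 + 1 / 2 = k + 1 by ring, show (l : ℝ) + 1 / 2 + 1 / 2 = l + 1 by ring,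
      Real.Gamma_nat_eq_factorial, Real.Gamma_nat_eq_factorial, blockD]
    field_simp
  · rw [if_pos (by nlinarith)]

/-! ### Sums of principal minors -/

/-- Expand the determinant on the right by multilinearity in the rows. The added matrix has unit
rows off X and zero rows on X, so only row sets Y ⊇ X survive, each leaving a principal minor. -/
theorem det_sum_minors_add_diagonal {n : Type*} [Fintype n] [DecidableEq n] (M : Matrix n n ℝ)
    (X : Finset n) :
    ∑ Y : Finset n, (if X ⊆ Y then
        (M.submatrix (Subtype.val : Y → n) (Subtype.val : Y → n)).det else 0) =
      (M + Matrix.of ((X.piecewise 0 (1 : Matrix n n ℝ).row : n → n → ℝ))).det := by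
  have h := (Matrix.detRowAlternating (R := ℝ) (n := n)).map_add_univ M
    (X.piecewise 0 (1 : Matrix n n ℝ).row)
  refine Eq.trans ?_ h.symm
  refine Finset.sum_congr rfl fun Y _ => ?_
  split_ifs with hXY
  · rw [← Matrix.det_piecewise_one_eq_submatrix_det]
    congr 1
    ext i j
    simp only [Finset.piecewise, Matrix.of_apply]
    by_cases hi : i ∈ Y
    · simp [hi]
    · have hX : i ∉ X := fun h => hi (hXY h)
      simp [hi, hX, Matrix.row]
  · obtain ⟨i, hi, hiY⟩ := Finset.not_subset.mp hXY
    refine (Matrix.det_eq_zero_of_row_eq_zero i fun j => ?_).symm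
    simp [Finset.piecewise, hi, hiY]

/-- With 1_X the projection onto X, M + 1 - 1_X = (1 - 1_X (1+M)⁻¹)(1+M), and the first factor is
the identity off the rows in X. -/
theorem sum_minors_eq {n : Type*} [Fintype n] [DecidableEq n] (M : Matrix n n ℝ)
    (hM : IsUnit (1 + M).det) (X : Finset n) :
    ∑ Y : Finset n, (if X ⊆ Y then
        (M.submatrix (Subtype.val : Y → n) (Subtype.val : Y → n)).det else 0) =
      (1 + M).det *
        ((1 - (1 + M)⁻¹).submatrix (Subtype.val : X → n) (Subtype.val : X → n)).det := by
  rw [det_sum_minors_add_diagonal, ← Matrix.det_piecewise_one_eq_submatrix_det, mul_comm,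
    ← Matrix.det_mul]
  congr 1
  have h1 : (Matrix.of (X.piecewise (1 - (1 + M)⁻¹).row (1 : Matrix n n ℝ).row)) =
      1 - Matrix.diagonal (fun i => if i ∈ X then 1 else 0) * (1 + M)⁻¹ := by
    ext i j
    by_cases hi : i ∈ X <;> simp [Finset.piecewise, hi]
  rw [h1, sub_mul, Matrix.mul_assoc, Matrix.nonsing_inv_mul _ hM, Matrix.mul_one, Matrix.one_mul]
  ext i j
  by_cases hi : i ∈ X <;> by_cases hij : i = j
  all_goals
    try subst hij
    simp [Finset.piecewise, *, Matrix.diagonal, Matrix.row]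
  ring

/-- The principal minor of a kernel. -/
def minor {ι : Type*} [DecidableEq ι] (L : ι → ι → ℝ) (Y : Finset ι) : ℝ :=
  (Matrix.of fun i j : Y => L i j).det

/-- The finite truncation of a kernel. -/
def truncation {ι : Type*} (L : ι → ι → ℝ) (N : Finset ι) : Matrix N N ℝ :=
  Matrix.of fun i j => L i j

theorem minor_image {ι n : Type*} [DecidableEq ι] [DecidableEq n] (L : ι → ι → ℝ)
    (f : n ↪ ι) (Y : Finset n) :
    minor L (Y.map f) = ((Matrix.of fun i j => L (f i) (f j)).submatrix
      (Subtype.val : Y → n) (Subtype.val : Y → n)).det := by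
  unfold minor
  let e : Y ≃ (Y.map f) := Equiv.ofBijective
    (fun i => ⟨f i, Finset.mem_map_of_mem f i.2⟩)
    ⟨fun i j h => Subtype.ext (f.injective (congrArg Subtype.val h)), fun i => by
      obtain ⟨j, hj, h⟩ := Finset.mem_map.mp i.2
      exact ⟨⟨j, hj⟩, Subtype.ext h⟩⟩
  rw [← Matrix.det_submatrix_equiv_self e]
  rfl

theorem sum_powerset_minor {ι : Type*} [DecidableEq ι] (L : ι → ι → ℝ) (N : Finset ι)
    (hL : IsUnit (1 + truncation L N).det) (X : Finset N) :
    ∑ Y ∈ N.powerset, (if X.map (Function.Embedding.subtype _) ⊆ Y then minor L Y else 0) =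
      (1 + truncation L N).det * ((1 - (1 + truncation L N)⁻¹).submatrix
        (Subtype.val : X → N) (Subtype.val : X → N)).det := by
  rw [← sum_minors_eq _ hL]
  refine (Finset.sum_nbij' (fun Y => Y.map (Function.Embedding.subtype _))
    (fun Y => Y.subtype (· ∈ N)) ?_ ?_ ?_ ?_ ?_).symm
  · intro Y _
    rw [Finset.mem_powerset]
    intro y hy
    obtain ⟨z, _, rfl⟩ := Finset.mem_map.mp hy
    exact z.2
  · simp
  · intro Y _
    ext y
    simp
  · intro Y hY
    rw [Finset.subtype_map]
    exact Finset.filter_true_of_mem fun y hy => Finset.mem_powerset.mp hY hy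
  · intro Y _
    simp only [Finset.map_subset_map]
    rw [minor_image]
    rfl

/-! ### Truncations of antisymmetric kernels -/

section Antisymmetric

theorem dotProduct_truncation_mulVec {ι : Type*} {L : ι → ι → ℝ} (hanti : ∀ x y, L y x = -L x y) (N : Finset ι) (u : N → ℝ) :
    u ⬝ᵥ (truncation L N).mulVec u = 0 := by
  have h : (truncation L N).transpose = -truncation L N := by
    ext i j; exact hanti i j
  have h2 : u ⬝ᵥ (truncation L N).mulVec u = -(u ⬝ᵥ (truncation L N).mulVec u) := by
    conv_lhs => rw [Matrix.dotProduct_mulVec, ← Matrix.mulVec_transpose, h, dotProduct_comm,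
      Matrix.neg_mulVec, dotProduct_neg]
  linarith

variable {ι : Type*} [DecidableEq ι] {L : ι → ι → ℝ}

theorem dotProduct_one_add_truncation_mulVec (hanti : ∀ x y, L y x = -L x y) (N : Finset ι)
    (u : N → ℝ) : u ⬝ᵥ (1 + truncation L N).mulVec u = u ⬝ᵥ u := by
  rw [Matrix.add_mulVec, dotProduct_add, dotProduct_truncation_mulVec hanti, Matrix.one_mulVec,
    add_zero]

/-- The quadratic form of an antisymmetric matrix vanishes, so a kernel vector u of 1 + L_N has u ·
u = 0. -/
theorem isUnit_det_one_add_truncation (hanti : ∀ x y, L y x = -L x y) (N : Finset ι) :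
    IsUnit (1 + truncation L N).det := by
  rw [isUnit_iff_ne_zero]
  intro h
  obtain ⟨u, hu, h0⟩ := Matrix.exists_mulVec_eq_zero_iff.mpr h
  have := dotProduct_one_add_truncation_mulVec hanti N u
  rw [h0, dotProduct_zero] at this
  exact hu (dotProduct_self_eq_zero.mp this.symm)

/-- From w · w = w · r, at the coordinate where |w| is largest. The constant does not depend on N.
-/
theorem abs_le_of_one_add_truncation_mulVec (hanti : ∀ x y, L y x = -L x y) (N : Finset ι)
    (w r : N → ℝ) (h : (1 + truncation L N).mulVec w = r) (x : N) : |w x| ≤ ∑ i, |r i| := by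
  have h1 := dotProduct_one_add_truncation_mulVec hanti N w
  rw [h] at h1
  obtain ⟨m, _, hm⟩ := Finset.exists_max_image Finset.univ (fun i => |w i|) ⟨x, Finset.mem_univ x⟩
  refine (hm x (Finset.mem_univ x)).trans ?_
  have h2 : |w m| * |w m| ≤ |w m| * ∑ i, |r i| :=
    calc |w m| * |w m| = w m * w m := abs_mul_abs_self _
      _ ≤ w ⬝ᵥ w := Finset.single_le_sum (f := fun i => w i * w i)
        (fun i _ => mul_self_nonneg _) (Finset.mem_univ m)
      _ = w ⬝ᵥ r := h1.symm
      _ ≤ ∑ i, |w m| * |r i| := Finset.sum_le_sum fun i _ =>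
        (le_abs_self _).trans ((abs_mul _ _).le.trans
          (mul_le_mul_of_nonneg_right (hm i (Finset.mem_univ i)) (abs_nonneg _)))
      _ = _ := (Finset.mul_sum _ _ _).symm
  rcases (abs_nonneg (w m)).eq_or_lt with h0 | h0
  · rw [← h0]; positivity
  · exact le_of_mul_le_mul_left h2 h0

variable {K : ι → ι → ℝ} {a : ι → ℝ} {C : ℝ}

/-- The column y of 1 - K solves (1 + L)v = e_y on the whole index set. Restricted to N it solves
the truncated system up to the tail of Lv outside N, and the bound independent of N applies to the
difference. -/
theorem abs_truncation_resolvent_sub_le (ha : Summable a) (ha0 : ∀ x, 0 ≤ a x)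
    (hLa : ∀ x y, |L x y| ≤ a x * a y)
    (hanti : ∀ x y, L y x = -L x y) (hK : ∀ x y, |K x y| ≤ C)
    (hKL : ∀ x y, HasSum (fun z => L x z * K z y) (L x y - K x y)) (N : Finset ι) (x y : N) :
    |(1 - (1 + truncation L N)⁻¹) x y - K x y| ≤
      (1 + C) * (∑' i, a i) * ∑' z : {z // z ∉ N}, a z := by
  have hC : 0 ≤ C := (abs_nonneg _).trans (hK x x)
  set R := (1 + truncation L N)⁻¹ with hR
  have hu := isUnit_det_one_add_truncation hanti N
  set v : ι → ℝ := fun z => (if z = y then 1 else 0) - K z y with hv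
  have hvC : ∀ z, |v z| ≤ 1 + C := fun z => by
    rw [hv]
    refine (abs_sub _ _).trans (add_le_add ?_ (hK z y))
    split_ifs <;> simp
  have hLv : ∀ i : ι, HasSum (fun z => L i z * v z) (K i y) := fun i => by
    have h1 : HasSum (fun z : ι => L i z * (if z = y then 1 else 0)) (L i y) :=
      hasSum_of_eq (hasSum_ite_eq (y : ι) (L i y)) rfl fun z => by
        by_cases h : z = y
        · subst h; simp
        · simp [h]
    exact hasSum_of_eq (h1.sub (hKL i y)) (by ring) fun z => by rw [hv]; ring
  have hs : ∀ i : ι, Summable fun z => L i z * v z := fun i => (hLv i).summable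
  set r : N → ℝ := fun i => -∑' z : {z // z ∉ N}, L i z * v z with hr
  set w : N → ℝ := fun i => v i - R i y with hw
  have hwr : (1 + truncation L N).mulVec w = r := by
    have e1 : w = (fun i : N => v i) - R.mulVec (Pi.single y 1) := by
      ext i; simp [hw]
    rw [e1, Matrix.mulVec_sub, Matrix.mulVec_mulVec, hR, Matrix.mul_nonsing_inv _ hu,
      Matrix.one_mulVec, Matrix.add_mulVec, Matrix.one_mulVec]
    ext i
    have e2 := (hs i).sum_add_tsum_subtype_compl N
    rw [(hLv i).tsum_eq] at e2
    have e3 : (truncation L N).mulVec (fun i : N => v i) i = ∑ z ∈ N, L i z * v z := by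
      rw [← Finset.sum_coe_sort]; rfl
    have e4 : v i = (Pi.single y 1 : N → ℝ) i - K i y := by
      simp only [hv, Pi.single_apply, Subtype.ext_iff]
    simp only [Pi.sub_apply, Pi.add_apply, e3, e4, hr]
    linarith
  have hb := abs_le_of_one_add_truncation_mulVec hanti N w r hwr x
  have hrb : ∀ i : N, |r i| ≤ a i * ((1 + C) * ∑' z : {z // z ∉ N}, a z) := fun i => by
    rw [hr]
    simp only [abs_neg]
    rw [← Real.norm_eq_abs, ← tsum_mul_left, ← tsum_mul_left]
    refine tsum_of_norm_bounded ((((ha.subtype _).mul_left _).mul_left _).hasSum) fun z => ?_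
    rw [Real.norm_eq_abs, abs_mul]
    calc |L i z| * |v z| ≤ (a i * a z) * (1 + C) :=
          mul_le_mul (hLa _ _) (hvC _) (abs_nonneg _) (mul_nonneg (ha0 _) (ha0 _))
      _ = _ := by simp only [Function.comp_apply]; ring
  have hwx : (1 - R) x y - K x y = w x := by
    simp only [hw, hv, Matrix.sub_apply, Matrix.one_apply, Subtype.ext_iff]
    ring
  rw [hwx]
  have ht : 0 ≤ ∑' z : {z // z ∉ N}, a z := tsum_nonneg fun _ => ha0 _
  calc |w x| ≤ ∑ i : N, a i * ((1 + C) * ∑' z : {z // z ∉ N}, a z) :=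
        hb.trans (Finset.sum_le_sum fun i _ => hrb i)
    _ = (∑ i ∈ N, a i) * ((1 + C) * ∑' z : {z // z ∉ N}, a z) := by
        rw [← Finset.sum_mul, Finset.sum_coe_sort N a]
    _ ≤ (∑' i, a i) * ((1 + C) * ∑' z : {z // z ∉ N}, a z) := by
        gcongr
        exact ha.sum_le_tsum _ fun _ _ => ha0 _
    _ = _ := by ring

/-- In an `L`-ensemble, the correlation functions are the minors of `K = L (1 + L)⁻¹`. -/
theorem tsum_minor_eq (ha : Summable a) (ha0 : ∀ x, 0 ≤ a x) (hLa : ∀ x y, |L x y| ≤ a x * a y)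
    (hanti : ∀ x y, L y x = -L x y) (hK : ∀ x y, |K x y| ≤ C)
    (hKL : ∀ x y, HasSum (fun z => L x z * K z y) (L x y - K x y)) {Z : ℝ}
    (hZ : HasSum (minor L) Z) (hnn : ∀ Y, 0 ≤ minor L Y) (X : Finset ι) :
    ∑' Y : Finset ι, (if X ⊆ Y then minor L Y else 0) = Z * minor K X := by
  have hs : Summable fun Y : Finset ι => if X ⊆ Y then minor L Y else 0 :=
    Summable.of_nonneg_of_le (fun Y => by split_ifs; exacts [hnn Y, le_rfl])
      (fun Y => by split_ifs; exacts [le_rfl, hnn Y]) hZ.summable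
  -- Powersets of finite sets are cofinal among finite families, so the full sums are limits of sums
  -- over the subsets of N.
  have hpow : Tendsto (Finset.powerset : Finset ι → Finset (Finset ι)) atTop atTop := by
    refine tendsto_atTop.mpr fun S => ?_
    filter_upwards [eventually_ge_atTop (S.biUnion id)] with N hN Y hY
    exact Finset.mem_powerset.mpr ((Finset.subset_biUnion_of_mem id hY).trans hN)
  have h1 := hs.hasSum.comp hpow
  have h0 := hZ.comp hpow
  -- The case of an empty X: the partial normalization is det(1 + L_N).
  have hdet : ∀ N : Finset ι, ∑ Y ∈ N.powerset, minor L Y = (1 + truncation L N).det := fun N => by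
    have := sum_powerset_minor L N (isUnit_det_one_add_truncation hanti N) ∅
    simpa using this
  have hent : ∀ x y : X, Tendsto (fun N : Finset ι => if h : X ⊆ N then
      (1 - (1 + truncation L N)⁻¹) ⟨x, h x.2⟩ ⟨y, h y.2⟩ else 0) atTop (𝓝 (K x y)) := by
    intro x y
    rw [tendsto_iff_norm_sub_tendsto_zero]
    have ht : Tendsto (fun N : Finset ι => (1 + C) * (∑' i, a i) * ∑' z : {z // z ∉ N}, a z) atTop
        (𝓝 0) := by
      simpa using (tendsto_tsum_compl_atTop_zero a).const_mul ((1 + C) * ∑' i, a i)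
    refine squeeze_zero' (Eventually.of_forall fun _ => norm_nonneg _) ?_ ht
    filter_upwards [eventually_ge_atTop X] with N hN
    rw [dif_pos hN]
    exact abs_truncation_resolvent_sub_le ha ha0 hLa hanti hK hKL N ⟨x, hN x.2⟩ ⟨y, hN y.2⟩
  have hlim : Tendsto (fun N : Finset ι => (Matrix.of fun x y : X => if h : X ⊆ N then
      (1 - (1 + truncation L N)⁻¹) ⟨x, h x.2⟩ ⟨y, h y.2⟩ else 0).det) atTop (𝓝 (minor K X)) := by
    have hc : Continuous fun M : Matrix X X ℝ => M.det := continuous_id.matrix_det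
    refine (hc.tendsto _).comp ?_
    exact tendsto_pi_nhds.mpr fun x => tendsto_pi_nhds.mpr fun y => hent x y
  refine tendsto_nhds_unique h1 ((h0.mul hlim).congr' ?_)
  filter_upwards [eventually_ge_atTop X] with N hN
  have h3 := sum_powerset_minor L N (isUnit_det_one_add_truncation hanti N) (X.subtype (· ∈ N))
  have h4 : (X.subtype (· ∈ N)).map (Function.Embedding.subtype _) = X := by
    rw [Finset.subtype_map]
    exact Finset.filter_true_of_mem fun y hy => hN hy
  rw [h4] at h3
  simp only [Function.comp_apply]
  rw [h3, hdet]
  congr 1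
  let e : X ≃ (X.subtype (· ∈ N)) :=
    { toFun := fun x => ⟨⟨x, hN x.2⟩, by simp⟩
      invFun := fun x => ⟨x.1.1, Finset.mem_subtype.mp x.2⟩
      left_inv := fun _ => rfl
      right_inv := fun _ => rfl }
  rw [← Matrix.det_submatrix_equiv_self e]
  congr 1
  ext x y
  simp only [Matrix.of_apply, dif_pos hN]
  rfl

end Antisymmetric

/-! ### Operators with summable kernels -/

section Operators

variable {ι : Type*} [DecidableEq ι] {L K : ι → ι → ℝ} {a : ι → ℝ} {C : ℝ}

/-- The standard basis vectors of `ℓ²`. -/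
def basisVec (x : ι) : lp (fun _ : ι => ℝ) 2 := lp.single 2 x 1

theorem inner_basisVec (x : ι) (f : lp (fun _ : ι => ℝ) 2) : inner ℝ (basisVec x) f = f x := by
  rw [basisVec, lp.inner_single_left]; simp

theorem basisVec_apply (x y : ι) : basisVec x y = if y = x then 1 else 0 := by
  rw [basisVec, lp.single_apply, Pi.single_apply]

/-- The matrix units as operators on `ℓ²`. -/
def matrixUnit (x y : ι) : lp (fun _ : ι => ℝ) 2 →L[ℝ] lp (fun _ : ι => ℝ) 2 :=
  (innerSL ℝ (basisVec y)).smulRight (basisVec x)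

theorem matrixUnit_apply (x y : ι) (f : lp (fun _ : ι => ℝ) 2) :
    matrixUnit x y f = f y • basisVec x := by
  simp [matrixUnit, inner_basisVec]

theorem norm_basisVec (x : ι) : ‖basisVec x‖ = 1 := by
  rw [basisVec, lp.norm_single (by norm_num), norm_one]

theorem norm_matrixUnit_le (x y : ι) : ‖matrixUnit x y‖ ≤ 1 := by
  rw [matrixUnit, ContinuousLinearMap.norm_smulRight_apply, innerSL_apply_norm, norm_basisVec,
    norm_basisVec, one_mul]

/-- Matrix units have norm at most one, so the bound by a x * a y makes the matrix series converge
in operator norm. Antisymmetry exchanges (x, y) and kills the quadratic form. -/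
theorem exists_operator_of_kernel (ha : Summable a) (ha0 : ∀ x, 0 ≤ a x)
    (hLa : ∀ x y, |L x y| ≤ a x * a y) (hanti : ∀ x y, L y x = -L x y) :
    ∃ T : lp (fun _ : ι => ℝ) 2 →L[ℝ] lp (fun _ : ι => ℝ) 2,
      (∀ f x, HasSum (fun y => L x y * f y) (T f x)) ∧ ∀ f, inner ℝ (T f) f = 0 := by
  have hs : Summable fun p : ι × ι => L p.1 p.2 • matrixUnit p.1 p.2 := by
    refine Summable.of_norm_bounded (ha.mul_of_nonneg ha ha0 ha0) fun p => ?_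
    rw [norm_smul]
    exact (mul_le_of_le_one_right (norm_nonneg _) (norm_matrixUnit_le _ _)).trans (hLa _ _)
  have hTf : ∀ f g, HasSum (fun p : ι × ι => L p.1 p.2 * (f p.2 * g p.1))
      (inner ℝ g ((∑' p : ι × ι, L p.1 p.2 • matrixUnit p.1 p.2) f)) := fun f g => by
    have h1 := hs.hasSum.mapL (ContinuousLinearMap.apply ℝ (lp (fun _ : ι => ℝ) 2) f)
    have h2 := h1.mapL (innerSL ℝ g)
    refine h2.congr_fun fun p => ?_
    simp only [ContinuousLinearMap.apply_apply, smul_apply, matrixUnit_apply,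
      innerSL_apply_apply, inner_smul_right]
    rw [real_inner_comm, inner_basisVec]
  refine ⟨∑' p : ι × ι, L p.1 p.2 • matrixUnit p.1 p.2, fun f x => ?_, fun f => ?_⟩
  · rw [← inner_basisVec]
    have h := hTf f (basisVec x)
    have hinj : Function.Injective fun y : ι => (x, y) := fun y z h => by simpa using h
    rw [← hinj.hasSum_iff] at h
    · refine h.congr_fun fun y => ?_
      simp [basisVec_apply]
    · rintro ⟨x', y⟩ hp
      have : x' ≠ x := fun h => hp ⟨y, by rw [h]⟩
      simp [basisVec_apply, this]
  · have h := hTf f f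
    have h2 := (Equiv.prodComm ι ι).hasSum_iff.mpr h
    have h3 := h2.unique (hasSum_of_eq h.neg rfl fun p => by
      simp only [Function.comp_apply, Equiv.prodComm_apply, Prod.fst_swap, Prod.snd_swap]
      rw [hanti p.1 p.2]; ring)
    rw [real_inner_comm]
    linarith

theorem exists_resolvent (ha : Summable a) (ha0 : ∀ x, 0 ≤ a x)
    (hLa : ∀ x y, |L x y| ≤ a x * a y) (hanti : ∀ x y, L y x = -L x y)
    (hKa : ∀ x y, |K x y| ≤ C * a x)
    (hKL : ∀ x y, HasSum (fun z => L x z * K z y) (L x y - K x y)) :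
    ∃ T S : lp (fun _ : ι => ℝ) 2 →L[ℝ] lp (fun _ : ι => ℝ) 2,
      (∀ f x, HasSum (fun y => L x y * f y) (T f x)) ∧
      (∀ f x, HasSum (fun y => K x y * f y) (S f x)) ∧
      IsUnit (1 + T) ∧ S = T * Ring.inverse (1 + T) := by
  obtain ⟨T, hT, hTi⟩ := exists_operator_of_kernel ha ha0 hLa hanti
  have hu : IsUnit (1 + T) := by
    -- Coercivity: ⟨(1 + T)f, f⟩ = ‖f‖².
    refine ContinuousLinearMap.isUnit_of_forall_le_norm_inner_map (1 + T) (c := 1) one_pos fun f => ?_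
    rw [add_apply, inner_add_left, hTi, one_apply_eq_self]
    simp
  set R := Ring.inverse (1 + T) with hR
  have hRl : R * (1 + T) = 1 := Ring.inverse_mul_cancel _ hu
  have hRr : (1 + T) * R = 1 := Ring.mul_inverse_cancel _ hu
  -- The columns of K are in ℓ¹, hence in ℓ².
  have hcol : ∀ y, Memℓp (fun x => K x y) 2 := fun y => by
    refine Memℓp.of_exponent_ge (q := 1) (memℓp_gen ?_) one_le_two
    simp only [ENNReal.toReal_one, Real.rpow_one]
    exact Summable.of_nonneg_of_le (fun _ => norm_nonneg _) (fun x => hKa x y) (ha.mul_left C)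
  have hTb : ∀ x y, T (basisVec y) x = L x y := fun x y => by
    refine (hT (basisVec y) x).unique (hasSum_of_eq (hasSum_ite_eq y (L x y)) rfl fun z => ?_)
    rw [basisVec_apply]
    by_cases h : z = y
    · subst h; simp
    · simp [h]
  have hTR : T * R = R * T := by
    have h1 : T * R = 1 - R := by rw [← hRr]; noncomm_ring
    have h2 : R * T = 1 - R := by rw [← hRl]; noncomm_ring
    rw [h1, h2]
  have hSb : ∀ y, (T * R) (basisVec y) = ⟨fun x => K x y, hcol y⟩ := fun y => by
    set k : lp (fun _ : ι => ℝ) 2 := ⟨fun x => K x y, hcol y⟩ with hk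
    -- The relation L = K + LK read on the column y; multiplying by (1 + T)⁻¹ identifies that column
    -- of T(1 + T)⁻¹ with k.
    have h1 : T (basisVec y) = (1 + T) k := by
      ext x
      rw [hTb, add_apply, one_apply_eq_self, lp.coeFn_add,
        Pi.add_apply, (hT k x).unique (hKL x y)]
      change _ = K x y + _
      ring
    rw [hTR, mul_apply_eq_comp, h1, ← mul_apply_eq_comp, hRl,
      one_apply_eq_self]
  refine ⟨T, T * R, hT, fun f x => ?_, hu, rfl⟩
  have h1 := lp.hasSum_single (p := 2) (by norm_num) f
  have h2 := (h1.mapL (T * R)).mapL (innerSL ℝ (basisVec x))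
  rw [innerSL_apply_apply, inner_basisVec] at h2
  refine h2.congr_fun fun y => ?_
  have h3 : lp.single 2 y (f y) = f y • basisVec y := by
    rw [basisVec, ← lp.single_smul, smul_eq_mul, mul_one]
  rw [innerSL_apply_apply, inner_basisVec, h3, map_smul, hSb, lp.coeFn_smul, Pi.smul_apply,
    smul_eq_mul, mul_comm]

end Operators

/-! ### Frobenius determinants -/

section Cofactors

variable {n : Type*} [Fintype n] [DecidableEq n]

/-- The first variation of the determinant in the direction B. Replacing rows and replacing columns
give the same pairing with cofactors, which lets moves of arms and of legs be added up. -/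
theorem sum_det_updateRow (M B : Matrix n n ℝ) :
    ∑ i, (M.updateRow i (B i)).det = ∑ i, ∑ j, B i j * M.adjugate j i := by
  refine Finset.sum_congr rfl fun i _ => ?_
  rw [← Matrix.cramer_transpose_apply, Matrix.cramer_eq_adjugate_mulVec, ← Matrix.adjugate_transpose]
  simp [Matrix.mulVec, dotProduct, mul_comm]

theorem sum_det_updateCol (M B : Matrix n n ℝ) :
    ∑ j, (M.updateCol j fun i => B i j).det = ∑ i, ∑ j, B i j * M.adjugate j i := by
  rw [Finset.sum_comm]
  refine Finset.sum_congr rfl fun j _ => ?_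
  rw [← Matrix.cramer_apply, Matrix.cramer_eq_adjugate_mulVec]
  simp [Matrix.mulVec, dotProduct, mul_comm]

theorem sum_mul_adjugate_row (M : Matrix n n ℝ) (i : n) : ∑ j, M i j * M.adjugate j i = M.det := by
  have := congrFun (congrFun M.mul_adjugate i) i
  simpa [Matrix.mul_apply] using this

theorem sum_mul_adjugate_col (M : Matrix n n ℝ) (j : n) : ∑ i, M i j * M.adjugate j i = M.det := by
  have := congrFun (congrFun M.adjugate_mul j) j
  simpa [Matrix.mul_apply, mul_comm] using this

theorem det_add_eq_sum (M B : Matrix n n ℝ) :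
    (M + B).det = ∑ S : Finset n, (Matrix.of fun i j => if i ∈ S then M i j else B i j).det := by
  have h := (Matrix.detRowAlternating (R := ℝ) (n := n)).map_add_univ M B
  refine Eq.trans h (Finset.sum_congr rfl fun S _ => ?_)
  change Matrix.det _ = _
  congr 1
  ext i j
  by_cases hi : i ∈ S <;> simp [Finset.piecewise, hi]

/-- For a rank-one perturbation only terms replacing at most one row of M survive the multilinear
expansion, so the first-order expansion is exact. -/
theorem det_sub_mul_eq (M : Matrix n n ℝ) (u v : n → ℝ) :
    (M - Matrix.of fun i j => u i * v j).det =
      M.det - ∑ i, ∑ j, (u i * v j) * M.adjugate j i := by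
  have e1 : M - Matrix.of (fun i j => u i * v j) = M + Matrix.of fun i j => -(u i * v j) := by
    ext i j; simp [sub_eq_add_neg]
  rw [e1, det_add_eq_sum, ← Finset.sum_subset (Finset.subset_univ
    (insert Finset.univ (Finset.univ.image fun i : n => ({i} : Finset n)ᶜ)))]
  · rw [Finset.sum_insert, Finset.sum_image]
    · have h := sum_det_updateRow M (Matrix.of fun i j => -(u i * v j))
      simp only [Matrix.of_apply, neg_mul, Finset.sum_neg_distrib] at h
      rw [sub_eq_add_neg, ← h]
      congr 1
      · simp only [Finset.mem_univ, if_true]; rfl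
      · refine Finset.sum_congr rfl fun i _ => ?_
        congr 1
        ext k j
        by_cases hk : k = i
        · subst hk; simp
        · simp [hk]
    · intro i _ j _ hij
      simpa using hij
    · simp only [Finset.mem_image, Finset.mem_univ, true_and, not_exists]
      intro i hi
      have : i ∈ ({i} : Finset n)ᶜ := hi ▸ Finset.mem_univ i
      simp at this
  · intro S _ hS
    simp only [Finset.mem_insert, Finset.mem_image, Finset.mem_univ, true_and, not_or,
      not_exists] at hS
    obtain ⟨i, hi⟩ : ∃ i, i ∉ S := by
      by_contra! h0
      exact hS.1 (Finset.eq_univ_iff_forall.mpr h0)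
    obtain ⟨k, hk, hki⟩ : ∃ k, k ∉ S ∧ k ≠ i := by
      by_contra! h0
      refine hS.2 i (Finset.ext fun k => ?_)
      rw [Finset.mem_compl, Finset.mem_singleton]
      exact ⟨fun hki => by_contra fun hk => hki (h0 k hk), fun hk hki => hi (hki ▸ hk)⟩
    -- Two replaced rows i and k are both multiples of v, so one can be cleared by the other.
    by_cases hui : u i = 0
    · refine Matrix.det_eq_zero_of_row_eq_zero i fun j => ?_
      simp [hi, hui]
    · rw [← Matrix.det_updateRow_add_smul_self _ hki (-(u k / u i))]
      refine Matrix.det_eq_zero_of_row_eq_zero k fun j => ?_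
      rw [Matrix.updateRow_self]
      simp only [hi, hk, if_false, Pi.add_apply, Pi.smul_apply, smul_eq_mul, Matrix.of_apply]
      field_simp
      ring

end Cofactors

/-- The number of standard tableaux of the hook `(p | q)`, divided by the factorial of its size. -/
def hookCoeff (p q : ℕ) : ℝ := (((p : ℝ) + q + 1) * p.factorial * q.factorial)⁻¹

theorem hookCoeff_symm (p q : ℕ) : hookCoeff p q = hookCoeff q p := by
  unfold hookCoeff; rw [add_comm (p : ℝ) q]; ring

/-- The Frobenius determinant of two tuples. -/
def frobDet {d : ℕ} (p q : Fin d → ℕ) : ℝ := (Matrix.of fun i j => hookCoeff (p i) (q j)).det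

theorem frobDet_symm {d : ℕ} (p q : Fin d → ℕ) : frobDet p q = frobDet q p := by
  unfold frobDet
  rw [← Matrix.det_transpose]
  congr 1
  ext i j
  exact hookCoeff_symm _ _

theorem frobDet_eq_zero {d : ℕ} {p : Fin d → ℕ} (q : Fin d → ℕ) {i j : Fin d} (hij : i ≠ j)
    (h : p i = p j) : frobDet p q = 0 :=
  Matrix.det_zero_of_row_eq hij (by ext k; simp [h])

theorem frobDet_update_left {d : ℕ} (p q : Fin d → ℕ) (i : Fin d) (x : ℕ) :
    frobDet (Function.update p i x) q = ((Matrix.of fun i j => hookCoeff (p i) (q j)).updateRow i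
      fun j => hookCoeff x (q j)).det := by
  unfold frobDet
  congr 1
  ext k j
  by_cases hk : k = i
  · subst hk; simp
  · simp [hk]

theorem frobDet_update_right {d : ℕ} (p q : Fin d → ℕ) (j : Fin d) (x : ℕ) :
    frobDet p (Function.update q j x) = ((Matrix.of fun i j => hookCoeff (p i) (q j)).updateCol j
      fun i => hookCoeff (p i) x).det := by
  unfold frobDet
  congr 1
  ext i k
  by_cases hk : k = j
  · subst hk; simp
  · simp [hk]

/-- Schur complement of the corner entry, which is hookCoeff 0 0 = 1. -/
theorem frobDet_cons {d : ℕ} (p q : Fin d → ℕ) :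
    frobDet (Fin.cons 0 p : Fin (d + 1) → ℕ) (Fin.cons 0 q : Fin (d + 1) → ℕ) =
      (Matrix.of (fun i j => hookCoeff (p i) (q j)) -
        Matrix.of fun i j => hookCoeff (p i) 0 * hookCoeff 0 (q j)).det := by
  unfold frobDet
  let e : Unit ⊕ Fin d ≃ Fin (d + 1) :=
    (Equiv.sumComm _ _).trans ((Equiv.optionEquivSumPUnit _).symm.trans (finSuccEquiv d).symm)
  rw [← Matrix.det_submatrix_equiv_self e]
  have h : (Matrix.of fun i j => hookCoeff ((Fin.cons 0 p : Fin (d + 1) → ℕ) i)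
      ((Fin.cons 0 q : Fin (d + 1) → ℕ) j)).submatrix e e =
      Matrix.fromBlocks 1 (Matrix.of fun _ j => hookCoeff 0 (q j))
        (Matrix.of fun i _ => hookCoeff (p i) 0) (Matrix.of fun i j => hookCoeff (p i) (q j)) := by
    ext (i | i) (j | j) <;> simp [e, hookCoeff]
  rw [h, Matrix.det_fromBlocks_one₁₁]
  congr 1
  ext i j
  simp [Matrix.mul_apply]

/-- Adding a box. -/
theorem frobDet_up {d : ℕ} (p q : Fin d → ℕ) :
    ∑ i, frobDet (Function.update p i (p i + 1)) q + ∑ j, frobDet p (Function.update q j (q j + 1)) +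
      frobDet (Fin.cons 0 p : Fin (d + 1) → ℕ) (Fin.cons 0 q : Fin (d + 1) → ℕ) = frobDet p q := by
  have h1 := sum_det_updateRow (Matrix.of fun i j => hookCoeff (p i) (q j))
    (Matrix.of fun i j => hookCoeff (p i + 1) (q j))
  have h2 := sum_det_updateCol (Matrix.of fun i j => hookCoeff (p i) (q j))
    (Matrix.of fun i j => hookCoeff (p i) (q j + 1))
  simp only [frobDet_update_left, frobDet_update_right]
  rw [frobDet_cons, det_sub_mul_eq]
  refine (congrArg₂ (· + ·) (congrArg₂ (· + ·) h1 h2) rfl).trans ?_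
  -- The two one-step variations add up to the rank-one matrix that appears when a new diagonal cell
  -- borders the determinant, so the bordered term cancels them.
  have h3 : ∀ x y : ℕ, hookCoeff (x + 1) y + hookCoeff x (y + 1) = hookCoeff x 0 * hookCoeff 0 y := by
    intro x y
    unfold hookCoeff
    rw [Nat.factorial_succ, Nat.factorial_succ]
    push_cast
    have hx : (0 : ℝ) ≤ x := by positivity
    have hy : (0 : ℝ) ≤ y := by positivity
    have : (x : ℝ) + 1 + y + 1 ≠ 0 := by positivity
    have : (x : ℝ) + (y + 1) + 1 ≠ 0 := by positivity
    field_simp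
    simp
    ring
  simp only [← h3, Matrix.of_apply, add_mul, Finset.sum_add_distrib]
  unfold frobDet
  ring

/-- Removing a box. -/
theorem frobDet_down {d : ℕ} (p q : Fin d → ℕ) :
    ∑ i, (if p i = 0 then 0 else frobDet (Function.update p i (p i - 1)) q) +
      ∑ j, (if q j = 0 then 0 else frobDet p (Function.update q j (q j - 1))) +
      ∑ i, ∑ j, (if p i = 0 ∧ q j = 0 then 1 else 0) *
        (Matrix.of fun i j => hookCoeff (p i) (q j)).adjugate j i =
      (∑ i, p i + ∑ i, q i + d : ℕ) * frobDet p q := by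
  set M := Matrix.of fun i j => hookCoeff (p i) (q j) with hM
  have h1 := sum_det_updateRow M
    (Matrix.of fun i j => if p i = 0 then 0 else hookCoeff (p i - 1) (q j))
  have h2 := sum_det_updateCol M
    (Matrix.of fun i j => if q j = 0 then 0 else hookCoeff (p i) (q j - 1))
  have e1 : ∀ i, (if p i = 0 then 0 else frobDet (Function.update p i (p i - 1)) q) =
      (M.updateRow i ((Matrix.of fun i j => if p i = 0 then 0 else hookCoeff (p i - 1) (q j)) i)).det := by
    intro i
    split_ifs with h
    · refine (Matrix.det_eq_zero_of_row_eq_zero i fun j => ?_).symm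
      simp [h]
    · rw [frobDet_update_left]
      congr 2
      ext j
      simp [h]
  have e2 : ∀ j, (if q j = 0 then 0 else frobDet p (Function.update q j (q j - 1))) =
      (M.updateCol j fun i => (Matrix.of fun i j => if q j = 0 then 0 else hookCoeff (p i) (q j - 1)) i j).det := by
    intro j
    split_ifs with h
    · refine (Matrix.det_eq_zero_of_column_eq_zero j fun i => ?_).symm
      simp [h]
    · rw [frobDet_update_right]
      congr 2
      ext i
      simp [h]
  -- The removal rule for a single hook. Its one-cell case yields the empty diagram, accounted for
  -- by the indicator.
  have h3 : ∀ x y : ℕ, (if x = 0 then 0 else hookCoeff (x - 1) y) +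
      (if y = 0 then 0 else hookCoeff x (y - 1)) + (if x = 0 ∧ y = 0 then 1 else 0) =
      ((x : ℝ) + y + 1) * hookCoeff x y := by
    intro x y
    rcases x with _ | x <;> rcases y with _ | y
    · simp [hookCoeff]
    all_goals
      simp [hookCoeff, Nat.factorial_succ]
      field_simp
      try ring
  simp only [e1, e2]
  rw [h1, h2, ← Finset.sum_add_distrib, ← Finset.sum_add_distrib]
  simp only [← Finset.sum_add_distrib, ← add_mul, Matrix.of_apply, h3]
  -- Against the cofactors, p i is summed by row expansions, q j by column expansions, and the
  -- remaining 1 over the d rows.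
  have h4 : ∀ i j, ((p i : ℝ) + q j + 1) * hookCoeff (p i) (q j) * M.adjugate j i =
      p i * (M i j * M.adjugate j i) + q j * (M i j * M.adjugate j i) + M i j * M.adjugate j i := by
    intro i j; simp only [hM, Matrix.of_apply]; ring
  simp only [h4, Finset.sum_add_distrib, ← Finset.mul_sum, sum_mul_adjugate_row]
  rw [Finset.sum_comm (f := fun i j => (q j : ℝ) * (M i j * M.adjugate j i))]
  simp only [← Finset.mul_sum, sum_mul_adjugate_col, ← Finset.sum_mul]
  push_cast
  simp only [Finset.sum_const, Finset.card_univ, Fintype.card_fin, nsmul_eq_mul]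
  unfold frobDet
  ring

theorem adjugate_zero_zero {d : ℕ} (p q : Fin (d + 1) → ℕ) :
    (Matrix.of fun i j => hookCoeff (p i) (q j)).adjugate 0 0 = frobDet (Fin.tail p) (Fin.tail q) := by
  rw [Matrix.adjugate_fin_succ_eq_det_submatrix]
  simp only [Fin.val_zero, add_zero, pow_zero, one_mul, Fin.succAbove_zero]
  rfl

/-- The Frobenius determinant of two finite sets of the same cardinality. -/
def frob (P Q : Finset ℕ) : ℝ :=
  if h : Q.card = P.card then frobDet (P.orderEmbOfFin rfl) (Q.orderEmbOfFin h) else 0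

theorem frob_eq_frobDet {d : ℕ} {p q : Fin d → ℕ} (hp : StrictMono p) (hq : StrictMono q) :
    frob (Finset.univ.image p) (Finset.univ.image q) = frobDet p q := by
  have key : ∀ (P Q : Finset ℕ) (hP : P.card = d) (hQ : Q.card = d),
      frob P Q = frobDet (P.orderEmbOfFin hP) (Q.orderEmbOfFin hQ) := by
    intro P Q hP hQ
    subst hP
    rw [frob, dif_pos hQ]
  have hcard : ∀ p : Fin d → ℕ, StrictMono p → (Finset.univ.image p).card = d := fun p hp => by
    rw [Finset.card_image_of_injective _ hp.injective, Finset.card_univ, Fintype.card_fin]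
  rw [key _ _ (hcard p hp) (hcard q hq),
    ← Finset.orderEmbOfFin_unique (hcard p hp)
      (fun x => Finset.mem_image_of_mem p (Finset.mem_univ x)) hp,
    ← Finset.orderEmbOfFin_unique (hcard q hq)
      (fun x => Finset.mem_image_of_mem q (Finset.mem_univ x)) hq]

theorem exists_strictMono_image_eq {d : ℕ} {P : Finset ℕ} (hP : P.card = d) :
    ∃ p : Fin d → ℕ, StrictMono p ∧ Finset.univ.image p = P :=
  ⟨P.orderEmbOfFin hP, (P.orderEmbOfFin hP).strictMono, by
    simp⟩

theorem exists_strictMono_images_eq {P Q : Finset ℕ} (h : P.card = Q.card) :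
    ∃ (d : ℕ) (p q : Fin d → ℕ), StrictMono p ∧ StrictMono q ∧
      Finset.univ.image p = P ∧ Finset.univ.image q = Q := by
  obtain ⟨p, hp, hP⟩ := exists_strictMono_image_eq h
  obtain ⟨q, hq, hQ⟩ := exists_strictMono_image_eq (P := Q) rfl
  exact ⟨_, p, q, hp, hq, hP, hQ⟩

theorem frob_symm {P Q : Finset ℕ} (h : P.card = Q.card) : frob P Q = frob Q P := by
  obtain ⟨d, p, q, hp, hq, rfl, rfl⟩ := exists_strictMono_images_eq h
  rw [frob_eq_frobDet hp hq, frob_eq_frobDet hq hp, frobDet_symm]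

theorem frob_empty : frob ∅ ∅ = 1 := by
  have h0 : ∀ p : Fin 0 → ℕ, StrictMono p := fun p i => i.elim0
  have := frob_eq_frobDet (h0 Fin.elim0) (h0 Fin.elim0)
  rw [Finset.univ_eq_empty, Finset.image_empty] at this
  rw [this, frobDet, Matrix.det_fin_zero]

/-- Replacement of an element of a finite set. -/
def replace (P : Finset ℕ) (x y : ℕ) : Finset ℕ := insert y (P.erase x)

theorem card_replace {P : Finset ℕ} {x y : ℕ} (hx : x ∈ P) (hy : y ∉ P) :
    (replace P x y).card = P.card := by
  rw [replace, Finset.card_insert_of_notMem fun h => hy (Finset.mem_of_mem_erase h),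
    Finset.card_erase_add_one hx]

theorem sum_replace {P : Finset ℕ} {x y : ℕ} (hx : x ∈ P) (hy : y ∉ P) :
    ∑ z ∈ replace P x y, z + x = ∑ z ∈ P, z + y := by
  rw [replace, Finset.sum_insert fun h => hy (Finset.mem_of_mem_erase h), add_assoc,
    Finset.sum_erase_add _ _ hx, add_comm]

theorem replace_replace {P : Finset ℕ} {x y : ℕ} (hx : x ∈ P) (hy : y ∉ P) :
    replace (replace P x y) y x = P := by
  rw [replace, replace, Finset.erase_insert fun h => hy (Finset.mem_of_mem_erase h),
    Finset.insert_erase hx]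

theorem image_update_eq {d : ℕ} {p : Fin d → ℕ} (hp : Function.Injective p) (i : Fin d) (y : ℕ) :
    Finset.univ.image (Function.update p i y) = replace (Finset.univ.image p) (p i) y := by
  ext z
  simp only [replace, Finset.mem_image, Finset.mem_univ, true_and, Finset.mem_insert,
    Finset.mem_erase]
  constructor
  · rintro ⟨j, rfl⟩
    by_cases hj : j = i
    · subst hj; simp
    · right
      rw [Function.update_of_ne hj]
      exact ⟨fun h => hj (hp h), j, rfl⟩
  · rintro (rfl | ⟨hz, j, rfl⟩)
    · exact ⟨i, by simp⟩
    · exact ⟨j, Function.update_of_ne (fun h => hz (by rw [h])) _ _⟩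

theorem strictMono_update {d : ℕ} {p : Fin d → ℕ} (hp : StrictMono p) (i : Fin d) (y : ℕ)
    (h1 : ∀ j < i, p j < y) (h2 : ∀ j, i < j → y < p j) : StrictMono (Function.update p i y) := by
  intro j k hjk
  by_cases hj : j = i
  · subst hj
    rw [Function.update_self, Function.update_of_ne hjk.ne']
    exact h2 k hjk
  · by_cases hk : k = i
    · subst hk
      rw [Function.update_self, Function.update_of_ne hjk.ne]
      exact h1 j hjk
    · rw [Function.update_of_ne hj, Function.update_of_ne hk]
      exact hp hjk

/-- The elements of a set that can be raised by one. -/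
def raisable (P : Finset ℕ) : Finset ℕ := P.filter fun x => x + 1 ∉ P

/-- The elements of a set that can be lowered by one. -/
def lowerable (P : Finset ℕ) : Finset ℕ := P.filter fun x => x ≠ 0 ∧ x - 1 ∉ P

/-- Indices with p i + 1 already present are absent on the left; on the right they give two equal
rows and contribute zero. Otherwise the update stays strictly increasing. -/
theorem sum_raisable {d : ℕ} {p q : Fin d → ℕ} (hp : StrictMono p) (hq : StrictMono q) :
    ∑ x ∈ raisable (Finset.univ.image p),
      frob (replace (Finset.univ.image p) x (x + 1)) (Finset.univ.image q) =
      ∑ i, frobDet (Function.update p i (p i + 1)) q := by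
  rw [raisable, Finset.sum_filter, Finset.sum_image fun i _ j _ h => hp.injective h]
  refine Finset.sum_congr rfl fun i _ => ?_
  by_cases h : p i + 1 ∉ Finset.univ.image p
  · rw [if_pos h, ← image_update_eq hp.injective, frob_eq_frobDet _ hq]
    have hne : ∀ j, p j ≠ p i + 1 := fun j hj => h (hj ▸ Finset.mem_image_of_mem p (Finset.mem_univ j))
    refine strictMono_update hp i _ (fun j hj => (hp hj).trans (Nat.lt_succ_self _)) fun j hj => ?_
    have := hp hj
    have := hne j
    lia
  · rw [if_neg h]
    simp only [Finset.mem_image, Finset.mem_univ, true_and, not_not] at h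
    obtain ⟨j, hj⟩ := h
    have hij : i ≠ j := by rintro rfl; lia
    exact (frobDet_eq_zero q hij (by rw [Function.update_self, Function.update_of_ne hij.symm, hj])).symm

theorem sum_lowerable {d : ℕ} {p q : Fin d → ℕ} (hp : StrictMono p) (hq : StrictMono q) :
    ∑ x ∈ lowerable (Finset.univ.image p),
      frob (replace (Finset.univ.image p) x (x - 1)) (Finset.univ.image q) =
      ∑ i, if p i = 0 then 0 else frobDet (Function.update p i (p i - 1)) q := by
  rw [lowerable, Finset.sum_filter, Finset.sum_image fun i _ j _ h => hp.injective h]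
  refine Finset.sum_congr rfl fun i _ => ?_
  by_cases h0 : p i = 0
  · simp [h0]
  rw [if_neg h0]
  by_cases h : p i - 1 ∉ Finset.univ.image p
  · rw [if_pos ⟨h0, h⟩, ← image_update_eq hp.injective, frob_eq_frobDet _ hq]
    have hne : ∀ j, p j ≠ p i - 1 := fun j hj => h (hj ▸ Finset.mem_image_of_mem p (Finset.mem_univ j))
    refine strictMono_update hp i _ (fun j hj => ?_) fun j hj => ?_
    · have := hp hj
      have := hne j
      lia
    · have := hp hj
      lia
  · rw [if_neg fun h' => h h'.2]
    simp only [Finset.mem_image, Finset.mem_univ, true_and, not_not] at h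
    obtain ⟨j, hj⟩ := h
    have hij : i ≠ j := by rintro rfl; lia
    exact (frobDet_eq_zero q hij (by rw [Function.update_self, Function.update_of_ne hij.symm, hj])).symm

theorem image_cons_eq {d : ℕ} (p : Fin d → ℕ) :
    Finset.univ.image (Fin.cons 0 p : Fin (d + 1) → ℕ) = insert 0 (Finset.univ.image p) := by
  ext z
  simp only [Finset.mem_image, Finset.mem_univ, true_and, Finset.mem_insert, Fin.exists_fin_succ,
    Fin.cons_zero, Fin.cons_succ, eq_comm]

theorem strictMono_cons {d : ℕ} {p : Fin d → ℕ} (hp : StrictMono p)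
    (h : 0 ∉ Finset.univ.image p) : StrictMono (Fin.cons 0 p : Fin (d + 1) → ℕ) := by
  have h' : ∀ i, 0 < p i := fun i => Nat.pos_of_ne_zero fun h0 =>
    h (h0 ▸ Finset.mem_image_of_mem p (Finset.mem_univ i))
  intro i j hij
  cases i using Fin.cases with
  | zero =>
    cases j using Fin.cases with
    | zero => exact absurd hij (lt_irrefl _)
    | succ j => simpa using h' j
  | succ i =>
    cases j using Fin.cases with
    | zero => exact absurd hij (by simp)
    | succ j => simpa using hp (Fin.succ_lt_succ_iff.mp hij)

/-- If 0 already occurs, the bordered determinant has a repeated row or column. -/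
theorem frob_insert_zero {d : ℕ} {p q : Fin d → ℕ} (hp : StrictMono p) (hq : StrictMono q) :
    (if 0 ∉ Finset.univ.image p ∧ 0 ∉ Finset.univ.image q then
      frob (insert 0 (Finset.univ.image p)) (insert 0 (Finset.univ.image q)) else 0) =
      frobDet (Fin.cons 0 p : Fin (d + 1) → ℕ) (Fin.cons 0 q : Fin (d + 1) → ℕ) := by
  have hz : ∀ p q : Fin d → ℕ, 0 ∈ Finset.univ.image p →
      frobDet (Fin.cons 0 p : Fin (d + 1) → ℕ) (Fin.cons 0 q : Fin (d + 1) → ℕ) = 0 := by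
    intro p q h
    obtain ⟨i, _, hi⟩ := Finset.mem_image.mp h
    exact frobDet_eq_zero _ (Fin.succ_ne_zero i).symm (by simp [hi])
  split_ifs with h
  · rw [← image_cons_eq, ← image_cons_eq,
      frob_eq_frobDet (strictMono_cons hp h.1) (strictMono_cons hq h.2)]
  · rw [not_and_or, not_not, not_not] at h
    rcases h with h | h
    · exact (hz p q h).symm
    · rw [frobDet_symm]; exact (hz q p h).symm

theorem image_tail_eq {d : ℕ} {p : Fin (d + 1) → ℕ} (hp : Function.Injective p) :
    Finset.univ.image (Fin.tail p) = (Finset.univ.image p).erase (p 0) := by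
  ext z
  simp only [Finset.mem_image, Finset.mem_univ, true_and, Finset.mem_erase, Fin.exists_fin_succ,
    Fin.tail]
  constructor
  · rintro ⟨j, rfl⟩
    exact ⟨fun h => Fin.succ_ne_zero j (hp h), Or.inr ⟨j, rfl⟩⟩
  · rintro ⟨h, h' | h'⟩
    · exact absurd h'.symm h
    · exact h'

/-- In a strictly increasing tuple 0 can only be the first entry, so a single corner cofactor
remains. -/
theorem sum_ite_mul_adjugate {d : ℕ} {p q : Fin d → ℕ} (hp : StrictMono p) (hq : StrictMono q) :
    ∑ i, ∑ j, (if p i = 0 ∧ q j = 0 then 1 else 0) *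
        (Matrix.of fun i j => hookCoeff (p i) (q j)).adjugate j i =
      if 0 ∈ Finset.univ.image p ∧ 0 ∈ Finset.univ.image q then
        frob ((Finset.univ.image p).erase 0) ((Finset.univ.image q).erase 0) else 0 := by
  split_ifs with h
  · obtain ⟨i, _, hi⟩ := Finset.mem_image.mp h.1
    obtain ⟨j, _, hj⟩ := Finset.mem_image.mp h.2
    rcases d with _ | d
    · exact i.elim0
    have hz : ∀ {p : Fin (d + 1) → ℕ}, StrictMono p → ∀ {i}, p i = 0 → ∀ k, p k = 0 ↔ k = 0 := by
      intro p hp i hi k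
      have h0 : p 0 = 0 := Nat.le_zero.mp ((hp.monotone (Fin.zero_le i)).trans hi.le)
      exact ⟨fun h => hp.injective (h.trans h0.symm), fun h => h ▸ h0⟩
    have hp0 := hz hp hi
    have hq0 := hz hq hj
    have tp : StrictMono (Fin.tail p) := fun a b hab => hp (Fin.succ_lt_succ_iff.mpr hab)
    have tq : StrictMono (Fin.tail q) := fun a b hab => hq (Fin.succ_lt_succ_iff.mpr hab)
    have e1 := image_tail_eq hp.injective
    have e2 := image_tail_eq hq.injective
    rw [(hp0 0).mpr rfl] at e1
    rw [(hq0 0).mpr rfl] at e2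
    rw [← e1, ← e2, frob_eq_frobDet tp tq, ← adjugate_zero_zero]
    simp only [hp0, hq0]
    rw [Finset.sum_eq_single 0, Finset.sum_eq_single 0]
    · simp
    · intro j _ hj; simp [hj]
    · simp
    · intro i _ hi; simp [hi]
    · simp
  · refine Finset.sum_eq_zero fun i _ => Finset.sum_eq_zero fun j _ => ?_
    rw [if_neg, zero_mul]
    rintro ⟨hi, hj⟩
    exact h ⟨hi ▸ Finset.mem_image_of_mem p (Finset.mem_univ i),
      hj ▸ Finset.mem_image_of_mem q (Finset.mem_univ j)⟩

/-- The Pieri-type recursion for the Frobenius determinants: adding a box. -/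
theorem frob_up {P Q : Finset ℕ} (h : P.card = Q.card) :
    ∑ x ∈ raisable P, frob (replace P x (x + 1)) Q + ∑ y ∈ raisable Q, frob P (replace Q y (y + 1)) +
      (if 0 ∉ P ∧ 0 ∉ Q then frob (insert 0 P) (insert 0 Q) else 0) = frob P Q := by
  have hs : ∑ y ∈ raisable Q, frob P (replace Q y (y + 1)) =
      ∑ y ∈ raisable Q, frob (replace Q y (y + 1)) P := by
    refine Finset.sum_congr rfl fun y hy => frob_symm ?_
    rw [raisable, Finset.mem_filter] at hy
    rw [card_replace hy.1 hy.2, h]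
  rw [hs]
  obtain ⟨d, p, q, hp, hq, rfl, rfl⟩ := exists_strictMono_images_eq h
  rw [sum_raisable hp hq, sum_raisable hq hp, frob_insert_zero hp hq, frob_eq_frobDet hp hq,
    ← frobDet_up p q]
  simp only [frobDet_symm p]

/-- The recursion for the Frobenius determinants: removing a box. -/
theorem frob_down {P Q : Finset ℕ} (h : P.card = Q.card) :
    ∑ x ∈ lowerable P, frob (replace P x (x - 1)) Q +
      ∑ y ∈ lowerable Q, frob P (replace Q y (y - 1)) +
      (if 0 ∈ P ∧ 0 ∈ Q then frob (P.erase 0) (Q.erase 0) else 0) =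
      (∑ x ∈ P, x + ∑ y ∈ Q, y + P.card : ℕ) * frob P Q := by
  have hs : ∑ y ∈ lowerable Q, frob P (replace Q y (y - 1)) =
      ∑ y ∈ lowerable Q, frob (replace Q y (y - 1)) P := by
    refine Finset.sum_congr rfl fun y hy => frob_symm ?_
    rw [lowerable, Finset.mem_filter] at hy
    rw [card_replace hy.1 hy.2.2, h]
  rw [hs]
  obtain ⟨d, p, q, hp, hq, rfl, rfl⟩ := exists_strictMono_images_eq h
  have hc : (Finset.univ.image p).card = d := by
    rw [Finset.card_image_of_injective _ hp.injective, Finset.card_univ, Fintype.card_fin]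
  rw [sum_lowerable hp hq, sum_lowerable hq hp, ← sum_ite_mul_adjugate hp hq,
    frob_eq_frobDet hp hq, hc, Finset.sum_image fun i _ j _ h => hp.injective h,
    Finset.sum_image fun i _ j _ h => hq.injective h, ← frobDet_down p q]
  simp only [frobDet_symm p]

/-! ### The sum of the squares of the Frobenius determinants -/

/-- The Frobenius coordinates of the partitions of `n`. -/
def frobStates (n : ℕ) : Finset (Finset ℕ × Finset ℕ) :=
  ((Finset.range n).powerset ×ˢ (Finset.range n).powerset).filter fun s =>
    s.1.card = s.2.card ∧ ∑ x ∈ s.1, x + ∑ y ∈ s.2, y + s.1.card = n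

theorem mem_frobStates {n : ℕ} {s : Finset ℕ × Finset ℕ} : s ∈ frobStates n ↔
    s.1.card = s.2.card ∧ ∑ x ∈ s.1, x + ∑ y ∈ s.2, y + s.1.card = n := by
  rw [frobStates, Finset.mem_filter, and_iff_right_iff_imp, Finset.mem_product,
    Finset.mem_powerset, Finset.mem_powerset]
  rintro ⟨h1, h2⟩
  constructor
  · intro x hx
    have := Finset.single_le_sum (f := fun x => x) (fun _ _ => Nat.zero_le _) hx
    have := Finset.card_pos.mpr ⟨x, hx⟩
    simp only [Finset.mem_range] at *
    lia
  · intro x hx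
    have := Finset.single_le_sum (f := fun x => x) (fun _ _ => Nat.zero_le _) hx
    have := Finset.card_pos.mpr ⟨x, hx⟩
    simp only [Finset.mem_range] at *
    lia

theorem sum_frobStates_swap (n : ℕ) (f : Finset ℕ × Finset ℕ → ℝ) :
    ∑ s ∈ frobStates n, f s.swap = ∑ s ∈ frobStates n, f s := by
  refine Finset.sum_nbij' Prod.swap Prod.swap ?_ ?_ (fun _ _ => rfl) (fun _ _ => rfl)
    (fun _ _ => rfl)
  all_goals
    intro s hs
    rw [mem_frobStates] at *
    simp only [Prod.fst_swap, Prod.snd_swap]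
    exact ⟨hs.1.symm, by rw [← hs.1]; lia⟩

/-- Lowering an arm from size n + 1 and raising one from size n describe the same edges, and the
summand is symmetric in the endpoints. -/
theorem sum_frobStates_lowerable (n : ℕ) (f : Finset ℕ × Finset ℕ → ℝ) :
    ∑ s ∈ frobStates (n + 1), ∑ x ∈ lowerable s.1, f s * f (replace s.1 x (x - 1), s.2) =
      ∑ s ∈ frobStates n, ∑ x ∈ raisable s.1, f s * f (replace s.1 x (x + 1), s.2) := by
  rw [Finset.sum_sigma', Finset.sum_sigma']
  refine Finset.sum_nbij' (fun t => ⟨(replace t.1.1 t.2 (t.2 - 1), t.1.2), t.2 - 1⟩)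
    (fun t => ⟨(replace t.1.1 t.2 (t.2 + 1), t.1.2), t.2 + 1⟩) ?_ ?_ ?_ ?_ ?_
  · rintro ⟨⟨P, Q⟩, x⟩ h
    simp only [Finset.mem_sigma, mem_frobStates, lowerable, raisable, Finset.mem_filter] at h ⊢
    obtain ⟨⟨h1, h2⟩, hx, h0, hx'⟩ := h
    have hs := sum_replace hx hx'
    have hxx : x - 1 + 1 = x := by lia
    refine ⟨⟨by rw [card_replace hx hx', h1], by rw [card_replace hx hx']; lia⟩, ?_, ?_⟩
    · simp [replace]
    · rw [hxx]; simp [replace]; lia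
  · rintro ⟨⟨P, Q⟩, x⟩ h
    simp only [Finset.mem_sigma, mem_frobStates, lowerable, raisable, Finset.mem_filter] at h ⊢
    obtain ⟨⟨h1, h2⟩, hx, hx'⟩ := h
    have hs := sum_replace hx hx'
    refine ⟨⟨by rw [card_replace hx hx', h1], by rw [card_replace hx hx']; lia⟩, ?_, ?_⟩
    · simp [replace]
    · simp [replace]
  · rintro ⟨⟨P, Q⟩, x⟩ h
    simp only [Finset.mem_sigma, lowerable, Finset.mem_filter] at h
    obtain ⟨-, hx, h0, hx'⟩ := h
    have hxx : x - 1 + 1 = x := by lia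
    simp only [hxx, replace_replace hx hx']
  · rintro ⟨⟨P, Q⟩, x⟩ h
    simp only [Finset.mem_sigma, raisable, Finset.mem_filter] at h
    obtain ⟨-, hx, hx'⟩ := h
    simp only [Nat.add_sub_cancel, replace_replace hx hx']
  · rintro ⟨⟨P, Q⟩, x⟩ h
    simp only [Finset.mem_sigma, lowerable, Finset.mem_filter] at h
    obtain ⟨-, hx, h0, hx'⟩ := h
    have hxx : x - 1 + 1 = x := by lia
    simp only [hxx, replace_replace hx hx']
    ring

theorem sum_frobStates_erase_zero (n : ℕ) (f : Finset ℕ × Finset ℕ → ℝ) :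
    ∑ s ∈ frobStates (n + 1),
        (if 0 ∈ s.1 ∧ 0 ∈ s.2 then f s * f (s.1.erase 0, s.2.erase 0) else 0) =
      ∑ s ∈ frobStates n,
        (if 0 ∉ s.1 ∧ 0 ∉ s.2 then f s * f (insert 0 s.1, insert 0 s.2) else 0) := by
  rw [← Finset.sum_filter, ← Finset.sum_filter]
  refine Finset.sum_nbij' (fun s => (s.1.erase 0, s.2.erase 0))
    (fun s => (insert 0 s.1, insert 0 s.2)) ?_ ?_ ?_ ?_ ?_
  · rintro ⟨P, Q⟩ h
    simp only [Finset.mem_filter, mem_frobStates] at h ⊢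
    obtain ⟨⟨h1, h2⟩, hP, hQ⟩ := h
    have := Finset.card_erase_add_one hP
    have := Finset.card_erase_add_one hQ
    have := Finset.sum_erase_add P (fun x => x) hP
    have := Finset.sum_erase_add Q (fun x => x) hQ
    refine ⟨⟨by lia, by lia⟩, by simp, by simp⟩
  · rintro ⟨P, Q⟩ h
    simp only [Finset.mem_filter, mem_frobStates] at h ⊢
    obtain ⟨⟨h1, h2⟩, hP, hQ⟩ := h
    rw [Finset.card_insert_of_notMem hP, Finset.card_insert_of_notMem hQ,
      Finset.sum_insert hP, Finset.sum_insert hQ]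
    refine ⟨⟨by lia, by lia⟩, by simp, by simp⟩
  · rintro ⟨P, Q⟩ h
    simp only [Finset.mem_filter] at h
    simp [Finset.insert_erase h.2.1, Finset.insert_erase h.2.2]
  · rintro ⟨P, Q⟩ h
    simp only [Finset.mem_filter] at h
    simp [Finset.erase_insert h.2.1, Finset.erase_insert h.2.2]
  · rintro ⟨P, Q⟩ h
    simp only [Finset.mem_filter] at h
    simp only [Finset.insert_erase h.2.1, Finset.insert_erase h.2.2]
    ring

/-- By the removal and addition recursions both sides equal the sum of f(s) f(t) over all edges s, t
between sizes n and n + 1. -/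
theorem succ_mul_sum_frob_sq (n : ℕ) :
    ((n : ℝ) + 1) * ∑ s ∈ frobStates (n + 1), frob s.1 s.2 ^ 2 =
      ∑ s ∈ frobStates n, frob s.1 s.2 ^ 2 := by
  have hL : ((n : ℝ) + 1) * ∑ s ∈ frobStates (n + 1), frob s.1 s.2 ^ 2 =
      ∑ s ∈ frobStates (n + 1), (∑ x ∈ lowerable s.1, frob s.1 s.2 * frob (replace s.1 x (x - 1)) s.2 +
        ∑ y ∈ lowerable s.2, frob s.1 s.2 * frob s.1 (replace s.2 y (y - 1)) +
        if 0 ∈ s.1 ∧ 0 ∈ s.2 then frob s.1 s.2 * frob (s.1.erase 0) (s.2.erase 0) else 0) := by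
    rw [Finset.mul_sum]
    refine Finset.sum_congr rfl fun s hs => ?_
    rw [mem_frobStates] at hs
    have := frob_down hs.1
    rw [hs.2] at this
    rw [← Finset.mul_sum, ← Finset.mul_sum, ← mul_ite_zero, ← mul_add, ← mul_add, this]
    push_cast
    ring
  have hR : ∑ s ∈ frobStates n, frob s.1 s.2 ^ 2 =
      ∑ s ∈ frobStates n, (∑ x ∈ raisable s.1, frob s.1 s.2 * frob (replace s.1 x (x + 1)) s.2 +
        ∑ y ∈ raisable s.2, frob s.1 s.2 * frob s.1 (replace s.2 y (y + 1)) +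
        if 0 ∉ s.1 ∧ 0 ∉ s.2 then frob s.1 s.2 * frob (insert 0 s.1) (insert 0 s.2) else 0) := by
    refine Finset.sum_congr rfl fun s hs => ?_
    rw [mem_frobStates] at hs
    have := frob_up hs.1
    rw [← Finset.mul_sum, ← Finset.mul_sum, ← mul_ite_zero, ← mul_add, ← mul_add, this, sq]
  rw [hL, hR]
  simp only [Finset.sum_add_distrib]
  have e1 := sum_frobStates_lowerable n fun s => frob s.1 s.2
  have e2 := sum_frobStates_lowerable n fun s => frob s.2 s.1
  have e3 := sum_frobStates_erase_zero n fun s => frob s.1 s.2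
  rw [← sum_frobStates_swap, ← sum_frobStates_swap n] at e2
  simp only [Prod.fst_swap, Prod.snd_swap] at e1 e2 e3
  rw [e1, e2, e3]

theorem sum_frob_sq (n : ℕ) : ∑ s ∈ frobStates n, frob s.1 s.2 ^ 2 = (n.factorial : ℝ)⁻¹ := by
  induction n with
  | zero =>
    have : frobStates 0 = {(∅, ∅)} := by
      ext ⟨P, Q⟩
      rw [mem_frobStates, Finset.mem_singleton, Prod.mk.injEq]
      constructor
      · rintro ⟨h1, h2⟩
        have hP : P.card = 0 := by simp only at h2; lia
        exact ⟨Finset.card_eq_zero.mp hP, Finset.card_eq_zero.mp (h1 ▸ hP)⟩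
      · rintro ⟨rfl, rfl⟩; simp
    rw [this, Finset.sum_singleton, frob_empty]
    simp
  | succ n ih =>
    have h := succ_mul_sum_frob_sq n
    rw [ih] at h
    rw [Nat.factorial_succ]
    push_cast
    rw [mul_inv, ← h]
    have : (n : ℝ) + 1 ≠ 0 := by positivity
    field_simp

/-! ### Frobenius coordinates of Young diagrams -/

open Classical in
/-- The arm lengths of the diagonal cells. -/
def arms (μ : YoungDiagram) : Finset ℕ :=
  (Finset.range (μ.rowLen 0)).filter fun p => ∃ i, μ.rowLen i = i + p + 1

/-- The leg lengths of the diagonal cells. -/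
def legs (μ : YoungDiagram) : Finset ℕ := arms μ.transpose

theorem mem_arms {μ : YoungDiagram} {p : ℕ} : p ∈ arms μ ↔ ∃ i, μ.rowLen i = i + p + 1 := by
  classical
  rw [arms, Finset.mem_filter, Finset.mem_range, and_iff_right_iff_imp]
  rintro ⟨i, hi⟩
  have := μ.rowLen_anti 0 i (Nat.zero_le i)
  lia

theorem mem_legs {μ : YoungDiagram} {q : ℕ} : q ∈ legs μ ↔ ∃ j, μ.colLen j = j + q + 1 := by
  rw [legs, mem_arms]
  simp only [YoungDiagram.rowLen_transpose]

/-- Distinct diagonal cells have distinct arms, so both sides count diagonal cells. This count is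
symmetric under transposition. -/
theorem card_arms_eq (μ : YoungDiagram) :
    (arms μ).card = ((Finset.range (μ.rowLen 0)).filter fun i => (i, i) ∈ μ).card := by
  have h : arms μ = ((Finset.range (μ.rowLen 0)).filter fun i => (i, i) ∈ μ).image
      fun i => μ.rowLen i - i - 1 := by
    ext p
    simp only [mem_arms, Finset.mem_image, Finset.mem_filter, Finset.mem_range,
      YoungDiagram.mem_iff_lt_rowLen]
    constructor
    · rintro ⟨i, hi⟩
      have := μ.rowLen_anti 0 i (Nat.zero_le i)
      exact ⟨i, by lia, by lia⟩
    · rintro ⟨i, hi, rfl⟩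
      exact ⟨i, by lia⟩
  rw [h, Finset.card_image_of_injOn]
  intro i hi k hk hik
  simp only [Finset.coe_filter, Finset.mem_range, Set.mem_ofPred_eq,
    YoungDiagram.mem_iff_lt_rowLen] at hi hk hik
  by_contra hne
  rcases Nat.lt_or_gt_of_ne hne with h' | h'
  · have := μ.rowLen_anti i k h'.le
    lia
  · have := μ.rowLen_anti k i h'.le
    lia

theorem card_arms_eq_card_legs (μ : YoungDiagram) : (arms μ).card = (legs μ).card := by
  rw [legs, card_arms_eq, card_arms_eq]
  congr 1
  ext i
  simp only [Finset.mem_filter, Finset.mem_range, YoungDiagram.mem_transpose, Prod.swap_prod_mk,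
    YoungDiagram.rowLen_transpose, and_congr_left_iff]
  intro h
  have h1 := YoungDiagram.mem_iff_lt_rowLen.mp h
  have h2 := YoungDiagram.mem_iff_lt_colLen.mp h
  have := μ.rowLen_anti 0 i (Nat.zero_le i)
  have := μ.colLen_anti 0 i (Nat.zero_le i)
  lia

/-- Rows and columns give complementary sets of boundary steps: a negative position missed by the
rows is taken by a column. -/
theorem mem_legs_iff_notMem_descentSet {μ : YoungDiagram} {q : ℕ} :
    q ∈ legs μ ↔ (-q - 1 : ℤ) ∉ descentSet μ := by
  rw [mem_legs, descentSet, Set.mem_range]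
  constructor
  · rintro ⟨j, hj⟩ ⟨i, hi⟩
    have h1 := YoungDiagram.mem_iff_lt_rowLen (μ := μ) (i := i) (j := j)
    have h2 := YoungDiagram.mem_iff_lt_colLen (μ := μ) (i := i) (j := j)
    rw [h1] at h2
    lia
  · intro h
    have hex : ∃ i, μ.rowLen i + q ≤ i := ⟨μ.rowLen 0 + q, by
      have := μ.rowLen_anti 0 (μ.rowLen 0 + q) (Nat.zero_le _)
      lia⟩
    classical
    -- The first row at which the descents pass below -q-1. If that value is skipped, the column i -
    -- q - 1 has length exactly i.
    obtain ⟨i, hi, hmin⟩ : ∃ i, μ.rowLen i + q ≤ i ∧ ∀ k < i, ¬ μ.rowLen k + q ≤ k :=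
      ⟨Nat.find hex, Nat.find_spec hex, fun k hk => Nat.find_min hex hk⟩
    have hne : μ.rowLen i + q ≠ i := fun h' => h ⟨i, by lia⟩
    have h3 := hmin (i - 1) (by lia)
    refine ⟨i - q - 1, ?_⟩
    have h1 : ((i, i - q - 1) : ℕ × ℕ) ∉ μ := by rw [YoungDiagram.mem_iff_lt_rowLen]; lia
    have h2 : ((i - 1, i - q - 1) : ℕ × ℕ) ∈ μ := by rw [YoungDiagram.mem_iff_lt_rowLen]; lia
    rw [YoungDiagram.mem_iff_lt_colLen] at h1 h2
    lia

theorem mem_arms_iff_mem_descentSet {μ : YoungDiagram} {p : ℕ} :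
    p ∈ arms μ ↔ (p : ℤ) ∈ descentSet μ := by
  rw [mem_arms, descentSet, Set.mem_range]
  exact exists_congr fun i => by lia

/-- The set of modified Frobenius coordinates as a finite set. -/
def frobSet (μ : YoungDiagram) : Finset (ℕ ⊕ ℕ) := (arms μ).disjSum (legs μ)

/-- Above zero the symmetric difference selects descents, which are arms; below zero it selects
missing positions, which are legs. -/
theorem modifiedFrobenius_eq (μ : YoungDiagram) : modifiedFrobenius μ = coord '' frobSet μ := by
  have hinj : Function.Injective fun n : ℤ => (n : ℝ) + 1 / 2 := fun m n h => by
    simpa using h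
  have h2 : ((fun n : ℤ => (n : ℝ) - 1 / 2) '' Set.Iic 0) =
      (fun n : ℤ => (n : ℝ) + 1 / 2) '' Set.Iio 0 := by
    ext x
    constructor
    · rintro ⟨n, hn, rfl⟩
      exact ⟨n - 1, by simp at *; lia, by push_cast; ring⟩
    · rintro ⟨n, hn, rfl⟩
      exact ⟨n + 1, by simp at *; lia, by push_cast; ring⟩
  rw [modifiedFrobenius, h2, ← Set.image_symmDiff hinj]
  ext x
  constructor
  · rintro ⟨n, ⟨hn, hn'⟩ | ⟨hn, hn'⟩, rfl⟩
    · obtain ⟨k, rfl⟩ := Int.eq_ofNat_of_zero_le (not_lt.mp hn')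
      exact ⟨Sum.inl k, by simpa [frobSet, mem_arms_iff_mem_descentSet] using hn, by simp [coord]⟩
    · obtain ⟨k, hk⟩ := Int.eq_ofNat_of_zero_le (show 0 ≤ -n - 1 by simp at hn; lia)
      have e : n = -(k : ℤ) - 1 := by lia
      subst e
      exact ⟨Sum.inr k, by simpa [frobSet, mem_legs_iff_notMem_descentSet] using hn',
        by simp [coord]; ring⟩
  · rintro ⟨k | k, hk, rfl⟩
    · refine ⟨k, Or.inl ⟨?_, by simp⟩, by simp [coord]⟩
      simpa [frobSet, mem_arms_iff_mem_descentSet] using hk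
    · refine ⟨-(k : ℤ) - 1, Or.inr ⟨by simp; lia, ?_⟩, by simp [coord]; ring⟩
      simpa [frobSet, mem_legs_iff_notMem_descentSet] using hk

/-- Arms and legs determine the descent set, whose unique strictly monotone enumeration recovers the
row lengths. -/
theorem eq_of_arms_eq_of_legs_eq {μ ν : YoungDiagram} (h1 : arms μ = arms ν)
    (h2 : legs μ = legs ν) : μ = ν := by
  have hS : descentSet μ = descentSet ν := by
    ext n
    rcases le_or_gt 0 n with h | h
    · obtain ⟨k, rfl⟩ := Int.eq_ofNat_of_zero_le h
      have e1 := mem_arms_iff_mem_descentSet (μ := μ) (p := k)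
      rw [h1, mem_arms_iff_mem_descentSet] at e1
      exact e1.symm
    · obtain ⟨k, hk⟩ := Int.eq_ofNat_of_zero_le (show 0 ≤ -n - 1 by lia)
      have e : n = -(k : ℤ) - 1 := by lia
      subst e
      have e1 := mem_legs_iff_notMem_descentSet (μ := μ) (q := k)
      rw [h2, mem_legs_iff_notMem_descentSet] at e1
      exact (not_iff_not.mp e1).symm
  have hmono : ∀ μ : YoungDiagram, StrictMono fun i : ℕ => -((μ.rowLen i : ℤ) - ((i : ℤ) + 1)) :=
    fun μ i j hij => by
      have := μ.rowLen_anti i j hij.le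
      simp only
      lia
  have hneg : ∀ μ : YoungDiagram,
      Set.range (fun i : ℕ => -((μ.rowLen i : ℤ) - ((i : ℤ) + 1))) = Neg.neg '' descentSet μ :=
    fun μ => Set.range_comp (Neg.neg : ℤ → ℤ) fun i : ℕ => (μ.rowLen i : ℤ) - ((i : ℤ) + 1)
  have hf := ((hmono μ).range_inj (hmono ν)).mp (by rw [hneg, hneg, hS])
  ext ⟨i, j⟩
  rw [YoungDiagram.mem_cells, YoungDiagram.mem_cells, YoungDiagram.mem_iff_lt_rowLen,
    YoungDiagram.mem_iff_lt_rowLen]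
  have := congrFun hf i
  lia

/-! ### Adding a box -/

/-- The diagram with an added box. -/
def addBox (μ : YoungDiagram) (i j : ℕ) (hi : μ.colLen j = i) (hj : μ.rowLen i = j) :
    YoungDiagram where
  cells := insert (i, j) μ.cells
  isLowerSet := by
    rintro ⟨a, b⟩ ⟨a', b'⟩ hle hmem
    simp only [Finset.coe_insert, Set.mem_insert_iff, Finset.mem_coe, YoungDiagram.mem_cells] at *
    obtain ⟨h1, h2⟩ := Prod.mk_le_mk.mp hle
    rcases hmem with h | h
    · obtain ⟨rfl, rfl⟩ := Prod.mk.inj h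
      by_cases ha : a' = a
      · by_cases hb : b' = b
        · left; rw [ha, hb]
        · right; rw [YoungDiagram.mem_iff_lt_rowLen, ha]; lia
      · right
        refine μ.up_left_mem le_rfl h2 ?_
        rw [YoungDiagram.mem_iff_lt_colLen]; lia
    · right
      exact μ.up_left_mem h1 h2 h

section AddBox

variable {μ : YoungDiagram} {i j : ℕ} (hi : μ.colLen j = i) (hj : μ.rowLen i = j)

theorem mem_addBox {c : ℕ × ℕ} : c ∈ addBox μ i j hi hj ↔ c = (i, j) ∨ c ∈ μ := by
  rw [← YoungDiagram.mem_cells, addBox, Finset.mem_insert, YoungDiagram.mem_cells]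

theorem box_notMem {μ : YoungDiagram} {i j : ℕ} (hj : μ.rowLen i = j) : (i, j) ∉ μ.cells := by
  rw [YoungDiagram.mem_cells, YoungDiagram.mem_iff_lt_rowLen]; lia

theorem rowLen_addBox (k : ℕ) :
    (addBox μ i j hi hj).rowLen k = if k = i then j + 1 else μ.rowLen k := by
  refine eq_of_forall_lt_iff fun l => ?_
  rw [← YoungDiagram.mem_iff_lt_rowLen, mem_addBox, YoungDiagram.mem_iff_lt_rowLen, Prod.mk.injEq]
  split_ifs with h
  · subst h; lia
  · simp [h]

theorem colLen_addBox (l : ℕ) :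
    (addBox μ i j hi hj).colLen l = if l = j then i + 1 else μ.colLen l := by
  refine eq_of_forall_lt_iff fun k => ?_
  rw [← YoungDiagram.mem_iff_lt_colLen, mem_addBox, YoungDiagram.mem_iff_lt_colLen, Prod.mk.injEq]
  split_ifs with h
  · subst h; lia
  · simp [h]

end AddBox

/-- `ν` is obtained from `μ` by adding a box of content `c`. -/
def IsAddBox (μ ν : YoungDiagram) (c : ℤ) : Prop :=
  ∃ b : ℕ × ℕ, (b.2 : ℤ) - b.1 = c ∧ b ∉ μ.cells ∧ ν.cells = insert b μ.cells

theorem IsAddBox.transpose {μ ν : YoungDiagram} {c : ℤ} (h : IsAddBox μ ν c) :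
    IsAddBox μ.transpose ν.transpose (-c) := by
  obtain ⟨b, hb, hbμ, hν⟩ := h
  refine ⟨b.swap, by simp; lia, by simpa [YoungDiagram.mem_transpose] using hbμ, ?_⟩
  ext d
  have := Finset.ext_iff.mp hν d.swap
  simp only [YoungDiagram.mem_cells, YoungDiagram.mem_transpose, Finset.mem_insert] at this ⊢
  rw [this, Prod.swap_eq_iff_eq_swap]

theorem IsAddBox.card {μ ν : YoungDiagram} {c : ℤ} (h : IsAddBox μ ν c) : ν.card = μ.card + 1 := by
  obtain ⟨b, -, hbμ, hν⟩ := h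
  rw [YoungDiagram.card, hν, Finset.card_insert_of_notMem hbμ]

/-- The box goes at the end of the row with arm x. It lies strictly above the diagonal, so the legs
are unchanged. -/
theorem exists_isAddBox_of_raisable {μ : YoungDiagram} {x : ℕ} (hx : x ∈ raisable (arms μ)) :
    ∃ ν, IsAddBox μ ν (x + 1) ∧ arms ν = replace (arms μ) x (x + 1) ∧ legs ν = legs μ := by
  rw [raisable, Finset.mem_filter, mem_arms, mem_arms] at hx
  obtain ⟨⟨i, hi⟩, hx'⟩ := hx
  have hcol : μ.colLen (μ.rowLen i) = i := by
    have h1 : (i, μ.rowLen i) ∉ μ := by rw [YoungDiagram.mem_iff_lt_rowLen]; lia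
    -- If the row above were no longer, its arm would be x + 1, contrary to raisability.
    have h2 : i = 0 ∨ (i - 1, μ.rowLen i) ∈ μ := by
      by_contra! h
      obtain ⟨h0, h⟩ := h
      rw [YoungDiagram.mem_iff_lt_rowLen] at h
      have := μ.rowLen_anti (i - 1) i (by lia)
      exact hx' ⟨i - 1, by lia⟩
    rw [YoungDiagram.mem_iff_lt_colLen] at h1 h2
    lia
  refine ⟨addBox μ i _ hcol rfl, ⟨(i, μ.rowLen i), by simp; lia, box_notMem rfl, rfl⟩, ?_, ?_⟩
  · ext p
    rw [replace, Finset.mem_insert, Finset.mem_erase, mem_arms, mem_arms]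
    simp only [rowLen_addBox]
    constructor
    · rintro ⟨k, hk⟩
      split_ifs at hk with h
      · left; lia
      · right
        refine ⟨fun hp => ?_, k, hk⟩
        rcases Nat.lt_or_gt_of_ne h with h' | h'
        · have := μ.rowLen_anti k i h'.le
          lia
        · have := μ.rowLen_anti i k h'.le
          lia
    · rintro (rfl | ⟨hp, k, hk⟩)
      · exact ⟨i, by rw [if_pos rfl]; lia⟩
      · refine ⟨k, ?_⟩
        rw [if_neg, hk]
        rintro rfl
        lia
  · ext q
    rw [mem_legs, mem_legs]
    simp only [colLen_addBox]
    refine exists_congr fun l => ?_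
    split_ifs with h
    · subst h; lia
    · rfl

theorem exists_isAddBox_of_raisable_legs {μ : YoungDiagram} {y : ℕ} (hy : y ∈ raisable (legs μ)) :
    ∃ ν, IsAddBox μ ν (-(y + 1)) ∧ arms ν = arms μ ∧ legs ν = replace (legs μ) y (y + 1) := by
  obtain ⟨ν, h1, h2, h3⟩ := exists_isAddBox_of_raisable (μ := μ.transpose) hy
  refine ⟨ν.transpose, by simpa using h1.transpose, ?_, ?_⟩
  · simpa [legs] using h3
  · simpa [legs] using h2

/-- The first missing diagonal cell can be added: an obstruction above it would be an arm 0 and one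
to its left a leg 0. -/
theorem exists_isAddBox_zero {μ : YoungDiagram} (h1 : 0 ∉ arms μ) (h2 : 0 ∉ legs μ) :
    ∃ ν, IsAddBox μ ν 0 ∧ arms ν = insert 0 (arms μ) ∧ legs ν = insert 0 (legs μ) := by
  classical
  have hex : ∃ d, (d, d) ∉ μ := ⟨μ.rowLen 0, by
    rw [YoungDiagram.mem_iff_lt_rowLen]
    have := μ.rowLen_anti 0 (μ.rowLen 0) (Nat.zero_le _)
    lia⟩
  obtain ⟨d, hd, hmin⟩ : ∃ d, (d, d) ∉ μ ∧ ∀ k < d, (k, k) ∈ μ :=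
    ⟨Nat.find hex, Nat.find_spec hex, fun k hk => not_not.mp (Nat.find_min hex hk)⟩
  rw [mem_arms] at h1
  rw [mem_legs] at h2
  have hcol : μ.colLen d = d := by
    have e1 := hd
    rw [YoungDiagram.mem_iff_lt_colLen] at e1
    by_contra hne
    have e2 := hmin (d - 1) (by lia)
    have e3 : (d - 1, d) ∉ μ := by rw [YoungDiagram.mem_iff_lt_colLen]; lia
    rw [YoungDiagram.mem_iff_lt_rowLen] at e2 e3
    exact h1 ⟨d - 1, by lia⟩
  have hrow : μ.rowLen d = d := by
    have e1 := hd
    rw [YoungDiagram.mem_iff_lt_rowLen] at e1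
    by_contra hne
    have e2 := hmin (d - 1) (by lia)
    have e3 : (d, d - 1) ∉ μ := by rw [YoungDiagram.mem_iff_lt_rowLen]; lia
    rw [YoungDiagram.mem_iff_lt_colLen] at e2 e3
    exact h2 ⟨d - 1, by lia⟩
  refine ⟨addBox μ d d hcol hrow, ⟨(d, d), by simp, box_notMem hrow, rfl⟩, ?_, ?_⟩
  · ext p
    rw [Finset.mem_insert, mem_arms, mem_arms]
    simp only [rowLen_addBox]
    constructor
    · rintro ⟨k, hk⟩
      split_ifs at hk with h
      · left; lia
      · right; exact ⟨k, hk⟩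
    · rintro (rfl | ⟨k, hk⟩)
      · exact ⟨d, by simp⟩
      · refine ⟨k, ?_⟩
        rw [if_neg, hk]
        rintro rfl
        lia
  · ext p
    rw [Finset.mem_insert, mem_legs, mem_legs]
    simp only [colLen_addBox]
    constructor
    · rintro ⟨k, hk⟩
      split_ifs at hk with h
      · left; lia
      · right; exact ⟨k, hk⟩
    · rintro (rfl | ⟨k, hk⟩)
      · exact ⟨d, by simp⟩
      · refine ⟨k, ?_⟩
        rw [if_neg, hk]
        rintro rfl
        lia

theorem arms_bot : arms ⊥ = ∅ := by
  ext p
  simp only [mem_arms, Finset.notMem_empty, iff_false, not_exists]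
  intro i hi
  have : (i, 0) ∈ (⊥ : YoungDiagram) := by rw [YoungDiagram.mem_iff_lt_rowLen]; lia
  exact YoungDiagram.notMem_bot _ this

theorem legs_bot : legs ⊥ = ∅ := by
  ext p
  simp only [mem_legs, Finset.notMem_empty, iff_false, not_exists]
  intro i hi
  have : (0, i) ∈ (⊥ : YoungDiagram) := by rw [YoungDiagram.mem_iff_lt_colLen]; lia
  exact YoungDiagram.notMem_bot _ this

/-! ### Removal moves and the diagrams with prescribed coordinates -/

theorem mem_raisable_replace {P : Finset ℕ} {x : ℕ} (hx : x ∈ lowerable P) :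
    x - 1 ∈ raisable (replace P x (x - 1)) ∧ replace (replace P x (x - 1)) (x - 1) (x - 1 + 1) = P := by
  rw [lowerable, Finset.mem_filter] at hx
  have hxx : x - 1 + 1 = x := by lia
  rw [raisable, Finset.mem_filter, hxx, replace_replace hx.1 hx.2.2]
  refine ⟨⟨by simp [replace], ?_⟩, rfl⟩
  simp [replace]; lia

theorem frobStates_lower {n : ℕ} {P Q : Finset ℕ} {x : ℕ} (h : (P, Q) ∈ frobStates (n + 1))
    (hx : x ∈ lowerable P) : (replace P x (x - 1), Q) ∈ frobStates n := by
  rw [lowerable, Finset.mem_filter] at hx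
  rw [mem_frobStates] at *
  have := sum_replace hx.1 hx.2.2
  have := card_replace hx.1 hx.2.2
  simp only at h ⊢
  lia

theorem frobStates_swap {n : ℕ} {P Q : Finset ℕ} (h : (P, Q) ∈ frobStates n) :
    (Q, P) ∈ frobStates n := by
  rw [mem_frobStates] at *
  simp only at h ⊢
  lia

theorem frobStates_erase {n : ℕ} {P Q : Finset ℕ} (h : (P, Q) ∈ frobStates (n + 1))
    (hP : 0 ∈ P) (hQ : 0 ∈ Q) : (P.erase 0, Q.erase 0) ∈ frobStates n := by
  rw [mem_frobStates] at *
  have := Finset.card_erase_add_one hP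
  have := Finset.card_erase_add_one hQ
  have := Finset.sum_erase_add P (fun x => x) hP
  have := Finset.sum_erase_add Q (fun x => x) hQ
  simp only at h ⊢
  lia

theorem exists_lowerable {P : Finset ℕ} (h : P.Nonempty) (h0 : 0 ∉ P) : ∃ x, x ∈ lowerable P := by
  refine ⟨P.min' h, ?_⟩
  rw [lowerable, Finset.mem_filter]
  have hm := P.min'_mem h
  refine ⟨hm, fun h' => h0 (h' ▸ hm), fun h' => ?_⟩
  have h1 := P.min'_le _ h'
  have h2 : P.min' h ≠ 0 := fun h' => h0 (h' ▸ hm)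
  lia

/-- Lower the coordinates by one move, use induction, and add the box back. The size is recorded
along the way. -/
theorem exists_youngDiagram (n : ℕ) : ∀ P Q : Finset ℕ, (P, Q) ∈ frobStates n →
    ∃ μ : YoungDiagram, arms μ = P ∧ legs μ = Q ∧ μ.card = n := by
  induction n with
  | zero =>
    intro P Q h
    rw [mem_frobStates] at h
    obtain ⟨h1, h2⟩ := h
    have hP : P.card = 0 := by simp only at h2; lia
    have hQ : Q.card = 0 := by simp only at h1; lia
    rw [Finset.card_eq_zero] at hP hQ
    subst hP hQ
    exact ⟨⊥, arms_bot, legs_bot, rfl⟩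
  | succ n ih =>
    intro P Q h
    have hPQ := mem_frobStates.mp h
    simp only at hPQ
    have hcard : 0 < P.card := by
      by_contra h0
      have hP : P = ∅ := Finset.card_eq_zero.mp (by lia)
      have hQ : Q = ∅ := Finset.card_eq_zero.mp (by lia)
      subst hP hQ
      simp at hPQ
    by_cases hP : 0 ∈ P
    · by_cases hQ : 0 ∈ Q
      · obtain ⟨ν, h1, h2, h3⟩ := ih _ _ (frobStates_erase h hP hQ)
        obtain ⟨μ, hμ, e1, e2⟩ := exists_isAddBox_zero (μ := ν) (by simp [h1]) (by simp [h2])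
        exact ⟨μ, by rw [e1, h1, Finset.insert_erase hP], by rw [e2, h2, Finset.insert_erase hQ],
          by rw [hμ.card, h3]⟩
      · obtain ⟨y, hy⟩ := exists_lowerable (Finset.card_pos.mp (by lia : 0 < Q.card)) hQ
        obtain ⟨ν, h1, h2, h3⟩ := ih _ _ (frobStates_swap (frobStates_lower (frobStates_swap h) hy))
        obtain ⟨hr, he⟩ := mem_raisable_replace hy
        rw [← h2] at hr
        obtain ⟨μ, hμ, e1, e2⟩ := exists_isAddBox_of_raisable_legs hr
        exact ⟨μ, by rw [e1, h1], by rw [e2, h2, he], by rw [hμ.card, h3]⟩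
    · obtain ⟨x, hx⟩ := exists_lowerable (Finset.card_pos.mp hcard) hP
      obtain ⟨ν, h1, h2, h3⟩ := ih _ _ (frobStates_lower h hx)
      obtain ⟨hr, he⟩ := mem_raisable_replace hx
      rw [← h1] at hr
      obtain ⟨μ, hμ, e1, e2⟩ := exists_isAddBox_of_raisable hr
      exact ⟨μ, by rw [e1, h1, he], by rw [e2, h2], by rw [hμ.card, h3]⟩

/-- The formula |μ| = ∑p + ∑q + d needs no counting of cells: a diagram with these coordinates and
this size was constructed, and it must be μ. -/
theorem arms_legs_mem_frobStates (μ : YoungDiagram) : (arms μ, legs μ) ∈ frobStates μ.card := by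
  obtain ⟨ν, h1, h2, h3⟩ := exists_youngDiagram _ _ _ (mem_frobStates.mpr
    ⟨card_arms_eq_card_legs μ, rfl⟩)
  have := eq_of_arms_eq_of_legs_eq h1 h2
  subst this
  rw [h3]
  exact mem_frobStates.mpr ⟨card_arms_eq_card_legs _, rfl⟩

/-- The smaller diagram is built from the lowered coordinates. Raising it again gives μ by
uniqueness, so the two differ by one box. -/
theorem exists_isAddBox_of_lowerable {μ : YoungDiagram} {n x : ℕ} (hμ : μ.card = n + 1)
    (hx : x ∈ lowerable (arms μ)) :
    ∃ ν, IsAddBox ν μ x ∧ arms ν = replace (arms μ) x (x - 1) ∧ legs ν = legs μ := by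
  have hm := arms_legs_mem_frobStates μ
  rw [hμ] at hm
  obtain ⟨ν, h1, h2, h3⟩ := exists_youngDiagram _ _ _ (frobStates_lower hm hx)
  obtain ⟨hr, he⟩ := mem_raisable_replace hx
  rw [← h1] at hr
  obtain ⟨μ', hμ', e1, e2⟩ := exists_isAddBox_of_raisable hr
  have : μ' = μ := eq_of_arms_eq_of_legs_eq (by rw [e1, h1, he]) (by rw [e2, h2])
  subst this
  refine ⟨ν, ?_, h1, h2⟩
  have h0 : x ≠ 0 := by rw [lowerable, Finset.mem_filter] at hx; exact hx.2.1
  rwa [show (x : ℤ) = ((x - 1 : ℕ) : ℤ) + 1 by lia]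

theorem exists_isAddBox_of_lowerable_legs {μ : YoungDiagram} {n y : ℕ} (hμ : μ.card = n + 1)
    (hy : y ∈ lowerable (legs μ)) :
    ∃ ν, IsAddBox ν μ (-y) ∧ arms ν = arms μ ∧ legs ν = replace (legs μ) y (y - 1) := by
  have hc : μ.transpose.card = n + 1 := by
    rw [← hμ, YoungDiagram.card, YoungDiagram.card, YoungDiagram.transpose]
    simp
  obtain ⟨ν, h1, h2, h3⟩ := exists_isAddBox_of_lowerable hc hy
  refine ⟨ν.transpose, by simpa using h1.transpose, ?_, ?_⟩
  · simpa [legs] using h3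
  · simpa [legs] using h2

theorem exists_isAddBox_of_zero_mem {μ : YoungDiagram} {n : ℕ} (hμ : μ.card = n + 1)
    (h1 : 0 ∈ arms μ) (h2 : 0 ∈ legs μ) :
    ∃ ν, IsAddBox ν μ 0 ∧ arms ν = (arms μ).erase 0 ∧ legs ν = (legs μ).erase 0 := by
  have hm := arms_legs_mem_frobStates μ
  rw [hμ] at hm
  obtain ⟨ν, e1, e2, e3⟩ := exists_youngDiagram _ _ _ (frobStates_erase hm h1 h2)
  obtain ⟨μ', hμ', f1, f2⟩ := exists_isAddBox_zero (μ := ν) (by simp [e1]) (by simp [e2])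
  have : μ' = μ := eq_of_arms_eq_of_legs_eq (by rw [f1, e1, Finset.insert_erase h1])
    (by rw [f2, e2, Finset.insert_erase h2])
  subst this
  exact ⟨ν, hμ', e1, e2⟩

/-! ### Standard fillings -/

/-- Standard fillings of a diagram by `0, …, n - 1`, extended by zero. -/
structure IsStandard (μ : YoungDiagram) (T : ℕ × ℕ → ℕ) : Prop where
  zero_of_notMem : ∀ c ∉ μ.cells, T c = 0
  injOn : Set.InjOn T μ.cells
  lt_card : ∀ c ∈ μ.cells, T c < μ.card
  row_lt : ∀ i j j', j < j' → (i, j') ∈ μ.cells → T (i, j) < T (i, j')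
  col_lt : ∀ i i' j, i < i' → (i', j) ∈ μ.cells → T (i, j) < T (i', j)

theorem IsStandard.update {μ ν : YoungDiagram} {T : ℕ × ℕ → ℕ} (hT : IsStandard ν T) {b : ℕ × ℕ}
    (hb : b ∉ ν.cells) (hμ : μ.cells = insert b ν.cells) :
    IsStandard μ (Function.update T b ν.card) := by
  have hcard : μ.card = ν.card + 1 := by
    rw [YoungDiagram.card, hμ, Finset.card_insert_of_notMem hb]
  have hne : ∀ c ∈ ν.cells, c ≠ b := fun c hc h => hb (h ▸ hc)
  have hmem : ∀ c c', c ≤ c' → c' ∈ μ.cells → c ∈ μ.cells := fun c c' h hc' => μ.isLowerSet h hc'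
  have key : ∀ c c', c ≤ c' → c ≠ c' → c' ∈ μ.cells → (c' ∈ ν.cells → T c < T c') →
      Function.update T b ν.card c < Function.update T b ν.card c' := by
    intro c c' hle hne' hc' hlt
    have hc := hmem c c' hle hc'
    rw [hμ, Finset.mem_insert] at hc hc'
    rcases hc' with rfl | hc'
    · rw [Function.update_self, Function.update_of_ne hne']
      exact hT.lt_card _ (hc.resolve_left hne')
    · have : c ∈ ν.cells := ν.isLowerSet hle hc'
      rw [Function.update_of_ne (hne _ hc'), Function.update_of_ne (hne _ this)]
      exact hlt hc'
  refine ⟨fun c hc => ?_, ?_, fun c hc => ?_, fun i j j' h hc => ?_, fun i i' j h hc => ?_⟩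
  · rw [hμ, Finset.mem_insert, not_or] at hc
    rw [Function.update_of_ne hc.1, hT.zero_of_notMem _ hc.2]
  · intro c hc c' hc' h
    rw [Finset.mem_coe, hμ, Finset.mem_insert] at hc hc'
    rcases hc with rfl | hc <;> rcases hc' with rfl | hc'
    · rfl
    · rw [Function.update_self, Function.update_of_ne (hne _ hc')] at h
      exact absurd (hT.lt_card _ hc') (by lia)
    · rw [Function.update_self, Function.update_of_ne (hne _ hc)] at h
      exact absurd (hT.lt_card _ hc) (by lia)
    · rw [Function.update_of_ne (hne _ hc'), Function.update_of_ne (hne _ hc)] at h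
      exact hT.injOn hc hc' h
  · rw [hμ, Finset.mem_insert] at hc
    rcases hc with rfl | hc
    · rw [Function.update_self]; lia
    · rw [Function.update_of_ne (hne _ hc)]
      have := hT.lt_card _ hc
      lia
  · exact key _ _ (Prod.mk_le_mk.mpr ⟨le_rfl, h.le⟩) (by simp; lia) hc (hT.row_lt _ _ _ h)
  · exact key _ _ (Prod.mk_le_mk.mpr ⟨h.le, le_rfl⟩) (by simp; lia) hc (hT.col_lt _ _ _ h)

theorem isStandard_bot : IsStandard ⊥ 0 :=
  ⟨fun _ _ => rfl, by simp [YoungDiagram.cells_bot], by simp, by simp, by simp⟩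

/-- Each filling of a smaller diagram is extended by the top entry n in the new box. The position of
n recovers the box, and distinct contents mean distinct boxes, so the families are disjoint. -/
theorem exists_standard_of_moves {μ : YoungDiagram} {n : ℕ} {M : Type*} [DecidableEq M]
    (m : Finset M) (κ : M → ℤ) (hκ : Set.InjOn κ m) (ν : M → YoungDiagram)
    (hν : ∀ t ∈ m, IsAddBox (ν t) μ (κ t)) (hn : μ.card = n + 1)
    (s : M → Finset (ℕ × ℕ → ℕ)) (hs : ∀ t ∈ m, ∀ T ∈ s t, IsStandard (ν t) T) :
    ∃ S : Finset (ℕ × ℕ → ℕ), (∀ T ∈ S, IsStandard μ T) ∧ ∑ t ∈ m, (s t).card ≤ S.card := by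
  classical
  choose! b hb1 hb2 hb3 using hν
  have hcard : ∀ t ∈ m, (ν t).card = n := fun t ht => by
    have : μ.card = (ν t).card + 1 := by
      rw [YoungDiagram.card, hb3 t ht, Finset.card_insert_of_notMem (hb2 t ht)]
    lia
  have hbμ : ∀ t ∈ m, b t ∈ μ.cells := fun t ht => by
    rw [hb3 t ht]; exact Finset.mem_insert_self _ _
  have hstd : ∀ t ∈ m, ∀ T ∈ s t, IsStandard μ (Function.update T (b t) n) := fun t ht T hT => by
    rw [← hcard t ht]
    exact (hs t ht T hT).update (hb2 t ht) (hb3 t ht)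
  refine ⟨m.biUnion fun t => (s t).image fun T => Function.update T (b t) n, ?_, ?_⟩
  · intro T hT
    simp only [Finset.mem_biUnion, Finset.mem_image] at hT
    obtain ⟨t, ht, T', hT', rfl⟩ := hT
    exact hstd t ht T' hT'
  · rw [Finset.card_biUnion]
    · refine Finset.sum_le_sum fun t ht => le_of_eq ?_
      rw [Finset.card_image_of_injOn]
      intro T hT T' hT' h
      funext c
      by_cases hc : c = b t
      · rw [hc, (hs t ht T hT).zero_of_notMem _ (hb2 t ht),
          (hs t ht T' hT').zero_of_notMem _ (hb2 t ht)]
      · have := congrFun h c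
        simpa only [Function.update_of_ne hc] using this
    · intro t ht t' ht' hne
      refine Finset.disjoint_left.mpr fun T hT hT' => ?_
      simp only [Finset.mem_image] at hT hT'
      obtain ⟨T1, h1, rfl⟩ := hT
      obtain ⟨T2, h2, h⟩ := hT'
      refine hne (hκ ht ht' ?_)
      have e : b t = b t' := by
        refine (hstd t ht T1 h1).injOn (hbμ t ht) (hbμ t' ht') ?_
        rw [Function.update_self, ← h, Function.update_self]
      rw [← hb1 t ht, ← hb1 t' ht', e]

/-- Fillings obey, as a lower bound, the recursion that `frob_down` gives for n! f. Equality is not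
needed here. -/
theorem exists_standard (n : ℕ) : ∀ μ : YoungDiagram, μ.card = n →
    ∃ s : Finset (ℕ × ℕ → ℕ), (∀ T ∈ s, IsStandard μ T) ∧
      (n.factorial : ℝ) * frob (arms μ) (legs μ) ≤ s.card := by
  classical
  induction n with
  | zero =>
    intro μ hμ
    have : μ = ⊥ := by
      ext c
      rw [YoungDiagram.card, Finset.card_eq_zero] at hμ
      rw [hμ, YoungDiagram.cells_bot]
    subst this
    refine ⟨{0}, by simpa using isStandard_bot, ?_⟩
    rw [arms_bot, legs_bot, frob_empty]
    simp
  | succ n ih =>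
    intro μ hμ
    let m : Finset (ℕ ⊕ ℕ ⊕ Unit) := (lowerable (arms μ)).disjSum ((lowerable (legs μ)).disjSum
      (if 0 ∈ arms μ ∧ 0 ∈ legs μ then {()} else ∅))
    let κ : ℕ ⊕ ℕ ⊕ Unit → ℤ := Sum.elim (fun x => x) (Sum.elim (fun y => -y) fun _ => 0)
    let P : ℕ ⊕ ℕ ⊕ Unit → Finset ℕ := Sum.elim (fun x => replace (arms μ) x (x - 1))
      (Sum.elim (fun y => arms μ) fun _ => (arms μ).erase 0)
    let Q : ℕ ⊕ ℕ ⊕ Unit → Finset ℕ := Sum.elim (fun x => legs μ)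
      (Sum.elim (fun y => replace (legs μ) y (y - 1)) fun _ => (legs μ).erase 0)
    have hex : ∀ t ∈ m, ∃ ν, IsAddBox ν μ (κ t) ∧ arms ν = P t ∧ legs ν = Q t := by
      rintro (x | y | u) ht
      · exact exists_isAddBox_of_lowerable hμ (by simpa [m] using ht)
      · exact exists_isAddBox_of_lowerable_legs hμ (by simpa [m] using ht)
      · have h0 : 0 ∈ arms μ ∧ 0 ∈ legs μ := by
          by_contra h
          simp [m, h] at ht
        exact exists_isAddBox_of_zero_mem hμ h0.1 h0.2
    choose! ν hν hP hQ using hex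
    have hcard : ∀ t ∈ m, (ν t).card = n := fun t ht => by
      have := (hν t ht).card
      lia
    have hex2 : ∀ t ∈ m, ∃ s : Finset (ℕ × ℕ → ℕ), (∀ T ∈ s, IsStandard (ν t) T) ∧
      (n.factorial : ℝ) * frob (P t) (Q t) ≤ s.card := fun t ht => by
        rw [← hP t ht, ← hQ t ht]
        exact ih _ (hcard t ht)
    choose! s hs hle using hex2
    -- The contents are positive for arms, negative for legs and zero on the diagonal; lowerable
    -- coordinates are nonzero.
    have hκ : Set.InjOn κ m := by
      rintro (x | y | u) ht (x' | y' | u') ht' h <;>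
      simp [m, κ, lowerable] at h ht ht' ⊢ <;> lia
    obtain ⟨S, hS, hSc⟩ := exists_standard_of_moves m κ hκ ν hν hμ s hs
    refine ⟨S, hS, ?_⟩
    have hdown := frob_down (card_arms_eq_card_legs μ)
    have hsum : ∑ t ∈ m, frob (P t) (Q t) = ((n + 1 : ℕ) : ℝ) * frob (arms μ) (legs μ) := by
      have h3 := (mem_frobStates.mp (arms_legs_mem_frobStates μ)).2
      simp only at h3
      rw [← hμ, ← h3, ← hdown]
      simp only [m, Finset.sum_disjSum, P, Q, Sum.elim_inl, Sum.elim_inr]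
      rw [add_assoc]
      congr 2
      split_ifs <;> simp
    calc ((n + 1).factorial : ℝ) * frob (arms μ) (legs μ)
        = n.factorial * ∑ t ∈ m, frob (P t) (Q t) := by
          rw [hsum, Nat.factorial_succ]; push_cast; ring
      _ = ∑ t ∈ m, n.factorial * frob (P t) (Q t) := Finset.mul_sum _ _ _
      _ ≤ ∑ t ∈ m, ((s t).card : ℝ) := Finset.sum_le_sum hle
      _ ≤ S.card := by exact_mod_cast hSc

/-! ### Quasi-idempotents in an algebra with a nondegenerate trace -/

section MatrixUnits

variable {k A : Type*} [Field k] [Ring A] [Algebra k A] [FiniteDimensional k A]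

theorem exists_dual_family {d : ℕ} {f : Fin d → A →ₗ[k] k} (hf : LinearIndependent k f) :
    ∃ a : Fin d → A, ∀ i j, f j (a i) = if i = j then 1 else 0 := by
  let B : (Fin d → k) →ₗ[k] A →ₗ[k] k := Fintype.linearCombination k f
  have hB : Function.Injective B := hf.fintypeLinearCombination_injective
  have hs : Function.Surjective B.flip := LinearMap.flip_injective_iff₁.mp hB
  choose a ha using fun i => hs (LinearMap.proj i)
  refine ⟨a, fun i j => ?_⟩
  have := LinearMap.congr_fun (ha i) (Pi.single j 1)
  rw [LinearMap.flip_apply] at this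
  simp only [B, Fintype.linearCombination_apply_single, one_smul, LinearMap.proj_apply] at this
  rw [this, Pi.single_apply]

/-- Define λ by e a e = λ(a) e. The pairing (a, xe) ↦ λ(ax) separates the elements of Ae, so a basis
of Ae has dual elements in A. -/
theorem exists_dual_basis {τ : A →ₗ[k] k} (hτ : ∀ x y, τ (x * y) = τ (y * x))
    (hnd : ∀ x, (∀ y, τ (x * y) = 0) → x = 0) {e : A}
    (h1 : ∀ a, ∃ s : k, e * a * e = s • e) (h2 : ∃ y, e * y * e ≠ 0) :
    ∃ v a : Fin (Module.finrank k (LinearMap.range (LinearMap.mulRight k e))) → A,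
      (∀ i, ∃ x, v i = x * e) ∧ ∀ i j, e * a i * v j = if i = j then e else 0 := by
  have he : e ≠ 0 := by
    rintro rfl
    simp at h2
  choose lam hlam using h1
  have hinj : ∀ s t : k, s • e = t • e → s = t := fun s t h => smul_left_injective k he h
  let L : A →ₗ[k] k :=
    { toFun := lam
      map_add' := fun x y => hinj _ _ (by rw [← hlam, add_smul, ← hlam, ← hlam]; noncomm_ring)
      map_smul' := fun c x => hinj _ _ (by
        rw [← hlam, RingHom.id_apply, smul_eq_mul, mul_smul, ← hlam]
        simp) }
  obtain ⟨y, hy⟩ := h2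
  -- Cyclicity gives λ(y) τ(xeb) = τ(y · e(bx)e) = λ(bx) τ(ye) = 0. As λ(y) ≠ 0, nondegeneracy
  -- yields xe = 0.
  have hsep : ∀ x, (∀ a, lam (a * x) = 0) → x * e = 0 := by
    intro x hx
    refine hnd _ fun b => ?_
    have hly : lam y ≠ 0 := fun h => hy (by rw [hlam, h, zero_smul])
    have h3 : lam y * τ (x * e * b) = 0 := by
      have e1 : lam y • (x * e * b) = x * e * (y * e * b) := by
        rw [← smul_mul_assoc, ← mul_smul_comm, ← hlam]
        noncomm_ring
      rw [← smul_eq_mul, ← map_smul, e1, hτ]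
      have e2 : y * e * b * (x * e) = y * (e * (b * x) * e) := by noncomm_ring
      rw [e2, hlam, hx, zero_smul, mul_zero, map_zero]
    exact (mul_eq_zero.mp h3).resolve_left hly
  let w := Module.finBasis k (LinearMap.range (LinearMap.mulRight k e))
  choose x hx using fun i => (w i).2
  have hw : LinearIndependent k fun i => (w i : A) :=
    w.linearIndependent.map' _ (Submodule.ker_subtype _)
  have hf : LinearIndependent k fun i => L ∘ₗ LinearMap.mulRight k (x i) := by
    rw [Fintype.linearIndependent_iff] at hw ⊢
    intro c hc
    refine hw c ?_
    have : (∑ i, c i • x i) * e = 0 := hsep _ fun a => by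
      have h4 := LinearMap.congr_fun hc a
      change L (a * ∑ i, c i • x i) = 0
      rw [Finset.mul_sum, map_sum]
      simpa using h4
    rw [Finset.sum_mul] at this
    rw [← this]
    refine Finset.sum_congr rfl fun i _ => ?_
    rw [smul_mul_assoc, ← hx i]
    rfl
  obtain ⟨a, ha⟩ := exists_dual_family hf
  refine ⟨fun i => w i, a, fun i => ⟨x i, (hx i).symm⟩, fun i j => ?_⟩
  have h5 : lam (a i * x j) = if i = j then 1 else 0 := ha i j
  have h6 : (w j : A) = x j * e := (hx j).symm
  change e * a i * (w j : A) = _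
  rw [h6, show e * a i * (x j * e) = e * (a i * x j) * e by noncomm_ring, hlam, h5]
  split_ifs <;> simp

/-- The products v a behave like matrix units and are independent across all e i. One-sided
orthogonality of each pair is enough, as two off-diagonal factors appear and either one kills the
product. -/
theorem sum_sq_finrank_le {ι : Type*} [Fintype ι] {τ : A →ₗ[k] k}
    (hτ : ∀ x y, τ (x * y) = τ (y * x)) (hnd : ∀ x, (∀ y, τ (x * y) = 0) → x = 0) {e : ι → A}
    (h1 : ∀ i a, ∃ s : k, e i * a * e i = s • e i) (h2 : ∀ i, ∃ y, e i * y * e i ≠ 0)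
    (h3 : ∀ i j, i ≠ j → (∀ a, e i * a * e j = 0) ∨ ∀ a, e j * a * e i = 0) :
    ∑ i, Module.finrank k (LinearMap.range (LinearMap.mulRight k (e i))) ^ 2 ≤
      Module.finrank k A := by
  classical
  choose v a hv hva using fun i => exists_dual_basis hτ hnd (h1 i) (h2 i)
  choose x hx using hv
  let d := fun i => Module.finrank k (LinearMap.range (LinearMap.mulRight k (e i)))
  have he : ∀ i, e i ≠ 0 := fun i h => by
    have := h2 i
    rw [h] at this
    simp at this
  have hind : LinearIndependent k fun p : (Σ i, Fin (d i) × Fin (d i)) =>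
      v p.1 p.2.1 * a p.1 p.2.2 := by
    rw [Fintype.linearIndependent_iff]
    rintro c hc ⟨i, p, q⟩
    -- Sandwiching a relation in this way isolates the coefficient with index (i, p, q).
    have hz : ∀ r : (Σ i, Fin (d i) × Fin (d i)),
        e i * a i p * (v r.1 r.2.1 * a r.1 r.2.2) * v i q =
          if r = ⟨i, p, q⟩ then e i else 0 := by
      rintro ⟨j, p', q'⟩
      by_cases hij : i = j
      · subst hij
        rw [show e i * a i p * (v i p' * a i q') * v i q = e i * a i p * v i p' * a i q' * v i q by
          noncomm_ring, hva]
        by_cases hp : p = p'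
        · subst hp
          rw [if_pos rfl, hva]
          by_cases hq : q' = q
          · subst hq; simp
          · rw [if_neg hq, if_neg]
            simpa using hq
        · rw [if_neg hp, zero_mul, zero_mul, if_neg]
          simp only [Sigma.mk.injEq, heq_eq_eq, true_and, Prod.mk.injEq, not_and]
          intro h
          exact absurd h.symm hp
      · rw [if_neg fun h => hij (congrArg Sigma.fst h).symm]
        dsimp only
        rw [hx j p', hx i q]
        rcases h3 i j hij with h | h
        · rw [show e i * a i p * (x j p' * e j * a j q') * (x i q * e i) =
            e i * (a i p * x j p') * e j * (a j q' * (x i q * e i)) by noncomm_ring, h, zero_mul]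
        · rw [show e i * a i p * (x j p' * e j * a j q') * (x i q * e i) =
            e i * a i p * x j p' * (e j * (a j q' * x i q) * e i) by noncomm_ring, h, mul_zero]
    have h4 : ∑ r, c r • (e i * a i p * (v r.1 r.2.1 * a r.1 r.2.2) * v i q) = 0 := by
      have : ∑ r, c r • (e i * a i p * (v r.1 r.2.1 * a r.1 r.2.2) * v i q) =
          e i * a i p * (∑ r, c r • (v r.1 r.2.1 * a r.1 r.2.2)) * v i q := by
        rw [Finset.mul_sum, Finset.sum_mul]
        simp
      rw [this, hc, mul_zero, zero_mul]
    simp only [hz, smul_ite, smul_zero, Finset.sum_ite_eq', Finset.mem_univ, if_true] at h4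
    exact (smul_eq_zero.mp h4).resolve_right (he i)
  have := hind.fintype_card_le_finrank
  simpa [Fintype.card_sigma, d, sq] using this

end MatrixUnits

/-! ### Young symmetrizers of tableaux on an arbitrary finite set -/

section Tableau

variable {Ω : Type*}

/-- The row and column indices `r` and `c` identify `Ω` with the cells of `μ`. -/
structure IsTableau (μ : YoungDiagram) (r c : Ω → ℕ) : Prop where
  mem : ∀ x, (r x, c x) ∈ μ
  inj : ∀ x y, r x = r y → c x = c y → x = y
  surj : ∀ p ∈ μ, ∃ x, r x = p.1 ∧ c x = p.2

variable [Fintype Ω]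

/-- At most min(k, colLen j) elements of column j can have pairwise distinct f-values below k, and r
attains this. -/
theorem IsTableau.card_filter_col_le {μ : YoungDiagram} {r c : Ω → ℕ} (h : IsTableau μ r c)
    {f : Ω → ℕ} (hf : ∀ x y, f x = f y → c x = c y → x = y) (k j : ℕ) :
    (Finset.univ.filter fun x => f x < k ∧ c x = j).card ≤
      (Finset.univ.filter fun x => r x < k ∧ c x = j).card := by
  rcases le_or_gt (μ.colLen j) k with hk | hk
  · refine Finset.card_le_card fun x hx => ?_
    rw [Finset.mem_filter] at hx ⊢
    refine ⟨hx.1, ?_, hx.2.2⟩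
    have := YoungDiagram.mem_iff_lt_colLen.mp (h.mem x)
    rw [hx.2.2] at this
    lia
  · calc (Finset.univ.filter fun x => f x < k ∧ c x = j).card
        ≤ (Finset.range k).card := Finset.card_le_card_of_injOn f
          (fun x hx => by
            rw [Finset.mem_coe, Finset.mem_filter] at hx
            exact Finset.mem_coe.mpr (Finset.mem_range.mpr hx.2.1))
          (fun x hx y hy hxy => by
            rw [Finset.mem_coe, Finset.mem_filter] at hx hy
            exact hf x y hxy (hx.2.2.trans hy.2.2.symm))
      _ ≤ ((Finset.univ.filter fun x => r x < k ∧ c x = j).image r).card := by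
          refine Finset.card_le_card fun i hi => ?_
          rw [Finset.mem_range] at hi
          obtain ⟨x, hx⟩ := h.surj (i, j) (YoungDiagram.mem_iff_lt_colLen.mpr (by lia))
          simp only at hx
          exact Finset.mem_image.mpr ⟨x, by simp [hx, hi], hx.1⟩
      _ ≤ _ := Finset.card_image_le

theorem card_filter_lt_eq_sum (f c : Ω → ℕ) (k : ℕ) :
    (Finset.univ.filter fun x => f x < k).card =
      ∑ j ∈ Finset.univ.image c, (Finset.univ.filter fun x => f x < k ∧ c x = j).card := by
  rw [Finset.card_eq_sum_card_fiberwise (f := c) (t := Finset.univ.image c) (fun x _ => by simp)]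
  refine Finset.sum_congr rfl fun j _ => ?_
  rw [Finset.filter_filter]

theorem IsTableau.card_filter_le {μ : YoungDiagram} {r c : Ω → ℕ} (h : IsTableau μ r c)
    {f : Ω → ℕ} (hf : ∀ x y, f x = f y → c x = c y → x = y) (k : ℕ) :
    (Finset.univ.filter fun x => f x < k).card ≤ (Finset.univ.filter fun x => r x < k).card := by
  rw [card_filter_lt_eq_sum f c, card_filter_lt_eq_sum r c]
  exact Finset.sum_le_sum fun j _ => h.card_filter_col_le hf k j

/-- The equality case of dominance: an element sent below its column would make the count for k =
colLen (c x) strictly smaller. -/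
theorem IsTableau.mem_of_card_filter_eq {μ : YoungDiagram} {r c : Ω → ℕ} (h : IsTableau μ r c)
    {f : Ω → ℕ} (hf : ∀ x y, f x = f y → c x = c y → x = y)
    (heq : ∀ k, (Finset.univ.filter fun x => f x < k).card =
      (Finset.univ.filter fun x => r x < k).card) (x : Ω) : (f x, c x) ∈ μ := by
  by_contra hx
  rw [YoungDiagram.mem_iff_lt_colLen, not_lt] at hx
  refine absurd (heq (μ.colLen (c x))) (ne_of_lt ?_)
  rw [card_filter_lt_eq_sum f c, card_filter_lt_eq_sum r c]
  refine Finset.sum_lt_sum (fun j _ => h.card_filter_col_le hf _ j)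
    ⟨c x, by simp, Finset.card_lt_card ⟨fun y hy => ?_, fun hss => ?_⟩⟩
  · rw [Finset.mem_filter] at hy ⊢
    refine ⟨hy.1, ?_, hy.2.2⟩
    rw [← hy.2.2]
    exact YoungDiagram.mem_iff_lt_colLen.mp (h.mem y)
  · have hm : x ∈ Finset.univ.filter fun y => r y < μ.colLen (c x) ∧ c y = c x := by
      simpa using YoungDiagram.mem_iff_lt_colLen.mp (h.mem x)
    have := hss hm
    rw [Finset.mem_filter] at this
    lia

theorem IsTableau.card_filter_row {μ : YoungDiagram} {r c : Ω → ℕ} (h : IsTableau μ r c) (i : ℕ) :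
    (Finset.univ.filter fun x => r x = i).card = μ.rowLen i := by
  rw [← Finset.card_range (μ.rowLen i)]
  refine Finset.card_bij (fun x _ => c x) (fun x hx => ?_) (fun x hx y hy hxy => ?_) fun j hj => ?_
  · rw [Finset.mem_filter] at hx
    rw [Finset.mem_range, ← YoungDiagram.mem_iff_lt_rowLen, ← hx.2]
    exact h.mem x
  · rw [Finset.mem_filter] at hx hy
    exact h.inj x y (hx.2.trans hy.2.symm) hxy
  · rw [Finset.mem_range, ← YoungDiagram.mem_iff_lt_rowLen] at hj
    obtain ⟨x, hx⟩ := h.surj _ hj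
    exact ⟨x, by simpa using hx.1, hx.2⟩

theorem IsTableau.eq_of_card_filter_eq {μ ν : YoungDiagram} {r c r' c' : Ω → ℕ}
    (h : IsTableau μ r c) (h' : IsTableau ν r' c')
    (heq : ∀ k, (Finset.univ.filter fun x => r x < k).card =
      (Finset.univ.filter fun x => r' x < k).card) : μ = ν := by
  have key : ∀ (f : Ω → ℕ) (i : ℕ), (Finset.univ.filter fun x => f x = i).card =
      (Finset.univ.filter fun x => f x < i + 1).card -
        (Finset.univ.filter fun x => f x < i).card := by
    intro f i
    have : (Finset.univ.filter fun x => f x < i + 1) =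
        (Finset.univ.filter fun x => f x < i).disjUnion (Finset.univ.filter fun x => f x = i)
          (Finset.disjoint_left.mpr fun x hx hx' => by
            rw [Finset.mem_filter] at hx hx'
            lia) := by
      ext x
      simp only [Finset.mem_filter, Finset.mem_univ, true_and, Finset.mem_disjUnion]
      lia
    rw [this, Finset.card_disjUnion]
    lia
  ext ⟨i, j⟩
  rw [YoungDiagram.mem_cells, YoungDiagram.mem_cells, YoungDiagram.mem_iff_lt_rowLen,
    YoungDiagram.mem_iff_lt_rowLen, ← h.card_filter_row, ← h'.card_filter_row, key, key r', heq,
    heq]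

theorem card_filter_comp_perm (f : Ω → ℕ) (g : Equiv.Perm Ω) (k : ℕ) :
    (Finset.univ.filter fun x => f (g x) < k).card = (Finset.univ.filter fun x => f x < k).card :=
  Finset.card_bij' (fun x _ => g x) (fun x _ => g⁻¹ x) (by simp) (by simp) (by simp) (by simp)

variable [DecidableEq Ω]

/-- The sum of all permutations that preserve `r`. -/
def rowSum (r : Ω → ℕ) : MonoidAlgebra ℂ (Equiv.Perm Ω) :=
  ∑ σ ∈ Finset.univ.filter (fun σ : Equiv.Perm Ω => ∀ x, r (σ x) = r x), MonoidAlgebra.single σ 1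

/-- The signed sum of all permutations that preserve `c`. -/
def columnSum (c : Ω → ℕ) : MonoidAlgebra ℂ (Equiv.Perm Ω) :=
  ∑ σ ∈ Finset.univ.filter (fun σ : Equiv.Perm Ω => ∀ x, c (σ x) = c x),
    MonoidAlgebra.single σ ((Equiv.Perm.sign σ : ℤ) : ℂ)

theorem rowSum_mul_single {r : Ω → ℕ} {ρ : Equiv.Perm Ω} (hρ : ∀ x, r (ρ x) = r x) :
    rowSum r * MonoidAlgebra.single ρ 1 = rowSum r := by
  rw [rowSum, Finset.sum_mul]
  refine Finset.sum_bij' (fun σ _ => σ * ρ) (fun σ _ => σ * ρ⁻¹) (fun σ hσ => ?_) (fun σ hσ => ?_)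
    (fun σ _ => by simp) (fun σ _ => by simp) fun σ _ => ?_
  · rw [Finset.mem_filter] at hσ ⊢
    exact ⟨Finset.mem_univ _, fun x => by rw [Equiv.Perm.mul_apply, hσ.2, hρ]⟩
  · rw [Finset.mem_filter] at hσ ⊢
    refine ⟨Finset.mem_univ _, fun x => ?_⟩
    rw [Equiv.Perm.mul_apply, hσ.2, ← hρ, show ρ (ρ⁻¹ x) = x from ρ.apply_symm_apply x]
  · rw [MonoidAlgebra.single_mul_single, one_mul]

theorem single_mul_columnSum {c : Ω → ℕ} {κ : Equiv.Perm Ω} (hκ : ∀ x, c (κ x) = c x) :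
    MonoidAlgebra.single κ 1 * columnSum c =
      ((Equiv.Perm.sign κ : ℤ) : ℂ) • columnSum c := by
  rw [columnSum, Finset.mul_sum, Finset.smul_sum]
  refine Finset.sum_bij' (fun σ _ => κ * σ) (fun σ _ => κ⁻¹ * σ) (fun σ hσ => ?_) (fun σ hσ => ?_)
    (fun σ _ => by simp) (fun σ _ => by simp) fun σ _ => ?_
  · rw [Finset.mem_filter] at hσ ⊢
    exact ⟨Finset.mem_univ _, fun x => by rw [Equiv.Perm.mul_apply, hκ, hσ.2]⟩
  · rw [Finset.mem_filter] at hσ ⊢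
    refine ⟨Finset.mem_univ _, fun x => ?_⟩
    rw [Equiv.Perm.mul_apply, ← hκ, show κ (κ⁻¹ (σ x)) = σ x from κ.apply_symm_apply _, hσ.2]
  · rw [MonoidAlgebra.single_mul_single, MonoidAlgebra.smul_single, one_mul]
    congr 1
    rw [smul_eq_mul, Equiv.Perm.sign_mul]
    push_cast
    rw [← mul_assoc, ← Int.cast_mul, Int.units_coe_mul_self]
    simp

/-- The transposition of x and y is absorbed with sign -1 by the columns, and its conjugate by g
with sign +1 by the rows. -/
theorem rowSum_mul_single_mul_columnSum_eq_zero {r c : Ω → ℕ} {g : Equiv.Perm Ω} {x y : Ω}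
    (hxy : x ≠ y) (hr : r (g x) = r (g y)) (hc : c x = c y) :
    rowSum r * MonoidAlgebra.single g 1 * columnSum c = 0 := by
  have hsw : ∀ (f : Ω → ℕ) (u v : Ω), f u = f v → ∀ z, f (Equiv.swap u v z) = f z := by
    intro f u v huv z
    rw [Equiv.swap_apply_def]
    split_ifs with h1 h2
    · rw [h1, huv]
    · rw [h2, huv]
    · rfl
  have h1 := rowSum_mul_single (hsw r _ _ hr)
  have h2 := single_mul_columnSum (hsw c _ _ hc)
  have h3 : Equiv.swap (g x) (g y) * g = g * Equiv.swap x y := by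
    rw [Equiv.swap_apply_apply]
    group
  have h4 : rowSum r * MonoidAlgebra.single g 1 * columnSum c =
      -(rowSum r * MonoidAlgebra.single g 1 * columnSum c) := by
    conv_lhs => rw [← h1, mul_assoc (rowSum r), MonoidAlgebra.single_mul_single, one_mul, h3,
      ← one_mul (1 : ℂ), ← MonoidAlgebra.single_mul_single, ← mul_assoc, mul_assoc, h2,
      Equiv.Perm.sign_swap hxy]
    simp
  have h5 : (2 : ℂ) • (rowSum r * MonoidAlgebra.single g 1 * columnSum c) = 0 := by
    rw [two_smul]
    nth_rewrite 1 [h4]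
    exact neg_add_cancel _
  exact (smul_eq_zero.mp h5).resolve_left two_ne_zero

theorem injective_of_rowSum_mul_ne_zero {r c : Ω → ℕ} {g : Equiv.Perm Ω}
    (h : rowSum r * MonoidAlgebra.single g 1 * columnSum c ≠ 0) :
    ∀ x y, r (g x) = r (g y) → c x = c y → x = y := by
  intro x y hr hc
  by_contra hne
  exact h (rowSum_mul_single_mul_columnSum_eq_zero hne hr hc)

theorem single_eq_smul_single_one {G : Type*} (g : G) (s : ℂ) :
    MonoidAlgebra.single g s = s • MonoidAlgebra.single g (1 : ℂ) := by
  rw [MonoidAlgebra.smul_single, smul_eq_mul, mul_one]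

theorem eq_zero_of_forall_single {r c : Ω → ℕ}
    (h : ∀ g, rowSum r * MonoidAlgebra.single g 1 * columnSum c = 0)
    (a : MonoidAlgebra ℂ (Equiv.Perm Ω)) : rowSum r * a * columnSum c = 0 := by
  induction a using MonoidAlgebra.induction_linear with
  | zero => simp
  | add f g hf hg => rw [mul_add, add_mul, hf, hg, add_zero]
  | single g s =>
    rw [single_eq_smul_single_one, mul_smul_comm, smul_mul_assoc,
      h, smul_zero]

/-- If both products were nonzero for suitable group elements, each shape would dominate the other,
and the row counts would agree. -/
theorem IsTableau.orthogonal {μ ν : YoungDiagram} {r c r' c' : Ω → ℕ} (h : IsTableau μ r c)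
    (h' : IsTableau ν r' c') (hne : μ ≠ ν) :
    (∀ a, rowSum r * a * columnSum c' = 0) ∨ ∀ a, rowSum r' * a * columnSum c = 0 := by
  by_contra! hcon
  obtain ⟨⟨a, ha⟩, b, hb⟩ := hcon
  have h1 : ∃ g, rowSum r * MonoidAlgebra.single g 1 * columnSum c' ≠ 0 := by
    by_contra! h0
    exact ha (eq_zero_of_forall_single h0 a)
  have h2 : ∃ g, rowSum r' * MonoidAlgebra.single g 1 * columnSum c ≠ 0 := by
    by_contra! h0
    exact hb (eq_zero_of_forall_single h0 b)
  obtain ⟨g, hg⟩ := h1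
  obtain ⟨g', hg'⟩ := h2
  refine hne (h.eq_of_card_filter_eq h' fun k => le_antisymm ?_ ?_)
  · rw [← card_filter_comp_perm r g]
    exact h'.card_filter_le (injective_of_rowSum_mul_ne_zero hg) k
  · rw [← card_filter_comp_perm r' g']
    exact h.card_filter_le (injective_of_rowSum_mul_ne_zero hg') k

/-- Von Neumann's lemma: a nonzero product forces g to be a row permutation times a column
permutation. -/
theorem IsTableau.exists_smul_single {μ : YoungDiagram} {r c : Ω → ℕ} (h : IsTableau μ r c)
    (g : Equiv.Perm Ω) : ∃ s : ℂ, rowSum r * MonoidAlgebra.single g 1 * columnSum c =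
      s • (rowSum r * columnSum c) := by
  by_cases h0 : rowSum r * MonoidAlgebra.single g 1 * columnSum c = 0
  · exact ⟨0, by rw [h0, zero_smul]⟩
  have hinj := injective_of_rowSum_mul_ne_zero h0
  have hmem := h.mem_of_card_filter_eq hinj (card_filter_comp_perm r g)
  -- κ x is the cell in the column of x and the row of g x. It preserves columns, and g κ⁻¹
  -- preserves rows.
  choose κ hκr hκc using fun x => h.surj _ (hmem x)
  simp only at hκr hκc
  have hκi : Function.Injective κ := fun x y hxy =>
    hinj x y (by rw [← hκr x, ← hκr y, hxy]) (by rw [← hκc x, ← hκc y, hxy])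
  let κ' : Equiv.Perm Ω := Equiv.ofBijective κ (Finite.injective_iff_bijective.mp hκi)
  have hκ' : ∀ x, κ' x = κ x := fun _ => rfl
  have hρ : ∀ x, r ((g * κ'⁻¹) x) = r x := by
    intro x
    obtain ⟨y, rfl⟩ := κ'.surjective x
    rw [Equiv.Perm.mul_apply, show κ'⁻¹ (κ' y) = y from κ'.symm_apply_apply y, hκ', hκr]
  refine ⟨((Equiv.Perm.sign κ' : ℤ) : ℂ), ?_⟩
  have hg : MonoidAlgebra.single g (1 : ℂ) =
      MonoidAlgebra.single (g * κ'⁻¹) 1 * MonoidAlgebra.single κ' 1 := by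
    rw [MonoidAlgebra.single_mul_single, inv_mul_cancel_right, one_mul]
  rw [hg, ← mul_assoc, rowSum_mul_single hρ, mul_assoc, single_mul_columnSum fun x => by
    rw [hκ', hκc], mul_smul_comm]

theorem IsTableau.exists_smul {μ : YoungDiagram} {r c : Ω → ℕ} (h : IsTableau μ r c)
    (a : MonoidAlgebra ℂ (Equiv.Perm Ω)) :
    ∃ s : ℂ, rowSum r * a * columnSum c = s • (rowSum r * columnSum c) := by
  induction a using MonoidAlgebra.induction_linear with
  | zero => exact ⟨0, by simp⟩
  | add f g hf hg =>
    obtain ⟨s, hs⟩ := hf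
    obtain ⟨t, ht⟩ := hg
    exact ⟨s + t, by rw [mul_add, add_mul, hs, ht, add_smul]⟩
  | single g s =>
    obtain ⟨t, ht⟩ := h.exists_smul_single g
    refine ⟨s * t, ?_⟩
    rw [single_eq_smul_single_one, mul_smul_comm, smul_mul_assoc,
      ht, smul_smul]

/-! ### Coefficients of the Young symmetrizer -/

theorem coeff_rowSum_mul_columnSum_eq_zero {r c : Ω → ℕ} {g : Equiv.Perm Ω}
    (h : ∀ ρ κ : Equiv.Perm Ω, (∀ x, r (ρ x) = r x) → (∀ x, c (κ x) = c x) → ρ * κ ≠ g) :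
    (rowSum r * columnSum c).coeff g = 0 := by
  rw [rowSum, columnSum, Finset.sum_mul_sum]
  simp only [MonoidAlgebra.coeff_sum, Finsupp.coe_finsetSum, Finset.sum_apply]
  refine Finset.sum_eq_zero fun ρ hρ => Finset.sum_eq_zero fun κ hκ => ?_
  rw [Finset.mem_filter] at hρ hκ
  rw [MonoidAlgebra.single_mul_single, MonoidAlgebra.coeff_single,
    Finsupp.single_eq_of_ne (h ρ κ hρ.2 hκ.2).symm]

/-- A permutation preserving rows and inverse to one preserving columns fixes every cell. -/
theorem IsTableau.coeff_one {μ : YoungDiagram} {r c : Ω → ℕ} (h : IsTableau μ r c) :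
    (rowSum r * columnSum c).coeff 1 = 1 := by
  have hone : ∀ f : Ω → ℕ, (1 : Equiv.Perm Ω) ∈
      Finset.univ.filter (fun σ : Equiv.Perm Ω => ∀ x, f (σ x) = f x) := fun f => by simp
  rw [rowSum, columnSum, Finset.sum_mul_sum]
  simp only [MonoidAlgebra.coeff_sum, Finsupp.coe_finsetSum, Finset.sum_apply]
  have key : ∀ ρ κ : Equiv.Perm Ω, (∀ x, r (ρ x) = r x) → (∀ x, c (κ x) = c x) → ρ * κ = 1 →
      ρ = 1 ∧ κ = 1 := by
    intro ρ κ hρ hκ hm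
    have hκ1 : κ = 1 := by
      ext x
      refine h.inj _ _ ?_ (hκ x)
      rw [← hρ (κ x), ← Equiv.Perm.mul_apply, hm]
    rw [hκ1, mul_one] at hm
    exact ⟨hm, hκ1⟩
  rw [Finset.sum_eq_single_of_mem 1 (hone r), Finset.sum_eq_single_of_mem 1 (hone c)]
  · simp [MonoidAlgebra.single_mul_single]
  · intro κ hκ hne
    rw [Finset.mem_filter] at hκ
    rw [MonoidAlgebra.single_mul_single, MonoidAlgebra.coeff_single, Finsupp.single_eq_of_ne]
    intro h1
    exact hne (key 1 κ (fun _ => rfl) hκ.2 h1.symm).2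
  · intro ρ hρ hne
    rw [Finset.mem_filter] at hρ
    refine Finset.sum_eq_zero fun κ hκ => ?_
    rw [Finset.mem_filter] at hκ
    rw [MonoidAlgebra.single_mul_single, MonoidAlgebra.coeff_single, Finsupp.single_eq_of_ne]
    intro h1
    exact hne (key ρ κ hρ.2 hκ.2 h1.symm).1

end Tableau

/-! ### The group algebra of a symmetric group -/

section GroupAlgebra

variable {G : Type*}

instance finiteDimensional_monoidAlgebra [Finite G] : FiniteDimensional ℂ (MonoidAlgebra ℂ G) :=
  Module.Finite.of_basis (MonoidAlgebra.basis G ℂ)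

theorem finrank_monoidAlgebra [Fintype G] : Module.finrank ℂ (MonoidAlgebra ℂ G) = Fintype.card G :=
  Module.finrank_eq_card_basis (MonoidAlgebra.basis G ℂ)

variable [Group G]

/-- The coefficient of the neutral element. -/
def unitCoeff (G : Type*) [Group G] : MonoidAlgebra ℂ G →ₗ[ℂ] ℂ :=
  { toFun := fun x => x.coeff 1
    map_add' := fun _ _ => rfl
    map_smul' := fun _ _ => rfl }

theorem unitCoeff_mul_comm (x y : MonoidAlgebra ℂ G) :
    unitCoeff G (x * y) = unitCoeff G (y * x) := by
  classical
  induction x using MonoidAlgebra.induction_linear with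
  | zero => simp
  | add f g hf hg => rw [add_mul, mul_add, map_add, map_add, hf, hg]
  | single a s =>
    induction y using MonoidAlgebra.induction_linear with
    | zero => simp
    | add f g hf hg => rw [add_mul, mul_add, map_add, map_add, hf, hg]
    | single b t =>
      rw [MonoidAlgebra.single_mul_single, MonoidAlgebra.single_mul_single]
      change (MonoidAlgebra.single _ _).coeff 1 = (MonoidAlgebra.single _ _).coeff 1
      rw [MonoidAlgebra.coeff_single, MonoidAlgebra.coeff_single, Finsupp.single_apply,
        Finsupp.single_apply, mul_comm s t]
      exact if_congr mul_eq_one_comm rfl rfl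

theorem eq_zero_of_unitCoeff_mul (x : MonoidAlgebra ℂ G) (h : ∀ y, unitCoeff G (x * y) = 0) :
    x = 0 := by
  ext g
  have := h (MonoidAlgebra.single g⁻¹ 1)
  change (x * MonoidAlgebra.single g⁻¹ 1).coeff 1 = 0 at this
  rw [MonoidAlgebra.coeff_mul_single_apply] at this
  simpa using this

/-- Otherwise right multiplication by e would be nilpotent, but its trace is |G| times the
coefficient of e at 1. -/
theorem mul_self_ne_zero_of_unitCoeff [Finite G] {e : MonoidAlgebra ℂ G} (he : e.coeff 1 ≠ 0) : e * e ≠ 0 := by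
  classical
  have := Fintype.ofFinite G
  intro h
  have hnil : IsNilpotent (LinearMap.mulRight ℂ e) := by
    refine ⟨2, ?_⟩
    refine LinearMap.ext fun x => ?_
    rw [pow_two]
    change x * e * e = 0
    rw [mul_assoc, h, mul_zero]
  have htr := (LinearMap.isNilpotent_trace_of_isNilpotent hnil).eq_zero
  rw [LinearMap.trace_eq_matrix_trace ℂ (MonoidAlgebra.basis G ℂ), Matrix.trace] at htr
  have hdiag : ∀ g : G, (LinearMap.toMatrix (MonoidAlgebra.basis G ℂ) (MonoidAlgebra.basis G ℂ)
      (LinearMap.mulRight ℂ e)).diag g = e.coeff 1 := by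
    intro g
    rw [Matrix.diag_apply, LinearMap.toMatrix_apply, MonoidAlgebra.basis_apply]
    change (MonoidAlgebra.single g 1 * e).coeff g = _
    rw [MonoidAlgebra.coeff_single_mul_apply]
    simp
  simp only [hdiag, Finset.sum_const, nsmul_eq_mul] at htr
  rcases mul_eq_zero.mp htr with h0 | h0
  · simp at h0
  · exact he h0

end GroupAlgebra

/-! ### Upper and lower bounds for the dimension of the Young ideal -/

section YoungModule

variable {Ω : Type*} [Fintype Ω] [DecidableEq Ω]

/-- The dimension of the left ideal generated by the Young symmetrizer of a tableau. -/
def youngDim (r c : Ω → ℕ) : ℕ :=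
  Module.finrank ℂ (LinearMap.range (LinearMap.mulRight ℂ (rowSum r * columnSum c)))

theorem sum_sq_youngDim_le {ι : Type*} [Fintype ι] {μ : ι → YoungDiagram}
    (hμ : Function.Injective μ) {r c : ι → Ω → ℕ} (h : ∀ i, IsTableau (μ i) (r i) (c i)) :
    ∑ i, youngDim (r i) (c i) ^ 2 ≤ (Fintype.card Ω).factorial := by
  rw [← Fintype.card_perm, ← finrank_monoidAlgebra]
  refine sum_sq_finrank_le (τ := unitCoeff _) unitCoeff_mul_comm eq_zero_of_unitCoeff_mul
    (fun i a => ?_) (fun i => ?_) fun i j hij => ?_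
  · obtain ⟨s, hs⟩ := (h i).exists_smul (columnSum (c i) * a * rowSum (r i))
    refine ⟨s, ?_⟩
    rw [← hs]
    noncomm_ring
  · refine ⟨1, ?_⟩
    rw [mul_one]
    exact mul_self_ne_zero_of_unitCoeff (by rw [(h i).coeff_one]; exact one_ne_zero)
  · rcases (h i).orthogonal (h j) (fun h' => hij (hμ h')) with h' | h'
    · left
      intro a
      rw [← h' (columnSum (c i) * a * rowSum (r j))]
      noncomm_ring
    · right
      intro a
      rw [← h' (columnSum (c j) * a * rowSum (r i))]
      noncomm_ring

/-! ### A lower bound for the dimension -/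

/-- Order standard fillings by the sequence of rows that hold the successive entries. Then σ_S can
occur in σ_T times the symmetrizer only if S = T or S precedes T. -/
theorem IsTableau.eq_or_lex_lt {μ : YoungDiagram} {r c : Ω → ℕ} (h : IsTableau μ r c) {n : ℕ}
    {T S : Ω ≃ Fin n} (hTr : ∀ x y, r x = r y → c x < c y → T x < T y)
    (hSr : ∀ x y, r x = r y → c x < c y → S x < S y)
    (hSc : ∀ x y, c x = c y → r x < r y → S x < S y)
    {ρ κ : Equiv.Perm Ω} (hρ : ∀ x, r (ρ x) = r x) (hκ : ∀ x, c (κ x) = c x)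
    (hTS : ∀ x, T (ρ (κ x)) = S x) :
    S = T ∨ toLex (fun v => r (S.symm v)) < toLex (fun v => r (T.symm v)) := by
  by_cases hne : S = T
  · exact Or.inl hne
  right
  have hex : {v | T.symm v ≠ S.symm v}.Nonempty := by
    by_contra hemp
    rw [Set.not_nonempty_iff_eq_empty] at hemp
    refine hne (Equiv.symm_bijective.injective (Equiv.ext fun v => ?_))
    by_contra hv
    have : v ∈ {v | T.symm v ≠ S.symm v} := fun h' => hv h'.symm
    rw [hemp] at this
    exact this
  obtain ⟨v, hv, hmin⟩ := WellFounded.has_min (wellFounded_lt (α := Fin n)) _ hex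
  have hlow : ∀ u < v, T.symm u = S.symm u := fun u hu => by
    by_contra h'
    exact hmin u h' hu
  refine ⟨v, fun u hu => congrArg r (hlow u hu).symm, ?_⟩
  change r (S.symm v) < r (T.symm v)
  by_contra! hle
  set b₁ := T.symm v with hb₁
  set b₂ := S.symm v with hb₂
  have hT₁ : T b₁ = v := T.apply_symm_apply v
  have hS₂ : S b₂ = v := S.apply_symm_apply v
  have hv' : b₁ ≠ b₂ := hv
  have hrow : ∀ x, r (κ x) = r (T.symm (S x)) := fun x => by
    rw [← hρ, ← hTS, Equiv.symm_apply_apply]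
  -- At the first entry v placed differently, assume that b₂ is not above b₁. The cell in the row of
  -- b₁ and the column of b₂ then exists.
  obtain ⟨w, hwr, hwc⟩ := h.surj (r b₁, c b₂) (μ.up_left_mem hle le_rfl (h.mem b₂))
  simp only at hwr hwc
  -- If b₂ is to the left, κ sends both b₂ and w to w, so v would equal the earlier entry at w.
  -- Otherwise b₁ is weakly above and to the left of b₂, so S places an earlier entry there, on
  -- which S and T agree.
  rcases lt_or_ge (c b₂) (c b₁) with hc | hc
  · have hlt : T w < v := by
      rw [← hT₁]
      exact hTr _ _ hwr (by rw [hwc]; exact hc)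
    have hSw : S w = T w := by
      have := hlow _ hlt
      rw [Equiv.symm_apply_apply] at this
      rw [this, Equiv.apply_symm_apply]
      rw [← this]
    have h1 : κ b₂ = w := h.inj _ _ (by rw [hrow, hS₂, hwr]) (by rw [hκ, hwc])
    have h2 : κ w = w := h.inj _ _ (by rw [hrow, hSw, Equiv.symm_apply_apply]) (hκ w)
    have h3 : w = b₂ := κ.injective (h2.trans h1.symm)
    rw [← hSw, h3, hS₂] at hlt
    exact lt_irrefl _ hlt
  · have h1 : S b₁ < v := by
      rw [← hS₂]
      rcases hc.lt_or_eq with hc | hc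
      · have e1 : S b₁ < S w := hSr _ _ hwr.symm (by rw [hwc]; exact hc)
        rcases hle.lt_or_eq with hr | hr
        · exact e1.trans (hSc _ _ hwc (by rw [hwr]; exact hr))
        · rwa [h.inj w b₂ (by rw [hwr, hr]) hwc] at e1
      · rcases hle.lt_or_eq with hr | hr
        · exact hSc _ _ hc hr
        · exact absurd (h.inj _ _ hr hc) hv'
    have h2 := hlow _ h1
    rw [Equiv.symm_apply_apply, Equiv.symm_apply_eq, hT₁] at h2
    rw [h2] at h1
    exact lt_irrefl _ h1

/-- In a relation, apply the functional of the term with maximal key among the nonzero coefficients.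
-/
theorem linearIndependent_of_triangular {ι k V L : Type*} [Fintype ι] [Field k] [AddCommGroup V]
    [Module k V] [LinearOrder L] (u : ι → V) (φ : ι → V →ₗ[k] k) (key : ι → L)
    (hdiag : ∀ i, φ i (u i) ≠ 0) (htri : ∀ i j, φ i (u j) ≠ 0 → i = j ∨ key i < key j) :
    LinearIndependent k u := by
  classical
  rw [Fintype.linearIndependent_iff]
  intro a ha
  by_contra! hex
  obtain ⟨i₀, hi₀⟩ := hex
  obtain ⟨i, hi, hmax⟩ := Finset.exists_max_image (Finset.univ.filter fun i => a i ≠ 0) key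
    ⟨i₀, by simpa using hi₀⟩
  rw [Finset.mem_filter] at hi
  have h1 := congrArg (φ i) ha
  rw [map_sum, map_zero, Finset.sum_eq_single i] at h1
  · rw [map_smul, smul_eq_mul] at h1
    rcases mul_eq_zero.mp h1 with h | h
    · exact hi.2 h
    · exact hdiag i h
  · intro j _ hji
    rw [map_smul, smul_eq_mul]
    by_contra hne
    obtain ⟨h2, h3⟩ := mul_ne_zero_iff.mp hne
    rcases htri i j h3 with h | h
    · exact hji h.symm
    · exact absurd (hmax j (by simpa using h2)) (not_le.mpr h)
  · simp

/-- Each filling, compared with a fixed numbering of Ω, is a permutation; its translates of the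
symmetrizer have a triangular matrix of coefficients with diagonal 1. -/
theorem IsTableau.card_le_youngDim {μ : YoungDiagram} {r c : Ω → ℕ} (h : IsTableau μ r c)
    (hcard : Fintype.card Ω = μ.card) (s : Finset (ℕ × ℕ → ℕ)) (hs : ∀ T ∈ s, IsStandard μ T) :
    s.card ≤ youngDim r c := by
  have hbij : ∀ T : s, Function.Bijective fun x : Ω =>
      (⟨T.1 (r x, c x), (hs _ T.2).lt_card _ (h.mem x)⟩ : Fin μ.card) := by
    intro T
    rw [Fintype.bijective_iff_injective_and_card, Fintype.card_fin]
    refine ⟨fun x y hxy => ?_, hcard⟩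
    have := (hs _ T.2).injOn (h.mem x) (h.mem y) (Fin.mk.inj hxy)
    exact h.inj _ _ (congrArg Prod.fst this) (congrArg Prod.snd this)
  let E : s → Ω ≃ Fin μ.card := fun T => Equiv.ofBijective _ (hbij T)
  have hE : ∀ T x, (E T x : ℕ) = T.1 (r x, c x) := fun _ _ => rfl
  have hEinj : Function.Injective E := by
    intro T S hTS
    refine Subtype.ext (funext fun p => ?_)
    by_cases hp : p ∈ μ.cells
    · obtain ⟨x, hx1, hx2⟩ := h.surj p hp
      have := congrArg Fin.val (Equiv.congr_fun hTS x)
      rwa [hE, hE, hx1, hx2] at this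
    · rw [(hs _ T.2).zero_of_notMem _ hp, (hs _ S.2).zero_of_notMem _ hp]
  have hrow : ∀ T x y, r x = r y → c x < c y → E T x < E T y := by
    intro T x y hr hc
    rw [Fin.lt_def, hE, hE, hr]
    exact (hs _ T.2).row_lt _ _ _ hc (h.mem y)
  have hcol : ∀ T x y, c x = c y → r x < r y → E T x < E T y := by
    intro T x y hc hr
    rw [Fin.lt_def, hE, hE, hc]
    exact (hs _ T.2).col_lt _ _ _ hr (h.mem y)
  let e₀ : Ω ≃ Fin μ.card := Fintype.equivFinOfCardEq hcard
  let σ : s → Equiv.Perm Ω := fun T => (E T).trans e₀.symm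
  let e := rowSum r * columnSum c
  let V := LinearMap.range (LinearMap.mulRight ℂ e)
  let u : s → V := fun T => ⟨MonoidAlgebra.single (σ T) 1 * e, ⟨MonoidAlgebra.single (σ T) 1, rfl⟩⟩
  let φ : s → V →ₗ[ℂ] ℂ := fun S =>
    { toFun := fun x => x.1.coeff (σ S)
      map_add' := fun _ _ => rfl
      map_smul' := fun _ _ => rfl }
  have hφ : ∀ S T, φ S (u T) = e.coeff ((σ T)⁻¹ * σ S) := by
    intro S T
    change (MonoidAlgebra.single (σ T) 1 * e).coeff (σ S) = _
    rw [MonoidAlgebra.coeff_single_mul_apply, one_mul]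
  have hind : LinearIndependent ℂ u := by
    refine linearIndependent_of_triangular u φ
      (fun T => toLex fun v => r ((E T).symm v)) (fun T => ?_) fun S T hST => ?_
    · rw [hφ, inv_mul_cancel, h.coeff_one]
      exact one_ne_zero
    · rw [hφ] at hST
      have hex : ∃ ρ κ : Equiv.Perm Ω, (∀ x, r (ρ x) = r x) ∧ (∀ x, c (κ x) = c x) ∧
          ρ * κ = (σ T)⁻¹ * σ S := by
        by_contra! hcon
        exact hST (coeff_rowSum_mul_columnSum_eq_zero hcon)
      obtain ⟨ρ, κ, hρ, hκ, hm⟩ := hex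
      have hTS : ∀ x, E T (ρ (κ x)) = E S x := by
        intro x
        have h1 : σ T * (ρ * κ) = σ S := by rw [hm, mul_inv_cancel_left]
        exact e₀.symm.injective (Equiv.congr_fun h1 x)
      rcases h.eq_or_lex_lt (hrow T) (hrow S) (hcol S) hρ hκ hTS with h1 | h1
      · exact Or.inl (hEinj h1)
      · exact Or.inr h1
  have := hind.fintype_card_le_finrank
  rwa [Fintype.card_coe] at this

end YoungModule

/-! ### The dimensions of the irreducible representations -/

section Transport

variable {Ω Ω' : Type*} [Fintype Ω] [Fintype Ω'] [DecidableEq Ω] [DecidableEq Ω']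

theorem domCongr_rowSum (ε : Ω ≃ Ω') (r : Ω' → ℕ) :
    MonoidAlgebra.domCongr ℂ ℂ ε.permCongrHom (rowSum (r ∘ ε)) = rowSum r := by
  rw [rowSum, rowSum, map_sum]
  refine Finset.sum_bij' (fun σ _ => ε.permCongr σ) (fun σ _ => ε.permCongr.symm σ)
    (fun σ hσ => ?_) (fun σ hσ => ?_) (fun σ _ => ε.permCongr.symm_apply_apply σ)
    (fun σ _ => ε.permCongr.apply_symm_apply σ) fun σ _ => ?_
  · rw [Finset.mem_filter] at hσ ⊢
    exact ⟨Finset.mem_univ _, fun x => by simpa using hσ.2 (ε.symm x)⟩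
  · rw [Finset.mem_filter] at hσ ⊢
    exact ⟨Finset.mem_univ _, fun x => by simpa using hσ.2 (ε x)⟩
  · rw [MonoidAlgebra.domCongr_single]
    rfl

theorem domCongr_columnSum (ε : Ω ≃ Ω') (c : Ω' → ℕ) :
    MonoidAlgebra.domCongr ℂ ℂ ε.permCongrHom (columnSum (c ∘ ε)) = columnSum c := by
  rw [columnSum, columnSum, map_sum]
  refine Finset.sum_bij' (fun σ _ => ε.permCongr σ) (fun σ _ => ε.permCongr.symm σ)
    (fun σ hσ => ?_) (fun σ hσ => ?_) (fun σ _ => ε.permCongr.symm_apply_apply σ)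
    (fun σ _ => ε.permCongr.apply_symm_apply σ) fun σ _ => ?_
  · rw [Finset.mem_filter] at hσ ⊢
    exact ⟨Finset.mem_univ _, fun x => by simpa using hσ.2 (ε.symm x)⟩
  · rw [Finset.mem_filter] at hσ ⊢
    exact ⟨Finset.mem_univ _, fun x => by simpa using hσ.2 (ε x)⟩
  · rw [MonoidAlgebra.domCongr_single, Equiv.Perm.sign_permCongr]
    rfl

theorem youngDim_comp (ε : Ω ≃ Ω') (r c : Ω' → ℕ) : youngDim (r ∘ ε) (c ∘ ε) = youngDim r c := by
  let Φ := MonoidAlgebra.domCongr ℂ ℂ ε.permCongrHom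
  have hΦ : Φ (rowSum (r ∘ ε) * columnSum (c ∘ ε)) = rowSum r * columnSum c := by
    rw [map_mul, domCongr_rowSum, domCongr_columnSum]
  have hmap : (LinearMap.range (LinearMap.mulRight ℂ (rowSum (r ∘ ε) * columnSum (c ∘ ε)))).map
      (Φ.toLinearEquiv : _ →ₗ[ℂ] _) =
      LinearMap.range (LinearMap.mulRight ℂ (rowSum r * columnSum c)) := by
    ext y
    constructor
    · rintro ⟨_, ⟨x, rfl⟩, rfl⟩
      refine ⟨Φ x, ?_⟩
      change Φ x * _ = Φ (x * _)
      rw [map_mul Φ x, hΦ]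
    · rintro ⟨x, rfl⟩
      refine ⟨_, ⟨Φ.symm x, rfl⟩, ?_⟩
      change Φ (Φ.symm x * _) = x * _
      rw [map_mul Φ _, hΦ, AlgEquiv.apply_symm_apply]
  rw [youngDim, youngDim, ← hmap]
  exact (LinearEquiv.finrank_map_eq Φ.toLinearEquiv _).symm

end Transport

theorem dimension_eq_youngDim (μ : YoungDiagram) :
    dimension μ = youngDim (fun x : μ.cells => x.1.1) (fun x : μ.cells => x.1.2) := by
  have h : (irrep μ).restrictScalars ℂ = LinearMap.range (LinearMap.mulRight ℂ
      (rowSum (fun x : μ.cells => x.1.1) * columnSum (fun x : μ.cells => x.1.2))) := by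
    ext y
    rw [Submodule.restrictScalars_mem, irrep, Submodule.mem_span_singleton]
    rfl
  rw [youngDim, ← h]
  rfl

theorem isTableau_cells (μ : YoungDiagram) :
    IsTableau μ (fun x : μ.cells => x.1.1) (fun x : μ.cells => x.1.2) :=
  ⟨fun x => x.2, fun _ _ hr hc => Subtype.ext (Prod.ext hr hc), fun p hp => ⟨⟨p, hp⟩, rfl, rfl⟩⟩

theorem IsTableau.comp {Ω Ω' : Type*} {μ : YoungDiagram} {r c : Ω' → ℕ} (h : IsTableau μ r c)
    (ε : Ω ≃ Ω') : IsTableau μ (r ∘ ε) (c ∘ ε) :=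
  ⟨fun x => h.mem _, fun x y hr hc => ε.injective (h.inj _ _ hr hc), fun p hp => by
    obtain ⟨x, hx⟩ := h.surj p hp
    exact ⟨ε.symm x, by simpa using hx⟩⟩

/-- The symmetric groups of the different cell sets are first transported to the common group of
`Fin n`. -/
theorem sum_sq_dimension_le {ι : Type*} [Fintype ι] {n : ℕ} {μ : ι → YoungDiagram}
    (hμ : Function.Injective μ) (hn : ∀ i, (μ i).card = n) :
    ∑ i, dimension (μ i) ^ 2 ≤ n.factorial := by
  have hcard : ∀ i, Fintype.card (μ i).cells = n := fun i => by
    rw [Fintype.card_coe]; exact hn i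
  let ε : ∀ i, Fin n ≃ (μ i).cells := fun i => (Fintype.equivFinOfCardEq (hcard i)).symm
  have h := sum_sq_youngDim_le hμ fun i => (isTableau_cells (μ i)).comp (ε i)
  simpa only [youngDim_comp, ← dimension_eq_youngDim, Fintype.card_fin] using h

/-! ### The squeeze that identifies the dimension -/

theorem frob_nonneg (n : ℕ) : ∀ P Q : Finset ℕ, (P, Q) ∈ frobStates n → 0 ≤ frob P Q := by
  induction n with
  | zero =>
    intro P Q h
    obtain ⟨h1, h2⟩ := mem_frobStates.mp h
    simp only at h1 h2
    have hP : P = ∅ := Finset.card_eq_zero.mp (by lia)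
    have hQ : Q = ∅ := Finset.card_eq_zero.mp (by lia)
    rw [hP, hQ, frob_empty]
    exact zero_le_one
  | succ n ih =>
    intro P Q h
    obtain ⟨h1, h2⟩ := mem_frobStates.mp h
    simp only at h1 h2
    have hdown := frob_down h1
    rw [h2] at hdown
    have h3 : (0 : ℝ) ≤ ((n + 1 : ℕ) : ℝ) * frob P Q := by
      rw [← hdown]
      refine add_nonneg (add_nonneg (Finset.sum_nonneg fun x hx => ?_)
        (Finset.sum_nonneg fun y hy => ?_)) ?_
      · exact ih _ _ (frobStates_lower h hx)
      · exact ih _ _ (frobStates_swap (frobStates_lower (frobStates_swap h) hy))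
      · split_ifs with h0
        · exact ih _ _ (frobStates_erase h h0.1 h0.2)
        · exact le_rfl
    exact nonneg_of_mul_nonneg_right h3 (by positivity)

theorem factorial_mul_frob_le_dimension (μ : YoungDiagram) :
    (μ.card.factorial : ℝ) * frob (arms μ) (legs μ) ≤ dimension μ := by
  obtain ⟨s, hs, hle⟩ := exists_standard _ μ rfl
  refine hle.trans ?_
  rw [dimension_eq_youngDim]
  exact_mod_cast (isTableau_cells μ).card_le_youngDim (Fintype.card_coe _) s hs

/-- Termwise n! f ≤ dim, while ∑ (n! f)² = n! ≥ ∑ dim². Nonnegativity of f allows squaring and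
taking roots. -/
theorem dimension_eq (μ : YoungDiagram) :
    (dimension μ : ℝ) = μ.card.factorial * frob (arms μ) (legs μ) := by
  obtain ⟨n, hn⟩ : ∃ n, μ.card = n := ⟨_, rfl⟩
  choose D hDa hDl hDc using fun s : frobStates n => exists_youngDiagram n s.1.1 s.1.2 s.2
  have hD : Function.Injective D := fun s t h => Subtype.ext (Prod.ext
    (by rw [← hDa, ← hDa, h]) (by rw [← hDl, ← hDl, h]))
  have hle : ∀ s : frobStates n, (n.factorial * frob s.1.1 s.1.2) ^ 2 ≤ (dimension (D s) : ℝ) ^ 2 :=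
    fun s => by
      have h1 := factorial_mul_frob_le_dimension (D s)
      rw [hDc, hDa, hDl] at h1
      exact pow_le_pow_left₀ (mul_nonneg (Nat.cast_nonneg _) (frob_nonneg n _ _ s.2)) h1 2
  have hsum : ∑ s : frobStates n, ((n.factorial : ℝ) * frob s.1.1 s.1.2) ^ 2 = n.factorial := by
    have h2 := sum_frob_sq n
    rw [← Finset.sum_coe_sort] at h2
    simp only [mul_pow]
    rw [← Finset.mul_sum, h2, sq, mul_assoc, mul_inv_cancel₀, mul_one]
    exact_mod_cast n.factorial_ne_zero
  have hge : ∑ s : frobStates n, (dimension (D s) : ℝ) ^ 2 ≤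
      ∑ s : frobStates n, ((n.factorial : ℝ) * frob s.1.1 s.1.2) ^ 2 := by
    rw [hsum]
    exact_mod_cast sum_sq_dimension_le hD hDc
  have heq := (Finset.sum_eq_sum_iff_of_le fun s _ => hle s).mp
    (le_antisymm (Finset.sum_le_sum fun s _ => hle s) hge)
  have hm := arms_legs_mem_frobStates μ
  rw [hn] at hm
  have h3 := heq ⟨_, hm⟩ (Finset.mem_univ _)
  have h4 : D ⟨_, hm⟩ = μ := eq_of_arms_eq_of_legs_eq (hDa _) (hDl _)
  rw [h4] at h3
  rw [hn]
  exact ((pow_left_inj₀ (mul_nonneg (Nat.cast_nonneg _) (frob_nonneg n _ _ hm))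
    (Nat.cast_nonneg _) two_ne_zero).mp h3).symm

/-! ### The principal minors of `L` -/

/-- The product of the three unipotent blocks is the rotation (0, 1; -1, 0), so no sign has to be
computed. -/
theorem det_fromBlocks_antidiagonal {n : Type*} [Fintype n] [DecidableEq n] (B C : Matrix n n ℝ) :
    (Matrix.fromBlocks 0 B (-C) 0).det = B.det * C.det := by
  have h : Matrix.fromBlocks 0 B (-C) 0 = Matrix.fromBlocks B 0 0 C *
      (Matrix.fromBlocks 1 1 0 1 * (Matrix.fromBlocks 1 0 (-1) 1 * Matrix.fromBlocks 1 1 0 1)) := by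
    simp [Matrix.fromBlocks_multiply]
  rw [h, Matrix.det_mul, Matrix.det_mul, Matrix.det_mul, Matrix.det_fromBlocks_zero₂₁,
    Matrix.det_fromBlocks_zero₂₁, Matrix.det_fromBlocks_zero₁₂]
  simp

/-- One of the two off-diagonal blocks has more columns than rows, hence a kernel vector. -/
theorem det_fromBlocks_eq_zero {m n : Type*} [Fintype m] [Fintype n] [DecidableEq m]
    [DecidableEq n] (B : Matrix m n ℝ) (C : Matrix n m ℝ) (h : Fintype.card m ≠ Fintype.card n) :
    (Matrix.fromBlocks 0 B C 0).det = 0 := by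
  rw [← Matrix.exists_mulVec_eq_zero_iff]
  rcases Nat.lt_or_gt_of_ne h with h | h
  · have hk : LinearMap.ker (Matrix.mulVecLin B) ≠ ⊥ :=
      LinearMap.ker_ne_bot_of_finrank_lt (by simpa using h)
    obtain ⟨v, hv, hv0⟩ := Submodule.exists_mem_ne_zero_of_ne_bot hk
    refine ⟨Sum.elim 0 v, fun h0 => hv0 (funext fun i => congrFun h0 (Sum.inr i)), ?_⟩
    have hv' : B.mulVec v = 0 := hv
    rw [Matrix.fromBlocks_mulVec]
    ext (i | i) <;> simp [hv']
  · have hk : LinearMap.ker (Matrix.mulVecLin C) ≠ ⊥ :=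
      LinearMap.ker_ne_bot_of_finrank_lt (by simpa using h)
    obtain ⟨v, hv, hv0⟩ := Submodule.exists_mem_ne_zero_of_ne_bot hk
    refine ⟨Sum.elim v 0, fun h0 => hv0 (funext fun i => congrFun h0 (Sum.inl i)), ?_⟩
    have hv' : C.mulVec v = 0 := hv
    rw [Matrix.fromBlocks_mulVec]
    ext (i | i) <;> simp [hv']

theorem minor_univ_map {ι n : Type*} [Fintype n] [DecidableEq ι] [DecidableEq n] (L : ι → ι → ℝ)
    (f : n ↪ ι) : minor L (Finset.univ.map f) = (Matrix.of fun i j => L (f i) (f j)).det := by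
  rw [minor_image]
  exact Matrix.det_submatrix_equiv_self (Equiv.subtypeUnivEquiv fun _ => Finset.mem_univ _) _

theorem minor_blockL_eq_zero (η : ℝ) {P Q : Finset ℕ} (h : P.card ≠ Q.card) :
    minor (blockL η) (P.disjSum Q) = 0 := by
  let f : P ⊕ Q ↪ ℕ ⊕ ℕ :=
    ⟨Sum.map Subtype.val Subtype.val, Subtype.val_injective.sumMap Subtype.val_injective⟩
  have hf : Finset.univ.map f = P.disjSum Q := by
    ext (k | k) <;> simp [f]
  rw [← hf, minor_univ_map, ← det_fromBlocks_eq_zero (m := P) (n := Q)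
    (Matrix.of fun i j => blockD η i j) (Matrix.of fun i j => -blockD η i j) (by simpa using h)]
  congr 1
  ext (i | i) (j | j) <;> rfl

theorem blockD_eq (η : ℝ) (k l : ℕ) : blockD η k l = η ^ k * (hookCoeff k l * η ^ (l + 1)) := by
  unfold blockD hookCoeff
  rw [div_eq_mul_inv, pow_add, pow_add, pow_succ]
  ring

/-- Rows contribute η^(p i) and columns η^(q j + 1); the total exponent is the size of the diagram.
-/
theorem det_blockD (η : ℝ) {d : ℕ} (p q : Fin d → ℕ) :
    (Matrix.of fun i j => blockD η (p i) (q j)).det = η ^ (∑ i, p i + ∑ i, q i + d) * frobDet p q := by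
  have h : (Matrix.of fun i j => blockD η (p i) (q j)) = Matrix.of fun i j =>
      η ^ p i * (Matrix.of fun i j => η ^ (q j + 1) *
        (Matrix.of fun i j => hookCoeff (p i) (q j)) i j) i j := by
    ext i j
    simp only [Matrix.of_apply, blockD_eq]
    ring
  rw [h, Matrix.det_mul_column, Matrix.det_mul_row, Finset.prod_pow_eq_pow_sum,
    Finset.prod_pow_eq_pow_sum, ← mul_assoc, ← pow_add, Finset.sum_add_distrib, frobDet]
  simp [add_assoc]

theorem minor_blockL_eq {θ : ℝ} (hθ : 0 < θ) {P Q : Finset ℕ} (h : P.card = Q.card) :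
    minor (blockL √θ) (P.disjSum Q) =
      θ ^ (∑ x ∈ P, x + ∑ y ∈ Q, y + P.card) * frob P Q ^ 2 := by
  obtain ⟨d, p, q, hp, hq, rfl, rfl⟩ := exists_strictMono_images_eq h
  let f : Fin d ⊕ Fin d ↪ ℕ ⊕ ℕ := ⟨Sum.map p q, hp.injective.sumMap hq.injective⟩
  have hf : Finset.univ.map f = (Finset.univ.image p).disjSum (Finset.univ.image q) := by
    ext (k | k) <;> simp [f]
  rw [← hf, minor_univ_map, frob_eq_frobDet hp hq, Finset.card_image_of_injective _ hp.injective,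
    Finset.sum_image hp.injective.injOn, Finset.sum_image hq.injective.injOn, Finset.card_univ,
    Fintype.card_fin]
  have hM : (Matrix.of fun i j => blockL √θ (f i) (f j)) =
      Matrix.fromBlocks 0 (Matrix.of fun i j => blockD √θ (p i) (q j))
        (-Matrix.of fun i j => blockD √θ (q i) (p j)) 0 := by
    ext (i | i) (j | j) <;> rfl
  rw [hM, det_fromBlocks_antidiagonal, det_blockD, det_blockD, frobDet_symm q p,
    add_comm (∑ i, q i)]
  nth_rewrite 3 [← Real.sq_sqrt hθ.le]
  ring

/-! ### Summation over all diagrams -/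

/-- The weight of a diagram, normalized to total mass `exp θ`. -/
def frobWeight (θ : ℝ) (μ : YoungDiagram) : ℝ := θ ^ μ.card * frob (arms μ) (legs μ) ^ 2

theorem frobWeight_nonneg {θ : ℝ} (hθ : 0 < θ) (μ : YoungDiagram) : 0 ≤ frobWeight θ μ := by
  unfold frobWeight; positivity

theorem poissonizedWeight_eq_frobWeight (θ : ℝ) (μ : YoungDiagram) :
    poissonizedWeight θ μ = Real.exp (-θ) * frobWeight θ μ := by
  have h : (μ.card.factorial : ℝ) ≠ 0 := by exact_mod_cast μ.card.factorial_ne_zero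
  rw [poissonizedWeight_eq, dimension_eq, mul_div_cancel_left₀ _ h, frobWeight, mul_assoc]

theorem minor_frobSet {θ : ℝ} (hθ : 0 < θ) (μ : YoungDiagram) :
    minor (blockL √θ) (frobSet μ) = frobWeight θ μ := by
  have h := mem_frobStates.mp (arms_legs_mem_frobStates μ)
  rw [frobSet, minor_blockL_eq hθ h.1, frobWeight, ← h.2]

theorem frobSet_injective : Function.Injective frobSet := by
  intro μ ν h
  refine eq_of_arms_eq_of_legs_eq ?_ ?_
  · ext x
    have := Finset.ext_iff.mp h (Sum.inl x)
    simpa [frobSet] using this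
  · ext x
    have := Finset.ext_iff.mp h (Sum.inr x)
    simpa [frobSet] using this

/-- A nonzero minor has as many arms as legs, and any such pair of sets comes from a diagram. Sums
over diagrams thus become sums over all finite configurations. -/
theorem mem_range_frobSet {η : ℝ} {Y : Finset (ℕ ⊕ ℕ)} (h : minor (blockL η) Y ≠ 0) :
    Y ∈ Set.range frobSet := by
  have hY : Y.toLeft.disjSum Y.toRight = Y := Finset.toLeft_disjSum_toRight
  rw [← hY] at h
  have hc : Y.toLeft.card = Y.toRight.card := by
    by_contra hne
    exact h (minor_blockL_eq_zero η hne)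
  obtain ⟨μ, h1, h2, -⟩ := exists_youngDiagram _ Y.toLeft Y.toRight (mem_frobStates.mpr ⟨hc, rfl⟩)
  exact ⟨μ, by rw [frobSet, h1, h2, hY]⟩

/-- Grading by size, the diagrams with n cells contribute θ^n ∑ f² = θ^n/n!. -/
theorem hasSum_frobWeight {θ : ℝ} (hθ : 0 < θ) : HasSum (frobWeight θ) (Real.exp θ) := by
  let e : YoungDiagram ≃ Σ n, frobStates n := Equiv.ofBijective
    (fun μ => ⟨μ.card, ⟨(arms μ, legs μ), arms_legs_mem_frobStates μ⟩⟩) (by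
      constructor
      · intro μ ν h
        obtain ⟨h1, h2⟩ := Sigma.mk.inj h
        have h3 : (arms μ, legs μ) = (arms ν, legs ν) := by
          have key : ∀ (m n : ℕ) (s : frobStates m) (t : frobStates n), m = n → HEq s t →
              s.1 = t.1 := by
            rintro m n s t rfl hst
            rw [eq_of_heq hst]
          exact key _ _ _ _ h1 h2
        exact eq_of_arms_eq_of_legs_eq (congrArg Prod.fst h3) (congrArg Prod.snd h3)
      · rintro ⟨n, ⟨⟨P, Q⟩, h⟩⟩
        obtain ⟨μ, rfl, rfl, rfl⟩ := exists_youngDiagram n P Q h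
        exact ⟨μ, rfl⟩)
  let g : (Σ n, frobStates n) → ℝ := fun s => θ ^ s.1 * frob s.2.1.1 s.2.1.2 ^ 2
  have hg0 : ∀ s, 0 ≤ g s := fun s => by positivity
  have hfib : ∀ n, HasSum (fun s : frobStates n => g ⟨n, s⟩) (θ ^ n / n.factorial) := by
    intro n
    have h := hasSum_fintype fun s : frobStates n => g ⟨n, s⟩
    have h2 : ∑ s : frobStates n, g ⟨n, s⟩ = θ ^ n / n.factorial := by
      simp only [g]
      rw [← Finset.mul_sum, Finset.sum_coe_sort (frobStates n) fun s => frob s.1 s.2 ^ 2,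
        sum_frob_sq, div_eq_mul_inv]
    rwa [h2] at h
  have hexp : HasSum (fun n : ℕ => θ ^ n / n.factorial) (Real.exp θ) := by
    rw [Real.exp_eq_exp_ℝ]
    exact NormedSpace.expSeries_div_hasSum_exp θ
  have hsum : Summable g := (summable_sigma_of_nonneg hg0).mpr
    ⟨fun n => (hfib n).summable, hexp.summable.congr fun n => ((hfib n).tsum_eq).symm⟩
  have hg : HasSum g (Real.exp θ) := by
    have h := hsum.hasSum
    rwa [(h.sigma hfib).unique hexp] at h
  exact (e.hasSum_iff (f := g)).mpr hg

theorem hasSum_minor_blockL {θ : ℝ} (hθ : 0 < θ) : HasSum (minor (blockL √θ)) (Real.exp θ) := by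
  rw [← frobSet_injective.hasSum_iff fun Y hY => by_contra fun h => hY (mem_range_frobSet h)]
  exact (hasSum_frobWeight hθ).congr_fun fun μ => minor_frobSet hθ μ

theorem minor_blockL_nonneg {θ : ℝ} (hθ : 0 < θ) (Y : Finset (ℕ ⊕ ℕ)) :
    0 ≤ minor (blockL √θ) Y := by
  by_contra h
  obtain ⟨μ, rfl⟩ := mem_range_frobSet (show minor (blockL √θ) Y ≠ 0 from fun h' => h h'.ge)
  exact h (by rw [minor_frobSet hθ]; exact frobWeight_nonneg hθ μ)

theorem tsum_frobWeight {θ : ℝ} (hθ : 0 < θ) (p : Finset (ℕ ⊕ ℕ) → Prop)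
    [DecidablePred p] :
    ∑' μ, (if p (frobSet μ) then frobWeight θ μ else 0) =
      ∑' Y, if p Y then minor (blockL √θ) Y else 0 := by
  rw [← frobSet_injective.tsum_eq (f := fun Y => if p Y then minor (blockL √θ) Y else 0)]
  · simp only [minor_frobSet hθ]
  · intro Y hY
    rw [Function.mem_support] at hY
    exact mem_range_frobSet (η := √θ) fun h => hY (by simp [h])

/-! ### Probabilities -/

theorem poissonizedPlancherel_apply {θ : ℝ} (hθ : 0 < θ) (p : Finset (ℕ ⊕ ℕ) → Prop)
    [DecidablePred p] :
    poissonizedPlancherel θ {μ | p (frobSet μ)} = ENNReal.ofReal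
      (Real.exp (-θ) * ∑' Y, if p Y then minor (blockL √θ) Y else 0) := by
  have hs : Summable fun μ => Real.exp (-θ) * if p (frobSet μ) then frobWeight θ μ else 0 :=
    (Summable.of_nonneg_of_le (fun μ => by split_ifs; exacts [frobWeight_nonneg hθ μ, le_rfl])
      (fun μ => by split_ifs; exacts [le_rfl, frobWeight_nonneg hθ μ])
      (hasSum_frobWeight hθ).summable).mul_left _
  rw [← tsum_frobWeight hθ, ← tsum_mul_left, ENNReal.ofReal_tsum_of_nonneg (fun μ => by
    split_ifs
    · exact mul_nonneg (Real.exp_nonneg _) (frobWeight_nonneg hθ μ)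
    · simp) hs, poissonizedPlancherel, Measure.sum_apply _ (by trivial)]
  refine tsum_congr fun μ => ?_
  rw [Measure.smul_apply, Measure.dirac_apply' _ (by trivial), poissonizedWeight_eq_frobWeight]
  by_cases h : p (frobSet μ)
  · simp [h]
  · simp [h]

theorem poissonizedPlancherel_real {θ : ℝ} (hθ : 0 < θ) (p : Finset (ℕ ⊕ ℕ) → Prop)
    [DecidablePred p] :
    (poissonizedPlancherel θ).real {μ | p (frobSet μ)} =
      Real.exp (-θ) * ∑' Y, if p Y then minor (blockL √θ) Y else 0 := by
  rw [Measure.real, poissonizedPlancherel_apply hθ, ENNReal.toReal_ofReal]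
  refine mul_nonneg (Real.exp_nonneg _) (tsum_nonneg fun Y => ?_)
  split_ifs
  exacts [minor_blockL_nonneg hθ Y, le_rfl]

theorem isProbabilityMeasure_poissonizedPlancherel {θ : ℝ} (hθ : 0 < θ) :
    IsProbabilityMeasure (poissonizedPlancherel θ) := by
  refine ⟨?_⟩
  have h := poissonizedPlancherel_apply hθ fun _ => True
  simp only [if_true, (hasSum_minor_blockL hθ).tsum_eq] at h
  rw [← Real.exp_add, neg_add_cancel, Real.exp_zero, ENNReal.ofReal_one] at h
  rw [← h]
  congr 1

/-! ### Estimates for the kernels -/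

theorem hasSum_sum_elim {f : ℕ ⊕ ℕ → ℝ} {s t : ℝ} (h1 : HasSum (fun k => f (Sum.inl k)) s)
    (h2 : HasSum (fun k => f (Sum.inr k)) t) : HasSum f (s + t) := h1.sum h2

/-- A summable majorant for the kernels. -/
def majorant (η : ℝ) (p : ℕ ⊕ ℕ) : ℝ :=
  (η + 1) * Sum.elim (fun k : ℕ => expCoeff η k) (fun l : ℕ => expCoeff η l) p

theorem majorant_nonneg {η : ℝ} (hη : 0 ≤ η) (p : ℕ ⊕ ℕ) : 0 ≤ majorant η p := by
  rcases p with k | k <;> exact mul_nonneg (by linarith) (expCoeff_nonneg hη _)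

theorem summable_majorant (η : ℝ) : Summable (majorant η) :=
  (hasSum_sum_elim (f := Sum.elim (fun k : ℕ => expCoeff η k) fun l : ℕ => expCoeff η l)
    (summable_expCoeff_nat η).hasSum (summable_expCoeff_nat η).hasSum).summable.mul_left _

theorem blockL_antisymm (η : ℝ) (p q : ℕ ⊕ ℕ) : blockL η q p = -blockL η p q := by
  rcases p with k | k <;> rcases q with l | l <;> simp [blockL, blockD_symm η k l]

theorem abs_blockD_le_majorant {η : ℝ} (hη : 0 ≤ η) (k l : ℕ) :
    |blockD η k l| ≤ ((η + 1) * expCoeff η k) * ((η + 1) * expCoeff η l) := by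
  refine (abs_blockD_le hη k l).trans ?_
  rw [show ((η + 1) * expCoeff η k) * ((η + 1) * expCoeff η l) =
    (η + 1) ^ 2 * (expCoeff η k * expCoeff η l) by ring]
  exact mul_le_mul_of_nonneg_right (by nlinarith)
    (mul_nonneg (expCoeff_nonneg hη _) (expCoeff_nonneg hη _))

theorem abs_blockL_le {η : ℝ} (hη : 0 ≤ η) (p q : ℕ ⊕ ℕ) :
    |blockL η p q| ≤ majorant η p * majorant η q := by
  rcases p with k | k <;> rcases q with l | l
  · simpa [blockL] using mul_nonneg (majorant_nonneg hη _) (majorant_nonneg hη _)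
  · exact abs_blockD_le_majorant hη k l
  · have h := abs_blockD_le_majorant hη k l
    rw [← abs_neg] at h
    exact h
  · simpa [blockL] using mul_nonneg (majorant_nonneg hη _) (majorant_nonneg hη _)

theorem abs_besselInt_add_le {η : ℝ} (hη : 0 ≤ η) (k m : ℕ) :
    |besselInt η (k + m)| ≤ besselConst η * Real.exp η * expCoeff η k := by
  have h := abs_besselInt_natCast_le hη (k + m)
  push_cast at h
  refine h.trans ?_
  rw [mul_assoc]
  exact mul_le_mul_of_nonneg_left (expCoeff_add_le_left hη k m) (besselConst_nonneg η)

theorem abs_blockG_le {η : ℝ} (hη : 0 ≤ η) (k l : ℕ) :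
    |blockG η k l| ≤ (∑' n, |besselInt η n|) * (besselConst η * Real.exp η) * expCoeff η k := by
  have hinj : Function.Injective fun m : ℕ => (l : ℤ) + (m + 1) := fun m n h => by simpa using h
  have hs : Summable fun m : ℕ => |besselInt η (l + (m + 1))| :=
    (summable_abs_besselInt hη).comp_injective hinj
  have hs' : ∑' m : ℕ, |besselInt η (l + (m + 1))| ≤ ∑' n, |besselInt η n| :=
    hs.tsum_le_tsum_of_inj (fun m : ℕ => (l : ℤ) + (m + 1)) hinj (fun _ _ => abs_nonneg _)
      (fun _ => le_rfl) (summable_abs_besselInt hη)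
  have hc : 0 ≤ besselConst η * Real.exp η * expCoeff η k :=
    mul_nonneg (mul_nonneg (besselConst_nonneg η) (Real.exp_nonneg η)) (expCoeff_nonneg hη _)
  have hsc := hs.mul_left (besselConst η * Real.exp η * expCoeff η k)
  have hle : ∀ m : ℕ, |besselInt η (k + (m + 1)) * besselInt η (l + (m + 1))| ≤
      besselConst η * Real.exp η * expCoeff η k * |besselInt η (l + (m + 1))| := by
    intro m
    rw [abs_mul]
    refine mul_le_mul_of_nonneg_right ?_ (abs_nonneg _)
    exact_mod_cast abs_besselInt_add_le hη k (m + 1)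
  have hs2 : Summable fun m : ℕ => |besselInt η (k + (m + 1)) * besselInt η (l + (m + 1))| :=
    Summable.of_nonneg_of_le (fun m => abs_nonneg _) hle hsc
  calc |blockG η k l| ≤ ∑' m : ℕ, |besselInt η (k + (m + 1)) * besselInt η (l + (m + 1))| :=
        norm_tsum_le_tsum_norm
          (f := fun m : ℕ => besselInt η (k + (m + 1)) * besselInt η (l + (m + 1))) hs2
    _ ≤ ∑' m : ℕ, besselConst η * Real.exp η * expCoeff η k * |besselInt η (l + (m + 1))| :=
        hs2.tsum_le_tsum hle hsc
    _ = besselConst η * Real.exp η * expCoeff η k * ∑' m : ℕ, |besselInt η (l + (m + 1))| :=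
        hs.tsum_mul_left _
    _ ≤ besselConst η * Real.exp η * expCoeff η k * ∑' n, |besselInt η n| :=
        mul_le_mul_of_nonneg_left hs' hc
    _ = _ := by ring

theorem abs_blockF_le {η : ℝ} (hη : 0 ≤ η) (k l : ℕ) :
    |blockF η k l| ≤ 2 * η * (besselConst η * Real.exp η) * (besselConst η * Real.exp η) *
      expCoeff η k := by
  have h0 := abs_besselInt_add_le hη k 0
  have h1 := abs_besselInt_add_le hη k 1
  simp only [Nat.cast_zero, add_zero, Nat.cast_one] at h0 h1
  have hB : 0 ≤ besselConst η * Real.exp η := mul_nonneg (besselConst_nonneg η) (Real.exp_nonneg η)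
  have hA : 0 ≤ besselConst η * Real.exp η * expCoeff η k := mul_nonneg hB (expCoeff_nonneg hη _)
  have hnum : |besselInt η k * besselInt η l + besselInt η (k + 1) * besselInt η (l + 1)| ≤
      2 * (besselConst η * Real.exp η * expCoeff η k * (besselConst η * Real.exp η)) := by
    refine (abs_add_le _ _).trans ?_
    rw [abs_mul, abs_mul, two_mul]
    exact add_le_add (mul_le_mul h0 (abs_besselInt_le_const hη _) (abs_nonneg _) hA)
      (mul_le_mul h1 (abs_besselInt_le_const hη _) (abs_nonneg _) hA)
  have hden : (1 : ℝ) ≤ |(k : ℝ) + l + 1| := by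
    rw [abs_of_nonneg (by positivity)]
    have : (0 : ℝ) ≤ (k : ℝ) + l := by positivity
    linarith
  rw [blockF, abs_div, abs_mul, abs_of_nonneg hη]
  refine (div_le_self (by positivity) hden).trans ?_
  refine (mul_le_mul_of_nonneg_left hnum hη).trans (le_of_eq ?_)
  ring

/-- Decay in the first index only: it puts the columns of K in ℓ¹ and, the majorant being bounded,
bounds K uniformly. -/
theorem exists_abs_blockK_le {η : ℝ} (hη : 0 ≤ η) :
    ∃ C, 0 ≤ C ∧ ∀ p q, |blockK η p q| ≤ C * majorant η p := by
  set A := (∑' n, |besselInt η n|) * (besselConst η * Real.exp η)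
  set B := 2 * η * (besselConst η * Real.exp η) * (besselConst η * Real.exp η)
  have hB0 : 0 ≤ besselConst η * Real.exp η := mul_nonneg (besselConst_nonneg η) (Real.exp_nonneg η)
  have hA : 0 ≤ A := mul_nonneg (tsum_nonneg fun _ => abs_nonneg _) hB0
  have hB : 0 ≤ B := mul_nonneg (mul_nonneg (by linarith) hB0) hB0
  have key : ∀ (k : ℕ) (D y : ℝ), D ≤ A + B → y ≤ D * expCoeff η k →
      y ≤ (A + B) * ((η + 1) * expCoeff η k) := by
    intro k D y hD hy
    have he := expCoeff_nonneg hη (k : ℤ)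
    refine hy.trans (mul_le_mul hD ?_ he (by linarith))
    nlinarith
  refine ⟨A + B, by linarith, ?_⟩
  rintro (k | k) (l | l)
  · exact key k A _ (by linarith) (abs_blockG_le hη k l)
  · exact key k B _ (by linarith) (abs_blockF_le hη k l)
  · exact key k B _ (by linarith) (by simpa [blockK] using abs_blockF_le hη k l)
  · exact key k A _ (by linarith) (abs_blockG_le hη k l)

/-- The relation `K + L K = L`. -/
theorem hasSum_blockL_mul_blockK {η : ℝ} (hη : 0 ≤ η) (p q : ℕ ⊕ ℕ) :
    HasSum (fun z => blockL η p z * blockK η z q) (blockL η p q - blockK η p q) := by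
  rcases p with k | k <;> rcases q with l | l
  -- The diagonal blocks are DF = G; the two mixed cases below are F + DG = D.
  · have h2 := (hasSum_blockD_mul_blockF hη k l).neg
    refine hasSum_of_eq (hasSum_sum_elim (f := fun z => blockL η (Sum.inl k) z *
      blockK η z (Sum.inl l)) (s := 0) (t := -blockG η k l) ?_ ?_) ?_ fun _ => rfl
    · simp [blockL]
    · simpa [blockL, blockK] using h2
    · simp [blockL, blockK]
  · have h2 := hasSum_blockD_mul_blockG hη k l
    refine hasSum_of_eq (hasSum_sum_elim (f := fun z => blockL η (Sum.inl k) z *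
      blockK η z (Sum.inr l)) (s := 0) (t := blockD η k l - blockF η k l) ?_ ?_) ?_ fun _ => rfl
    · simp [blockL]
    · simpa [blockL, blockK] using h2
    · simp [blockL, blockK]
  · have h2 := (hasSum_blockD_mul_blockG hη k l).neg
    refine hasSum_of_eq (hasSum_sum_elim (f := fun z => blockL η (Sum.inr k) z *
      blockK η z (Sum.inl l)) (s := -(blockD η k l - blockF η k l)) (t := 0) ?_ ?_) ?_
      fun _ => rfl
    · simpa [blockL, blockK] using h2
    · simp [blockL]
    · simp [blockL, blockK, add_comm, sub_eq_add_neg]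
  · have h2 := (hasSum_blockD_mul_blockF hη k l).neg
    refine hasSum_of_eq (hasSum_sum_elim (f := fun z => blockL η (Sum.inr k) z *
      blockK η z (Sum.inr l)) (s := -blockG η k l) (t := 0) ?_ ?_) ?_ fun _ => rfl
    · simpa [blockL, blockK] using h2
    · simp [blockL]
    · simp [blockL, blockK]

theorem tsum_minor_blockL {θ : ℝ} (hθ : 0 < θ) (X : Finset (ℕ ⊕ ℕ)) :
    ∑' Y, (if X ⊆ Y then minor (blockL √θ) Y else 0) = Real.exp θ * minor (blockK √θ) X := by
  have hη := Real.sqrt_nonneg θ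
  obtain ⟨C, hC, hK⟩ := exists_abs_blockK_le hη
  have hle : ∀ p, majorant √θ p ≤ ∑' p, majorant √θ p := fun p =>
    (summable_majorant √θ).le_tsum p fun q _ => majorant_nonneg hη q
  exact tsum_minor_eq (summable_majorant √θ) (majorant_nonneg hη) (abs_blockL_le hη)
    (blockL_antisymm √θ) (C := C * ∑' p, majorant √θ p)
    (fun p q => (hK p q).trans (mul_le_mul_of_nonneg_left (hle p) hC))
    (hasSum_blockL_mul_blockK hη) (hasSum_minor_blockL hθ) (minor_blockL_nonneg hθ) X

/-! ### The main statements in terms of the kernels on `ℤ + 1/2` -/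

/-- The points of a finite configuration as elements of `ℕ ⊕ ℕ`. -/
def pointEmbedding {s : ℕ} (x : Fin s → halfIntegers) (hx : Function.Injective x) :
    Fin s ↪ ℕ ⊕ ℕ :=
  ⟨fun i => coordEquiv.symm (x i), coordEquiv.symm.injective.comp hx⟩

theorem coord_pointEmbedding {s : ℕ} (x : Fin s → halfIntegers) (hx : Function.Injective x)
    (i : Fin s) : coord (pointEmbedding x hx i) = x i := by
  rw [← coe_coordEquiv]
  exact congrArg Subtype.val (coordEquiv.apply_symm_apply (x i))

theorem range_eq_coord_image {s : ℕ} (x : Fin s → halfIntegers) (hx : Function.Injective x) :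
    Set.range (fun i => (x i : ℝ)) = coord '' (Finset.univ.map (pointEmbedding x hx)) := by
  ext y
  simp [← coord_pointEmbedding x hx]

theorem correlation_eq {θ : ℝ} (hθ : 0 < θ) {s : ℕ} (x : Fin s → halfIntegers)
    (hx : Function.Injective x) : correlation θ (Set.range fun i => (x i : ℝ)) =
      (Matrix.of fun i j => kernelK θ (x i) (x j)).det := by
  classical
  have hset : {μ | Set.range (fun i => (x i : ℝ)) ⊆ modifiedFrobenius μ} =
      {μ | Finset.univ.map (pointEmbedding x hx) ⊆ frobSet μ} := by
    ext μ
    simp only [Set.mem_ofPred_eq]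
    rw [range_eq_coord_image x hx, modifiedFrobenius_eq,
      Set.image_subset_image_iff coord_injective, Finset.coe_subset]
  have h := poissonizedPlancherel_real hθ fun Y => Finset.univ.map (pointEmbedding x hx) ⊆ Y
  rw [correlation, hset, h]
  have h2 := tsum_minor_blockL hθ (Finset.univ.map (pointEmbedding x hx))
  rw [minor_univ_map] at h2
  simp only [← kernelK_coord hθ, coord_pointEmbedding] at h2
  rw [h2, ← mul_assoc, ← Real.exp_add, neg_add_cancel, Real.exp_zero, one_mul]

theorem configuration_probability {θ : ℝ} (hθ : 0 < θ) {s : ℕ} (x : Fin s → halfIntegers)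
    (hx : Function.Injective x) : (poissonizedPlancherel θ).real
      {μ | modifiedFrobenius μ = Set.range fun i => (x i : ℝ)} =
      Real.exp (-θ) * (Matrix.of fun i j => kernelL θ (x i) (x j)).det := by
  classical
  have hset : {μ | modifiedFrobenius μ = Set.range (fun i => (x i : ℝ))} =
      {μ | frobSet μ = Finset.univ.map (pointEmbedding x hx)} := by
    ext μ
    simp only [Set.mem_ofPred_eq]
    rw [range_eq_coord_image x hx, modifiedFrobenius_eq, coord_injective.image_injective.eq_iff,
      Finset.coe_inj]
  have h := poissonizedPlancherel_real hθ fun Y => Y = Finset.univ.map (pointEmbedding x hx)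
  rw [hset, h, tsum_eq_single (Finset.univ.map (pointEmbedding x hx))]
  · rw [if_pos rfl, minor_univ_map]
    simp only [← kernelL_coord hθ, coord_pointEmbedding]
  · intro Y hY
    rw [if_neg hY]

theorem exists_kernel_operators {θ : ℝ} (hθ : 0 < θ) :
    ∃ L K : HalfIntegerSpace →L[ℝ] HalfIntegerSpace, IsOperatorOfKernel L (kernelL θ) ∧
      IsOperatorOfKernel K (kernelK θ) ∧ IsUnit (1 + L) ∧ K = L * Ring.inverse (1 + L) := by
  classical
  have hη := Real.sqrt_nonneg θ
  obtain ⟨C, hC, hK⟩ := exists_abs_blockK_le hη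
  have hL' : ∀ x y : halfIntegers, kernelL θ x y =
      blockL √θ (coordEquiv.symm x) (coordEquiv.symm y) := fun x y => by
    rw [← kernelL_coord hθ, ← coe_coordEquiv, ← coe_coordEquiv, Equiv.apply_symm_apply,
      Equiv.apply_symm_apply]
  have hK' : ∀ x y : halfIntegers, kernelK θ x y =
      blockK √θ (coordEquiv.symm x) (coordEquiv.symm y) := fun x y => by
    rw [← kernelK_coord hθ, ← coe_coordEquiv, ← coe_coordEquiv, Equiv.apply_symm_apply,
      Equiv.apply_symm_apply]
  refine exists_resolvent (ι := halfIntegers) (L := fun x y => kernelL θ x y)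
    (K := fun x y => kernelK θ x y) (a := fun x => majorant √θ (coordEquiv.symm x)) (C := C)
    ((coordEquiv.symm.summable_iff (f := majorant √θ)).mpr (summable_majorant √θ))
    (fun x => majorant_nonneg hη _)
    (fun x y => ?_) (fun x y => ?_) (fun x y => ?_) fun x y => ?_
  · rw [hL']; exact abs_blockL_le hη _ _
  · rw [hL', hL']; exact blockL_antisymm _ _ _
  · rw [hK']; exact hK _ _
  · rw [hL', hK']
    refine hasSum_of_eq ((coordEquiv.symm.hasSum_iff).mpr
      (hasSum_blockL_mul_blockK hη (coordEquiv.symm x) (coordEquiv.symm y))) rfl fun z => ?_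
    simp only [hL', hK', Function.comp_apply]

end PoissonizedPlancherel

end

theorem mainTheorem3 (θ : ℝ) (hθ : 0 < θ) :
    -- `M^θ` is a probability measure
    IsProbabilityMeasure (PoissonizedPlancherel.poissonizedPlancherel θ) ∧
    -- the diagonal values of `K` are well defined limits
    (∀ x ∈ PoissonizedPlancherel.halfIntegers,
      Tendsto (fun t : ℝ => √θ * (PoissonizedPlancherel.kPlus θ |x| |t| / (|x| - |t|)))
        (𝓝[≠] x) (𝓝 (PoissonizedPlancherel.kernelK θ x x))) ∧
    -- the determinantal formula for the correlation functions
    (∀ (s : ℕ) (x : Fin s → PoissonizedPlancherel.halfIntegers), Function.Injective x →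
      PoissonizedPlancherel.correlation θ (Set.range fun i => (x i : ℝ)) =
        (Matrix.of fun i j => PoissonizedPlancherel.kernelK θ (x i) (x j)).det) ∧
    -- the modified Frobenius coordinates form the `L`-ensemble with kernel `L`
    (∀ (s : ℕ) (x : Fin s → PoissonizedPlancherel.halfIntegers), Function.Injective x →
      (PoissonizedPlancherel.poissonizedPlancherel θ).real
          {μ | PoissonizedPlancherel.modifiedFrobenius μ = Set.range fun i => (x i : ℝ)} =
        Real.exp (-θ) *
          (Matrix.of fun i j => PoissonizedPlancherel.kernelL θ (x i) (x j)).det) ∧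
    -- `K = L (1 + L)⁻¹` as bounded operators on `ℓ²(ℤ + 1/2)`
    (∃ L K : PoissonizedPlancherel.HalfIntegerSpace →L[ℝ] PoissonizedPlancherel.HalfIntegerSpace,
      PoissonizedPlancherel.IsOperatorOfKernel L (PoissonizedPlancherel.kernelL θ) ∧
      PoissonizedPlancherel.IsOperatorOfKernel K (PoissonizedPlancherel.kernelK θ) ∧
      IsUnit (1 + L) ∧ K = L * Ring.inverse (1 + L)) := by
  refine ⟨PoissonizedPlancherel.isProbabilityMeasure_poissonizedPlancherel hθ, fun x hx => ?_,
    fun s x hx => PoissonizedPlancherel.correlation_eq hθ x hx,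
    fun s x hx => PoissonizedPlancherel.configuration_probability hθ x hx,
    PoissonizedPlancherel.exists_kernel_operators hθ⟩
  obtain ⟨p, rfl⟩ := PoissonizedPlancherel.exists_coord_eq hx
  rw [PoissonizedPlancherel.kernelK_coord hθ]
  exact PoissonizedPlancherel.tendsto_kernelK_diag hθ p
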